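/- Let $0<p<1$ be fixed, and let $\gamma$ be a fixed graph on the vertex set $\{1,\dots,k\}$ with $h\ge 1$ edges (so $k\ge 2$). For $n\in\mathbb N$ let $\Gamma=\Gamma(n,p)$ be the Erdős–Rényi random graph on $n$ vertices, in which every pair of distinct vertices is an edge independently with probability $p$, and let $X^{(n)}_\gamma$ be the number of copies of $\gamma$ contained in $\Gamma$, that is, the number of lists $(a_1,\dots,a_k)$ of distinct vertices of $\Gamma$ such that $\{a_u,a_v\}$ is an edge of $\Gamma$ whenever $\{u,v\}$ is an edge of $\gamma$. Put $$\alpha_n=n^2,\qquad \beta_n=n^{k-2},\qquad \sigma^2=2h^2p^{2h-1}(1-p)\quad(\sigma>0),$$ $$L=12\,h^3(h-1)\,p^{3h-2}(1-p)^2+4\,h^3\,p^{3h-2}(1-p)(1-2p).$$ 1. The random variables $(X^{(n)}_\gamma-\mathbb E[X^{(n)}_\gamma])/(\alpha_n^{1/3}\beta_n)$ converge mod-Gaussian on the whole of $\mathbb C$, with parameters $t_n=\sigma^2\alpha_n^{1/3}$ and limiting function $\psi(z)=\exp(Lz^3/6)$. That is, $t_n\to+\infty$ and, locally uniformly in $z\in\mathbb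 C$, $$\exp\!\left(-t_n\frac{z^2}{2}\right)\,\mathbb E\!\left[\exp\!\left(z\,\frac{X^{(n)}_\gamma-\mathbb E[X^{(n)}_\gamma]}{\alpha_n^{1/3}\beta_n}\right)\right]\longrightarrow \exp\!\left(\frac{L}{6}z^3\right).$$ 2. For every sequence of real numbers $T=T_n$ with $(\alpha_n)^{1/2}\ll T\ll(\alpha_n)^{3/4}$, i.e. $T_n/n\to+\infty$ and $T_n/n^{3/2}\to0$, one has, as $n\to\infty$, $$\mathbb P\!\left[\frac{X^{(n)}_\gamma-\mathbb E[X^{(n)}_\gamma]}{\beta_n}\ge T\right]=\frac{\mathrm e^{-\frac{T^2}{2\sigma^2\alpha_n}}}{\sqrt{2\pi\frac{T^2}{\sigma^2\alpha_n}}}\,\exp\!\left(\frac{L\,T^3}{6\,\sigma^6\,(\alpha_n)^2}\right)(1+o(1)).$$ -/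

import Mathlib

open MeasureTheory ProbabilityTheory Filter Topology

noncomputable section

namespace ModGauss

/-- The strip `{z : -c < Re z < c}`, where `0 < c ≤ +∞`; for `c = ⊤` it is the whole plane. -/
def strip (c : EReal) : Set ℂ := {z | ((|z.re| : ℝ) : EReal) < c}

/-- A probability distribution on `ℝ` is infinitely divisible if, for every `m ≥ 1`, it is the law
of a sum of `m` independent and identically distributed real random variables. -/
def InfinitelyDivisible (φ : Measure ℝ) : Prop :=
  IsProbabilityMeasure φ ∧ ∀ m : ℕ, 1 ≤ m → ∃ ν : Measure ℝ, IsProbabilityMeasure ν ∧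
    (Measure.pi (fun _ : Fin m => ν)).map (fun x => ∑ i, x i) = φ

/-- The random variables `X n`, defined on the probability spaces `(Ω n, P n)`, converge mod-`φ`
on the strip of half-width `c`, with parameters `t n` and limiting function `ψ`; the moment
generating function of `φ` is `exp ∘ η`. -/
structure ConvergesModPhi (c : EReal) (φ : Measure ℝ) (η : ℂ → ℂ)
    {Ω : ℕ → Type*} [∀ n, MeasurableSpace (Ω n)] (P : ∀ n, Measure (Ω n))
    (X : ∀ n, Ω n → ℝ) (t : ℕ → ℝ) (ψ : ℂ → ℂ) : Prop where
  c_pos : 0 < c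
  isProbabilityMeasure : ∀ n, IsProbabilityMeasure (P n)
  aemeasurable : ∀ n, AEMeasurable (X n) (P n)
  /-- The moment generating functions `E[exp (z X n)]` exist in the strip. -/
  integrable : ∀ n, ∀ z ∈ strip c, Integrable (fun ω => Complex.exp (z * X n ω)) (P n)
  /-- `φ` is a non-constant infinitely divisible distribution. -/
  infinitelyDivisible : InfinitelyDivisible φ
  nonconstant : ∀ a : ℝ, φ ≠ Measure.dirac a
  /-- The moment generating function of `φ` converges on the strip and equals `exp (η z)`. -/
  integrable_limit : ∀ z ∈ strip c, Integrable (fun x : ℝ => Complex.exp (z * x)) φ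
  exponent_analytic : AnalyticOnNhd ℂ η (strip c)
  exponent_zero : η 0 = 0
  mgf_limit : ∀ z ∈ strip c, complexMGF id φ z = Complex.exp (η z)
  /-- `ψ` is analytic on the strip and does not vanish on its real part. -/
  psi_analytic : AnalyticOnNhd ℂ ψ (strip c)
  psi_ne_zero : ∀ x : ℝ, (x : ℂ) ∈ strip c → ψ x ≠ 0
  parameters : Tendsto t atTop atTop
  tendsto : TendstoLocallyUniformlyOn
    (fun n z => Complex.exp (-(t n : ℂ) * η z) * complexMGF (X n) (P n) z) ψ atTop (strip c)

/-- Mod-Gaussian convergence: mod-`φ` convergence for `φ` the standard Gaussian distribution. -/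
def ConvergesModGaussian (c : EReal)
    {Ω : ℕ → Type*} [∀ n, MeasurableSpace (Ω n)] (P : ∀ n, Measure (Ω n))
    (X : ∀ n, Ω n → ℝ) (t : ℕ → ℝ) (ψ : ℂ → ℂ) : Prop :=
  ConvergesModPhi c (gaussianReal 0 1) (fun z => z ^ 2 / 2) P X t ψ

/-- The number `h` of edges of the graph `γ`. -/
def edgeCount {k : ℕ} (γ : SimpleGraph (Fin k)) : ℕ := γ.edgeSet.ncard

/-- The number of copies of `γ` contained in the graph `Γ` on `n` vertices: the number of lists
`(a₁, …, a_k)` of distinct vertices of `Γ` such that `{a_u, a_v}` is an edge of `Γ` whenever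
`{u, v}` is an edge of `γ`. -/
def subgraphCount {k : ℕ} (γ : SimpleGraph (Fin k)) (n : ℕ) (Γ : SimpleGraph (Fin n)) : ℝ :=
  (Γ.labelledCopyCount γ : ℝ)

/-- The subgraph count centered at its expectation in the random graph `G(n, p)`. -/
def centeredCount {k : ℕ} (γ : SimpleGraph (Fin k)) (p : unitInterval) (n : ℕ)
    (Γ : SimpleGraph (Fin n)) : ℝ :=
  subgraphCount γ n Γ - ∫ Γ', subgraphCount γ n Γ' ∂(SimpleGraph.binomialRandom (Fin n) p)

/-- `α n = n²`. -/
def alpha (n : ℕ) : ℝ := (n : ℝ) ^ 2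

/-- `β n = n^(k-2)`, for `k ≥ 2` (a graph with an edge has at least two vertices). -/
def beta (k n : ℕ) : ℝ := (n : ℝ) ^ (k - 2)

/-- `σ² = 2 h² p^(2h-1) (1-p)`, for `h ≥ 1`. -/
def sigmaSq (h : ℕ) (p : ℝ) : ℝ := 2 * (h : ℝ) ^ 2 * p ^ (2 * h - 1) * (1 - p)

/-- `L = 12 h³ (h-1) p^(3h-2) (1-p)² + 4 h³ p^(3h-2) (1-p) (1-2p)`, for `h ≥ 1`. -/
def thirdCoeff (h : ℕ) (p : ℝ) : ℝ :=
  12 * (h : ℝ) ^ 3 * ((h : ℝ) - 1) * p ^ (3 * h - 2) * (1 - p) ^ 2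
    + 4 * (h : ℝ) ^ 3 * p ^ (3 * h - 2) * (1 - p) * (1 - 2 * p)

end ModGauss

end

/-! Put Y = (X − E X)/β_n. Both claims follow from one estimate, `CubicExpansion`: on a disc |w| ≤ c
independent of n, log E e^{wY} = n²(σ²w²/2 + Lw³/6) + O(n|w|² + n²|w|⁴).

The logarithm exists because the moment generating function has no zero near 0. Since X is a sum of
indicators of copies, E e^{wX/β_n} is a partition function ∑_B u^|B| p^|⋃B| over sets B of copies,
with u = e^{w/β_n} − 1. A copy has h edges and a pair of vertices lies in D = O(β_n) copies, so |u|D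
is small for small w; revealing the edges one at a time then keeps the sum away from zero
(`partitionSum_ne_zero`). As |Y| ≤ n², the logarithm has real part at most n² on a fixed disc, and
Borel–Carathéodory with Cauchy's estimates makes the Taylor remainder O(n²|w|⁴)
(`exists_cubic_expansion`).

The coefficients are the second and third moments of Y, found by counting pairs and triples of
copies by overlap. Every pair of vertices lies in 2h(n−2)_{k−2} copies, two different pairs in only
O(β_n/n) common ones. Hence overlaps in single edges give the leading terms σ²n² and Ln², and all
others cost O(n) (`exists_abs_second_moment_sub_le`, `exists_abs_third_moment_sub_le`). Mod-Gaussian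
convergence is the expansion at w = z/n^{2/3}.

For the tail, tilt by e^{hY} with h = T/(σ²n²). The condition T ≪ n^{3/2} says nh² → 0, so the
tilted variable (Y − T)/(σn) is asymptotically standard Gaussian. The quantity h(Y − T) lives on the
scale s = T/(σn) → ∞, and P[Y ≥ T] only sees its density at scale 1. To reach that scale, tilt also
by e^{−|h(Y−T)|}: its Fourier transform is a Cauchy kernel, whose decay controls frequencies beyond
δn, where the expansion says nothing. The doubly tilted law converges to the Laplace law, which
gives [0,∞) mass 1/2. On {Y ≥ T} the double tilt has constant density, proportional to e^{hT}, so
this mass is P[Y ≥ T] times explicit factors (`tendsto_tail_of_tiltedCharFun`). -/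

noncomputable section

namespace ModGauss


/-! ### Zero-freeness of the partition function of copies -/

section PartitionSum

variable {E ι : Type*} [DecidableEq E]

/-- The expectation of `∏ a ∈ A, (1 + u * 1[I a \ F ⊆ S])` for a random set `S` containing every
element independently with probability `p`. -/
def partitionSum (p : ℝ) (u : ℂ) (I : ι → Finset E) (F : Finset E) (A : Finset ι) : ℂ :=
  ∑ B ∈ A.powerset, u ^ B.card * (p : ℂ) ^ (B.biUnion I \ F).card

/-- Subsets containing `a` carry an extra weight `u` and force `I a`, which afterwards is free, as
if it belonged to `F`. -/
lemma partitionSum_insert [DecidableEq ι] (p : ℝ) (u : ℂ) (I : ι → Finset E) (F : Finset E)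
    {A : Finset ι} {a : ι} (ha : a ∉ A) :
    partitionSum p u I F (insert a A) = partitionSum p u I F A
      + u * (p : ℂ) ^ (I a \ F).card * partitionSum p u I (F ∪ I a) A := by
  unfold partitionSum
  rw [Finset.sum_powerset_insert ha, Finset.mul_sum]
  congr 1
  refine Finset.sum_congr rfl fun B hB => ?_
  have haB : a ∉ B := fun h => ha (Finset.mem_powerset.1 hB h)
  have hcard : ((insert a B).biUnion I \ F).card
      = (I a \ F).card + (B.biUnion I \ (F ∪ I a)).card := by
    rw [← Finset.card_union_of_disjoint]
    · congr 1
      ext x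
      simp only [Finset.biUnion_insert, Finset.mem_sdiff, Finset.mem_union]
      tauto
    · rw [Finset.disjoint_left]
      intro x hx hx'
      simp only [Finset.mem_sdiff, Finset.mem_union] at hx hx'
      tauto
  rw [Finset.card_insert_of_notMem haB, hcard, pow_succ, pow_add]
  ring

/-- Reveal whether `i` is in the random set: if present it joins `F`; if absent, every set through
`i` is lost and `i` no longer matters. -/
lemma partitionSum_condition (p : ℝ) (u : ℂ) (I : ι → Finset E) {F : Finset E} (A : Finset ι)
    {i : E} (hi : i ∉ F) :
    partitionSum p u I F A = p * partitionSum p u I (insert i F) A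
      + (1 - p) * partitionSum p u I (insert i F) (A.filter (i ∉ I ·)) := by
  unfold partitionSum
  have hsub : (A.filter (i ∉ I ·)).powerset = A.powerset.filter (fun B => i ∉ B.biUnion I) := by
    ext B
    simp only [Finset.mem_powerset, Finset.mem_filter, Finset.mem_biUnion, not_exists, not_and]
    constructor
    · intro h
      exact ⟨fun x hx => (Finset.mem_filter.1 (h hx)).1, fun x hx => (Finset.mem_filter.1 (h hx)).2⟩
    · intro h x hx
      exact Finset.mem_filter.2 ⟨h.1 hx, h.2 x hx⟩
  rw [hsub, Finset.sum_filter, Finset.mul_sum, Finset.mul_sum, ← Finset.sum_add_distrib]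
  refine Finset.sum_congr rfl fun B _ => ?_
  by_cases h : i ∈ B.biUnion I
  · have h1 : (B.biUnion I \ F).card = (B.biUnion I \ insert i F).card + 1 := by
      rw [← Finset.card_insert_of_notMem (a := i) (s := B.biUnion I \ insert i F) (by simp)]
      congr 1
      ext x
      by_cases hx : x = i
      · subst hx; simp only [Finset.mem_sdiff, Finset.mem_insert, h, hi]; tauto
      · simp only [Finset.mem_sdiff, Finset.mem_insert, hx]; tauto
    rw [h1, pow_succ]
    simp only [h, not_true_eq_false, if_false]
    ring
  · have h1 : B.biUnion I \ F = B.biUnion I \ insert i F := by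
      ext x
      by_cases hx : x = i
      · subst hx; simp only [Finset.mem_sdiff, Finset.mem_insert, h]; tauto
      · simp only [Finset.mem_sdiff, Finset.mem_insert, hx]; tauto
    rw [h1]
    simp only [h, not_false_eq_true, if_true]
    ring

/-- The restrictions on `partitionSum` propagated by the induction in
`partitionSum_ne_zero`. -/
def RatioBound (p : ℝ) (u : ℂ) (I : ι → Finset E) (F : Finset E) : Prop :=
  ∀ A : Finset ι, partitionSum p u I F A ≠ 0 ∧
    ∀ i, ‖partitionSum p u I (insert i F) A‖ ≤ 2 * ‖partitionSum p u I F A‖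

lemma norm_partitionSum_union_le {p : ℝ} {u : ℂ} {I : ι → Finset E} {F : Finset E}
    (h : ∀ F', F ⊆ F' → RatioBound p u I F') (A : Finset ι) (J : Finset E) :
    ‖partitionSum p u I (F ∪ J) A‖ ≤ 2 ^ J.card * ‖partitionSum p u I F A‖ := by
  induction J using Finset.induction_on with
  | empty => simp
  | insert j J hj ih =>
    rw [Finset.union_insert, Finset.card_insert_of_notMem hj, pow_succ]
    have := (h (F ∪ J) Finset.subset_union_left A).2 j
    linarith

/-- Sets are added one at a time. By `partitionSum_insert` a new set contributes `u` times a sum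
whose `F` has grown by at most `d` elements, each costing a factor 2; so one insertion multiplies
the modulus by at most `1 + ‖u‖ * 2 ^ d`. -/
lemma norm_partitionSum_union_sub_le [DecidableEq ι] {p : ℝ} (hp0 : 0 ≤ p) (hp1 : p ≤ 1) {u : ℂ}
    {I : ι → Finset E} {d : ℕ} (hI : ∀ a, (I a).card ≤ d) {F : Finset E}
    (h : ∀ F', F ⊆ F' → RatioBound p u I F') (A B : Finset ι) (hAB : Disjoint A B) :
    ‖partitionSum p u I F (A ∪ B) - partitionSum p u I F A‖
      ≤ ((1 + ‖u‖ * 2 ^ d) ^ B.card - 1) * ‖partitionSum p u I F A‖ := by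
  induction B using Finset.induction_on with
  | empty => simp
  | insert b B hb ih =>
    have hbA : b ∉ A := fun hA => (Finset.disjoint_left.1 hAB hA) (Finset.mem_insert_self b B)
    have hAB' : Disjoint A B := hAB.mono_right (Finset.subset_insert b B)
    have ih := ih hAB'
    set z := partitionSum p u I F A
    set z' := partitionSum p u I F (A ∪ B)
    rw [Finset.union_insert, partitionSum_insert _ _ _ _ (by simp [hb, hbA]),
      Finset.card_insert_of_notMem hb, pow_succ]
    set q := (1 + ‖u‖ * 2 ^ d) ^ B.card
    have h1 : ‖u * (p : ℂ) ^ (I b \ F).card * partitionSum p u I (F ∪ I b) (A ∪ B)‖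
        ≤ ‖u‖ * 2 ^ d * ‖z'‖ := by
      rw [norm_mul, norm_mul, norm_pow, Complex.norm_real, Real.norm_of_nonneg hp0]
      have e1 : p ^ (I b \ F).card ≤ 1 := pow_le_one₀ hp0 hp1
      have e2 := norm_partitionSum_union_le h (A ∪ B) (I b)
      have e3 : (2 : ℝ) ^ (I b).card ≤ 2 ^ d := pow_le_pow_right₀ (by norm_num) (hI b)
      calc _ ≤ ‖u‖ * 1 * (2 ^ d * ‖z'‖) := by
            gcongr
            exact e2.trans (by gcongr)
        _ = _ := by ring
    have h2 : ‖z'‖ ≤ q * ‖z‖ := by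
      have := norm_le_norm_add_norm_sub' z' z
      nlinarith
    have h3 : z' + u * (p : ℂ) ^ (I b \ F).card * partitionSum p u I (F ∪ I b) (A ∪ B) - z
        = (z' - z) + u * (p : ℂ) ^ (I b \ F).card * partitionSum p u I (F ∪ I b) (A ∪ B) := by
      ring
    change ‖z' + _ - z‖ ≤ _
    rw [h3]
    refine (norm_add_le _ _).trans ((add_le_add ih h1).trans ?_)
    have : ‖u‖ * 2 ^ d * ‖z'‖ ≤ ‖u‖ * 2 ^ d * (q * ‖z‖) := by gcongr
    nlinarith

/-- After revealing `i`, the two branches differ by at most `D` sets, so they are nearly equal and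
their convex combination can neither vanish nor fall below half the branch where `i` is present. -/
lemma ratioBound_of_forall_superset [DecidableEq ι] {p : ℝ} (hp0 : 0 ≤ p) (hp1 : p ≤ 1) {u : ℂ}
    {I : ι → Finset E} {d D : ℕ} (hI : ∀ a, (I a).card ≤ d)
    (hD : ∀ (e : E) (A : Finset ι), (A.filter (e ∈ I ·)).card ≤ D)
    (hu : ‖u‖ * 2 ^ d * D ≤ 1 / 4) {F : Finset E}
    (h : ∀ F', F ⊂ F' → RatioBound p u I F') (hF : ∃ i, i ∉ F) : RatioBound p u I F := by
  have main : ∀ i ∉ F, ∀ A, partitionSum p u I F A ≠ 0 ∧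
      ‖partitionSum p u I (insert i F) A‖ ≤ 2 * ‖partitionSum p u I F A‖ := by
    intro i hi A
    have hiF : F ⊂ insert i F := Finset.ssubset_insert hi
    have h' : ∀ F', insert i F ⊆ F' → RatioBound p u I F' := fun F' hF' =>
      h F' (hiF.trans_subset hF')
    set A0 := A.filter (i ∉ I ·)
    set A1 := A.filter (i ∈ I ·)
    have hA : A0 ∪ A1 = A := by
      rw [Finset.union_comm]; exact Finset.filter_union_filter_not_eq _ _
    have hdisj : Disjoint A0 A1 := (Finset.disjoint_filter_filter_not A A _).symm
    have e1 := norm_partitionSum_union_sub_le hp0 hp1 hI h' A0 A1 hdisj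
    rw [hA] at e1
    have e2 := partitionSum_condition p u I A hi
    have hne := (h' _ subset_rfl A).1
    set z := partitionSum p u I (insert i F) A
    change _ = _ + _ * partitionSum p u I (insert i F) A0 at e2
    set z0 := partitionSum p u I (insert i F) A0
    -- The budget 1/4 enters here: the power is at most `exp (1/4)`, which is at most 4/3 because
    -- `exp (-1/4) ≥ 3/4`.
    have e3 : (1 + ‖u‖ * 2 ^ d) ^ A1.card ≤ 4 / 3 := by
      have x1 : (1 + ‖u‖ * 2 ^ d) ^ A1.card ≤ (1 + ‖u‖ * 2 ^ d) ^ D :=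
        pow_le_pow_right₀ (le_add_of_nonneg_right (by positivity)) (hD i A)
      have x2 : (1 + ‖u‖ * 2 ^ d) ^ D ≤ Real.exp (‖u‖ * 2 ^ d * D) := by
        rw [mul_comm _ (D : ℝ), Real.exp_nat_mul]
        gcongr
        rw [add_comm]
        exact Real.add_one_le_exp _
      have x3 : Real.exp (‖u‖ * 2 ^ d * D) ≤ Real.exp (1 / 4) := Real.exp_le_exp.2 hu
      have x4 : Real.exp (1 / 4) ≤ 4 / 3 := by
        have := Real.add_one_le_exp (-(1 / 4) : ℝ)
        rw [Real.exp_neg] at this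
        have hpos := Real.exp_pos (1 / 4)
        have h2 : (3 / 4 : ℝ) ≤ (Real.exp (1 / 4))⁻¹ := by linarith
        have h3 := mul_le_mul_of_nonneg_right h2 hpos.le
        rw [inv_mul_cancel₀ hpos.ne'] at h3
        linarith
      linarith
    have e4 : ‖z - z0‖ ≤ 1 / 3 * ‖z0‖ := e1.trans (by gcongr; linarith)
    -- A deviation of at most a third of `z0` is at most half of `z`.
    have e5 : ‖z - z0‖ ≤ 1 / 2 * ‖z‖ := by
      have := norm_le_norm_add_norm_sub z z0
      linarith
    have e6 : partitionSum p u I F A = z - (1 - p) * (z - z0) := by rw [e2]; ring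
    have e7 : ‖(1 - p : ℂ) * (z - z0)‖ ≤ 1 / 2 * ‖z‖ := by
      rw [norm_mul, show (1 - p : ℂ) = ((1 - p : ℝ) : ℂ) by push_cast; rfl, Complex.norm_real,
        Real.norm_of_nonneg (by linarith)]
      calc _ ≤ 1 * ‖z - z0‖ := by gcongr; linarith
        _ ≤ _ := by linarith
    have e8 : 1 / 2 * ‖z‖ ≤ ‖partitionSum p u I F A‖ := by
      rw [e6]
      have := norm_sub_norm_le z ((1 - p : ℂ) * (z - z0))
      linarith
    have hz : 0 < ‖z‖ := norm_pos_iff.2 hne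
    exact ⟨norm_pos_iff.1 (by linarith), by linarith⟩
  obtain ⟨i₀, hi₀⟩ := hF
  intro A
  refine ⟨(main i₀ hi₀ A).1, fun i => ?_⟩
  by_cases hi : i ∈ F
  · rw [Finset.insert_eq_of_mem hi]
    linarith [norm_nonneg (partitionSum p u I F A)]
  · exact (main i hi A).2

lemma partitionSum_univ [Fintype E] (p : ℝ) (u : ℂ) (I : ι → Finset E) (A : Finset ι) :
    partitionSum p u I Finset.univ A = (1 + u) ^ A.card := by
  unfold partitionSum
  simp only [← Finset.top_eq_univ, sdiff_top, Finset.bot_eq_empty, Finset.card_empty, pow_zero,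
    mul_one]
  rw [Finset.sum_powerset_apply_card (fun m => u ^ m), add_comm (1 : ℂ), add_pow]
  simp [mul_comm]

/-- If every `I a` has at most `d` elements, every element lies in at most `D` of the sets `I a`,
and `u` is small, then the partition sum does not vanish. -/
theorem partitionSum_ne_zero [DecidableEq ι] [Fintype E] {p : ℝ} (hp0 : 0 ≤ p) (hp1 : p ≤ 1) {u : ℂ}
    {I : ι → Finset E} {d D : ℕ} (hI : ∀ a, (I a).card ≤ d)
    (hD : ∀ (e : E) (A : Finset ι), (A.filter (e ∈ I ·)).card ≤ D)
    (hu : ‖u‖ * 2 ^ d * D ≤ 1 / 4) (hu1 : ‖u‖ < 1) (A : Finset ι) :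
    partitionSum p u I ∅ A ≠ 0 := by
  suffices h : ∀ F, RatioBound p u I F from (h ∅ A).1
  intro F
  -- Downward induction: `F` increases towards the full set, where nothing is random and the sum is
  -- `(1 + u) ^ A.card`.
  induction F using WellFounded.induction (r := fun a b : Finset E => b ⊂ a)
    (wellFounded_gt (α := Finset E)) with
  | _ F ih =>
    by_cases hF : ∃ i, i ∉ F
    · exact ratioBound_of_forall_superset hp0 hp1 hI hD hu (fun F' h => ih F' h) hF
    · push Not at hF
      have : F = Finset.univ := Finset.eq_univ_iff_forall.2 hF
      subst this
      intro A
      refine ⟨?_, fun i => ?_⟩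
      · rw [partitionSum_univ]
        refine pow_ne_zero _ fun h => ?_
        have : u = -1 := by linear_combination h
        rw [this] at hu1
        simp at hu1
      · rw [Finset.insert_eq_of_mem (Finset.mem_univ i)]
        linarith [norm_nonneg (partitionSum p u I Finset.univ A)]

end PartitionSum


/-! ### Copies as edge sets, and moments of the count in G(n, p) -/

section RandomGraph

/-- There are finitely many graphs, so once singletons are measurable every function is measurable
and integrable, and such side conditions disappear below. -/
instance discreteMeasurableSpace_simpleGraph (n : ℕ) :
    DiscreteMeasurableSpace (SimpleGraph (Fin n)) := by
  have : MeasurableSingletonClass (SimpleGraph (Fin n)) := by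
    refine ⟨fun G => ?_⟩
    have h := (SimpleGraph.measurable_edgeSet (V := Fin n)) (measurableSet_singleton G.edgeSet)
    convert h using 1
    ext G'
    simp
  infer_instance

/-- The set of edges of `γ` as a finset. -/
def patternEdges {k : ℕ} (γ : SimpleGraph (Fin k)) : Finset (Sym2 (Fin k)) :=
  γ.edgeSet.toFinite.toFinset

/-- The pairs of vertices that have to be edges for the list `a` to be a copy of `γ`. -/
def copyEdges {k : ℕ} (γ : SimpleGraph (Fin k)) {n : ℕ} (a : Fin k ↪ Fin n) :
    Finset (Sym2 (Fin n)) :=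
  (patternEdges γ).map ⟨Sym2.map a, Sym2.map.injective a.injective⟩

variable {k n : ℕ} (γ : SimpleGraph (Fin k))

lemma card_patternEdges : (patternEdges γ).card = edgeCount γ :=
  (Set.ncard_eq_toFinset_card _ _).symm

lemma card_copyEdges (a : Fin k ↪ Fin n) : (copyEdges γ a).card = edgeCount γ := by
  rw [copyEdges, Finset.card_map, card_patternEdges]

variable {γ} in
lemma mem_copyEdges {a : Fin k ↪ Fin n} {e : Sym2 (Fin n)} :
    e ∈ copyEdges γ a ↔ ∃ g ∈ γ.edgeSet, Sym2.map a g = e := by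
  simp [copyEdges, patternEdges]

variable {γ} in
lemma not_isDiag_of_mem_copyEdges {a : Fin k ↪ Fin n} {e : Sym2 (Fin n)}
    (h : e ∈ copyEdges γ a) : ¬ e.IsDiag := by
  obtain ⟨g, hg, rfl⟩ := mem_copyEdges.1 h
  rw [Sym2.isDiag_map a.injective]
  exact γ.not_isDiag_of_mem_edgeSet hg

/-- The indicator function of the event that all the elements of `U` are edges. -/
def containsEdges (U : Finset (Sym2 (Fin n))) (Γ : SimpleGraph (Fin n)) : ℝ :=
  Set.indicator {Γ | ∀ e ∈ U, e ∈ Γ.edgeSet} 1 Γ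

lemma containsEdges_mul (U V : Finset (Sym2 (Fin n))) (Γ : SimpleGraph (Fin n)) :
    containsEdges U Γ * containsEdges V Γ = containsEdges (U ∪ V) Γ := by
  have h : (∀ e ∈ U ∪ V, e ∈ Γ.edgeSet) ↔ (∀ e ∈ U, e ∈ Γ.edgeSet) ∧ ∀ e ∈ V, e ∈ Γ.edgeSet := by
    simp only [Finset.mem_union, or_imp, forall_and]
  classical
  simp only [containsEdges, Set.indicator_apply, Set.mem_ofPred_eq, h, Pi.one_apply]
  split_ifs <;> simp_all

lemma containsEdges_empty (Γ : SimpleGraph (Fin n)) : containsEdges ∅ Γ = 1 := by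
  simp [containsEdges]

lemma prod_containsEdges {ι : Type*} [DecidableEq ι] (I : ι → Finset (Sym2 (Fin n)))
    (B : Finset ι) (Γ : SimpleGraph (Fin n)) :
    ∏ a ∈ B, containsEdges (I a) Γ = containsEdges (B.biUnion I) Γ := by
  induction B using Finset.induction_on with
  | empty => simp [containsEdges_empty]
  | insert b B hb ih => rw [Finset.prod_insert hb, ih, containsEdges_mul, Finset.biUnion_insert]

lemma subgraphCount_eq_sum (Γ : SimpleGraph (Fin n)) :
    subgraphCount γ n Γ = ∑ a : Fin k ↪ Fin n, containsEdges (copyEdges γ a) Γ := by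
  classical
  have e : SimpleGraph.Copy γ Γ ≃
      {a : Fin k ↪ Fin n // ∀ e ∈ copyEdges γ a, e ∈ Γ.edgeSet} :=
    { toFun := fun f => ⟨f.toEmbedding, fun e he => by
        obtain ⟨g, hg, rfl⟩ := mem_copyEdges.1 he
        induction g using Sym2.ind with
        | _ x y =>
          rw [SimpleGraph.mem_edgeSet] at hg
          rw [Sym2.map_mk, SimpleGraph.mem_edgeSet]
          exact f.toHom.map_adj hg⟩
      invFun := fun a => ⟨⟨a.1, fun {x y} hxy => by
        rw [← SimpleGraph.mem_edgeSet]
        refine a.2 _ (mem_copyEdges.2 ⟨s(x, y), (SimpleGraph.mem_edgeSet _).2 hxy, ?_⟩)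
        rw [Sym2.map_mk]⟩, a.1.injective⟩
      left_inv := fun f => rfl
      right_inv := fun a => rfl }
  have hcard : Γ.labelledCopyCount γ = Nat.card (SimpleGraph.Copy γ Γ) := by
    rw [SimpleGraph.labelledCopyCount]
    exact (@Nat.card_eq_fintype_card _ (_)).symm
  rw [subgraphCount, hcard, Nat.card_congr e, Nat.card_eq_fintype_card, Fintype.card_subtype]
  simp [containsEdges, Set.indicator_apply]

/-- The event is a cylinder of the product measure. Loops must be excluded since
`SimpleGraph.fromEdgeSet` discards diagonal pairs, so a loop is never an edge. -/
lemma integral_containsEdges (p : unitInterval) {U : Finset (Sym2 (Fin n))}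
    (hU : ∀ e ∈ U, ¬ e.IsDiag) :
    ∫ Γ, containsEdges U Γ ∂(SimpleGraph.binomialRandom (Fin n) p) = (p : ℝ) ^ U.card := by
  unfold containsEdges
  rw [integral_indicator_one (MeasurableSet.of_discrete), measureReal_def,
    SimpleGraph.binomialRandom_eq_map, Measure.map_apply (by fun_prop) (MeasurableSet.of_discrete),
    setBernoulli_apply']
  have hset : ((fun q : Sym2 (Fin n) → Prop => {i | q i}) ⁻¹'
      (SimpleGraph.fromEdgeSet ⁻¹' {Γ : SimpleGraph (Fin n) | ∀ e ∈ U, e ∈ Γ.edgeSet}))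
      = Set.pi U (fun _ => {True}) := by
    ext q
    simp only [Set.mem_preimage, Set.mem_ofPred_eq, SimpleGraph.edgeSet_fromEdgeSet, Set.mem_sdiff,
      Set.mem_pi, Finset.mem_coe, Set.mem_singleton_iff, eq_iff_iff, iff_true, Sym2.mem_diagSet]
    exact forall₂_congr fun e he => ⟨fun h => h.1, fun h => ⟨h, hU e he⟩⟩
  rw [hset, Measure.infinitePi_pi _ (fun _ _ => MeasurableSet.of_discrete),
    Finset.prod_congr rfl (g := fun _ => ((unitInterval.toNNReal p : NNReal) : ENNReal))]
  · simp
  · intro e he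
    have := hU e he
    simp [this]

/-- The expectation of a copy indicator. -/
lemma integral_subgraphCount (p : unitInterval) :
    ∫ Γ, subgraphCount γ n Γ ∂(SimpleGraph.binomialRandom (Fin n) p)
      = ∑ _a : Fin k ↪ Fin n, (p : ℝ) ^ edgeCount γ := by
  simp_rw [subgraphCount_eq_sum]
  rw [integral_finsetSum _ fun a _ => Integrable.of_finite]
  refine Finset.sum_congr rfl fun a _ => ?_
  rw [integral_containsEdges p fun e he => not_isDiag_of_mem_copyEdges he, card_copyEdges]

lemma centeredCount_eq_sum (p : unitInterval) (Γ : SimpleGraph (Fin n)) :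
    centeredCount γ p n Γ
      = ∑ a : Fin k ↪ Fin n, (containsEdges (copyEdges γ a) Γ - (p : ℝ) ^ edgeCount γ) := by
  rw [centeredCount, integral_subgraphCount, subgraphCount_eq_sum, Finset.sum_sub_distrib]

lemma integral_centeredCount (p : unitInterval) :
    ∫ Γ, centeredCount γ p n Γ ∂(SimpleGraph.binomialRandom (Fin n) p) = 0 := by
  unfold centeredCount
  rw [integral_sub Integrable.of_finite Integrable.of_finite]
  simp

lemma abs_centeredCount_le (p : unitInterval) (Γ : SimpleGraph (Fin n)) :
    |centeredCount γ p n Γ| ≤ (n : ℝ) ^ k := by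
  rw [centeredCount_eq_sum]
  refine (Finset.abs_sum_le_sum_abs _ _).trans ?_
  have : ∀ a : Fin k ↪ Fin n, |containsEdges (copyEdges γ a) Γ - (p : ℝ) ^ edgeCount γ| ≤ 1 := by
    intro a
    have h1 : 0 ≤ containsEdges (copyEdges γ a) Γ := Set.indicator_nonneg (by simp) _
    have h2 : containsEdges (copyEdges γ a) Γ ≤ 1 := Set.indicator_le_self' (by simp) _
    have h3 : (0 : ℝ) ≤ (p : ℝ) ^ edgeCount γ := pow_nonneg p.2.1 _
    have h4 : (p : ℝ) ^ edgeCount γ ≤ 1 := pow_le_one₀ p.2.1 p.2.2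
    rw [abs_le]
    constructor <;> linarith
  refine (Finset.sum_le_sum fun a _ => this a).trans ?_
  simp only [Finset.sum_const, Finset.card_univ, Fintype.card_embedding_eq, Fintype.card_fin,
    nsmul_eq_mul, mul_one]
  exact_mod_cast Nat.descFactorial_le_pow n k

lemma not_isDiag_of_mem_union {U V : Finset (Sym2 (Fin n))} (hU : ∀ e ∈ U, ¬ e.IsDiag)
    (hV : ∀ e ∈ V, ¬ e.IsDiag) : ∀ e ∈ U ∪ V, ¬ e.IsDiag := by
  intro e he
  rcases Finset.mem_union.1 he with h | h
  exacts [hU e h, hV e h]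

lemma integral_centeredCount_sq (p : unitInterval) :
    ∫ Γ, centeredCount γ p n Γ ^ 2 ∂(SimpleGraph.binomialRandom (Fin n) p)
      = ∑ a : Fin k ↪ Fin n, ∑ b : Fin k ↪ Fin n,
        ((p : ℝ) ^ (copyEdges γ a ∪ copyEdges γ b).card - (p : ℝ) ^ (2 * edgeCount γ)) := by
  simp_rw [centeredCount_eq_sum, pow_two (∑ a : Fin k ↪ Fin n, _), Finset.sum_mul_sum]
  rw [integral_finsetSum _ fun a _ => Integrable.of_finite]
  refine Finset.sum_congr rfl fun a _ => ?_
  rw [integral_finsetSum _ fun a _ => Integrable.of_finite]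
  refine Finset.sum_congr rfl fun b _ => ?_
  have hd := fun a : Fin k ↪ Fin n => fun e (he : e ∈ copyEdges γ a) =>
    not_isDiag_of_mem_copyEdges he
  set q := (p : ℝ) ^ edgeCount γ with hq
  have h : ∀ Γ, (containsEdges (copyEdges γ a) Γ - q) * (containsEdges (copyEdges γ b) Γ - q)
      = containsEdges (copyEdges γ a ∪ copyEdges γ b) Γ + q ^ 2
        - q * containsEdges (copyEdges γ a) Γ - q * containsEdges (copyEdges γ b) Γ := by
    intro Γ
    rw [← containsEdges_mul]
    ring
  simp_rw [h]
  rw [integral_sub Integrable.of_finite Integrable.of_finite,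
    integral_sub Integrable.of_finite Integrable.of_finite,
    integral_add Integrable.of_finite Integrable.of_finite, integral_const_mul, integral_const_mul,
    integral_containsEdges p (hd a), integral_containsEdges p (hd b),
    integral_containsEdges p (not_isDiag_of_mem_union (hd a) (hd b)), card_copyEdges,
    card_copyEdges, ← hq, pow_mul' (p : ℝ) 2, ← hq]
  simp
  ring

lemma integral_centeredCount_cube (p : unitInterval) :
    ∫ Γ, centeredCount γ p n Γ ^ 3 ∂(SimpleGraph.binomialRandom (Fin n) p)
      = ∑ a : Fin k ↪ Fin n, ∑ b : Fin k ↪ Fin n, ∑ c : Fin k ↪ Fin n,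
        ((p : ℝ) ^ (copyEdges γ a ∪ copyEdges γ b ∪ copyEdges γ c).card
          - (p : ℝ) ^ edgeCount γ * ((p : ℝ) ^ (copyEdges γ a ∪ copyEdges γ b).card
            + (p : ℝ) ^ (copyEdges γ b ∪ copyEdges γ c).card
            + (p : ℝ) ^ (copyEdges γ a ∪ copyEdges γ c).card)
          + 2 * (p : ℝ) ^ (3 * edgeCount γ)) := by
  have hcube : ∀ f : (Fin k ↪ Fin n) → ℝ, (∑ a, f a) ^ 3 = ∑ a, ∑ b, ∑ c, f a * f b * f c := by
    intro f
    rw [pow_three', Finset.sum_mul_sum, Finset.sum_mul]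
    refine Finset.sum_congr rfl fun a _ => ?_
    rw [Finset.sum_mul]
    exact Finset.sum_congr rfl fun b _ => Finset.mul_sum _ _ _
  simp_rw [centeredCount_eq_sum, hcube]
  rw [integral_finsetSum _ fun a _ => Integrable.of_finite]
  refine Finset.sum_congr rfl fun a _ => ?_
  rw [integral_finsetSum _ fun a _ => Integrable.of_finite]
  refine Finset.sum_congr rfl fun b _ => ?_
  rw [integral_finsetSum _ fun a _ => Integrable.of_finite]
  refine Finset.sum_congr rfl fun c _ => ?_
  have hd := fun a : Fin k ↪ Fin n => fun e (he : e ∈ copyEdges γ a) =>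
    not_isDiag_of_mem_copyEdges he
  set q := (p : ℝ) ^ edgeCount γ with hq
  have h : ∀ Γ, (containsEdges (copyEdges γ a) Γ - q) * (containsEdges (copyEdges γ b) Γ - q)
      * (containsEdges (copyEdges γ c) Γ - q)
      = containsEdges (copyEdges γ a ∪ copyEdges γ b ∪ copyEdges γ c) Γ
        - q * containsEdges (copyEdges γ a ∪ copyEdges γ b) Γ
        - q * containsEdges (copyEdges γ b ∪ copyEdges γ c) Γ
        - q * containsEdges (copyEdges γ a ∪ copyEdges γ c) Γ
        + q ^ 2 * containsEdges (copyEdges γ a) Γ + q ^ 2 * containsEdges (copyEdges γ b) Γ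
        + q ^ 2 * containsEdges (copyEdges γ c) Γ - q ^ 3 := by
    intro Γ
    rw [← containsEdges_mul, ← containsEdges_mul, ← containsEdges_mul, ← containsEdges_mul]
    ring
  simp_rw [h]
  rw [integral_sub Integrable.of_finite Integrable.of_finite,
    integral_add Integrable.of_finite Integrable.of_finite,
    integral_add Integrable.of_finite Integrable.of_finite,
    integral_add Integrable.of_finite Integrable.of_finite,
    integral_sub Integrable.of_finite Integrable.of_finite,
    integral_sub Integrable.of_finite Integrable.of_finite,
    integral_sub Integrable.of_finite Integrable.of_finite]
  simp only [integral_const_mul]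
  rw [integral_containsEdges p (hd a), integral_containsEdges p (hd b),
    integral_containsEdges p (hd c),
    integral_containsEdges p (not_isDiag_of_mem_union (hd a) (hd b)),
    integral_containsEdges p (not_isDiag_of_mem_union (hd b) (hd c)),
    integral_containsEdges p (not_isDiag_of_mem_union (hd a) (hd c)),
    integral_containsEdges p
      (not_isDiag_of_mem_union (not_isDiag_of_mem_union (hd a) (hd b)) (hd c)),
    card_copyEdges, card_copyEdges, card_copyEdges, ← hq, pow_mul' (p : ℝ) 3, ← hq]
  simp
  ring

/-- The moment generating function of a subgraph count is a partition sum. -/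
lemma complexMGF_subgraphCount (p : unitInterval) (w : ℂ) :
    complexMGF (subgraphCount γ n) (SimpleGraph.binomialRandom (Fin n) p) w
      = partitionSum p (Complex.exp w - 1) (copyEdges γ (n := n)) ∅ Finset.univ := by
  have h : ∀ Γ : SimpleGraph (Fin n), Complex.exp (w * subgraphCount γ n Γ)
      = ∑ B ∈ (Finset.univ : Finset (Fin k ↪ Fin n)).powerset, (Complex.exp w - 1) ^ B.card
        * ((containsEdges (B.biUnion (copyEdges γ)) Γ : ℝ) : ℂ) := by
    intro Γ
    rw [subgraphCount_eq_sum]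
    push_cast
    rw [Finset.mul_sum, Complex.exp_sum]
    -- An indicator takes only the values 0 and 1, so its exponential is affine in it; expanding the
    -- product gives the sum over sets of copies.
    have : ∀ a : Fin k ↪ Fin n, Complex.exp (w * containsEdges (copyEdges γ a) Γ)
        = 1 + (Complex.exp w - 1) * containsEdges (copyEdges γ a) Γ := by
      intro a
      unfold containsEdges
      by_cases h : Γ ∈ {Γ : SimpleGraph (Fin n) | ∀ e ∈ copyEdges γ a, e ∈ Γ.edgeSet}
      · simp [Set.indicator_of_mem h]
      · simp [Set.indicator_of_notMem h]
    rw [Finset.prod_congr rfl fun a _ => this a, Finset.prod_one_add]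
    refine Finset.sum_congr rfl fun B _ => ?_
    rw [Finset.prod_mul_distrib, Finset.prod_const, ← prod_containsEdges]
    push_cast
    rfl
  rw [complexMGF, partitionSum]
  simp_rw [h]
  rw [integral_finsetSum _ fun a _ => Integrable.of_finite]
  refine Finset.sum_congr rfl fun B _ => ?_
  rw [integral_const_mul, integral_complex_ofReal, integral_containsEdges p, Finset.sdiff_empty]
  · push_cast
    rfl
  · intro e he
    obtain ⟨a, _, ha⟩ := Finset.mem_biUnion.1 he
    exact not_isDiag_of_mem_copyEdges ha

end RandomGraph


/-! ### Second and third cumulants of a regular family of sets -/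

section Counting

lemma pow_eq_mul_inv_pow {p : ℝ} (hp : 0 < p) {U x m : ℕ} (h : U + x = m) :
    p ^ U = p ^ m * p⁻¹ ^ x := by
  rw [← h, pow_add, inv_pow, mul_assoc, mul_inv_cancel₀ (pow_pos hp x).ne', mul_one]

/-- The linear approximation in the overlap `x` is exact for x = 0 and x = 1. For x ≥ 2 the crude
bound suffices, since x² − x ≥ 1; this weight counts ordered pairs of distinct common edges. -/
lemma abs_covariance_sub_le {p : ℝ} (hp0 : 0 < p) (hp1 : p ≤ 1) {h x U : ℕ} (hx : x ≤ h)
    (hU : U + x = 2 * h) :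
    |p ^ U - p ^ (2 * h) - p ^ (2 * h) * ((p⁻¹ - 1) * x)|
      ≤ (1 + (p⁻¹ - 1) * h) * ((x : ℝ) * x - x) := by
  have hr : 0 ≤ p⁻¹ - 1 := by
    have := (one_le_inv₀ hp0).2 hp1
    linarith
  rcases Nat.lt_or_ge x 2 with h2 | h2
  · have : p ^ U - p ^ (2 * h) - p ^ (2 * h) * ((p⁻¹ - 1) * x) = 0 := by
      rw [pow_eq_mul_inv_pow hp0 hU]
      interval_cases x
      · simp
      · simp; ring
    rw [this]
    interval_cases x <;> simp
  · have h2' : (2 : ℝ) ≤ x := by exact_mod_cast h2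
    have hx' : (x : ℝ) ≤ h := by exact_mod_cast hx
    have e1 : p ^ U ≤ 1 := pow_le_one₀ hp0.le hp1
    have e2 : p ^ (2 * h) ≤ p ^ U := pow_le_pow_of_le_one hp0.le hp1 (by omega)
    have e3 : 0 < p ^ (2 * h) := pow_pos hp0 _
    have e4 : 0 ≤ (p⁻¹ - 1) * x := by positivity
    have e5 : (p⁻¹ - 1) * x ≤ (p⁻¹ - 1) * h := by gcongr
    have e6 : p ^ (2 * h) * ((p⁻¹ - 1) * x) ≤ 1 * ((p⁻¹ - 1) * h) := by
      gcongr
      linarith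
    have e7 : (1 : ℝ) ≤ (x : ℝ) * x - x := by nlinarith
    have e8 : 0 ≤ p ^ (2 * h) * ((p⁻¹ - 1) * x) := by positivity
    rw [abs_le]
    constructor <;> nlinarith

/-- A joint third cumulant of three edge indicators, in terms of the sizes of unions. -/
def tripleCumulant (p : ℝ) (h U₁ U₂ U₃ U : ℕ) : ℝ :=
  p ^ U - p ^ h * (p ^ U₁ + p ^ U₂ + p ^ U₃) + 2 * p ^ (3 * h)

/-- The leading part of `tripleCumulant` in terms of the sizes of intersections. -/
def tripleMain (p : ℝ) (h x y z t : ℕ) : ℝ :=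
  p ^ (3 * h) * ((p⁻¹ - 1) ^ 2 * (x * y + y * z + x * z)
    + ((p⁻¹ - 1) * (p⁻¹ - 2) - 3 * (p⁻¹ - 1) ^ 2) * t)

lemma abs_tripleCumulant_sub_le_const {p : ℝ} (hp0 : 0 < p) (hp1 : p ≤ 1)
    {h x y z t U₁ U₂ U₃ U : ℕ} (hx : x ≤ h) (hy : y ≤ h) (hz : z ≤ h) (htx : t ≤ x) :
    |tripleCumulant p h U₁ U₂ U₃ U - tripleMain p h x y z t|
      ≤ 6 + (p⁻¹ - 1) ^ 2 * (3 * h ^ 2)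
        + |(p⁻¹ - 1) * (p⁻¹ - 2) - 3 * (p⁻¹ - 1) ^ 2| * h := by
  have hpow : ∀ m : ℕ, 0 < p ^ m ∧ p ^ m ≤ 1 := fun m =>
    ⟨pow_pos hp0 m, pow_le_one₀ hp0.le hp1⟩
  have hx' : (x : ℝ) ≤ h := by exact_mod_cast hx
  have hy' : (y : ℝ) ≤ h := by exact_mod_cast hy
  have hz' : (z : ℝ) ≤ h := by exact_mod_cast hz
  have ht' : (t : ℝ) ≤ h := by exact_mod_cast htx.trans hx
  -- All powers of `p` lie in [0, 1], and 6 = 1 + 3 + 2.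
  have e1 : |tripleCumulant p h U₁ U₂ U₃ U| ≤ 6 := by
    unfold tripleCumulant
    obtain ⟨a1, a2⟩ := hpow U
    obtain ⟨b1, b2⟩ := hpow (3 * h)
    have c1 : 0 ≤ p ^ h * (p ^ U₁ + p ^ U₂ + p ^ U₃) := by positivity
    have c2 : p ^ h * (p ^ U₁ + p ^ U₂ + p ^ U₃) ≤ 1 * (1 + 1 + 1) := by
      gcongr
      exacts [(hpow h).2, (hpow U₁).2, (hpow U₂).2, (hpow U₃).2]
    rw [abs_le]
    constructor <;> linarith
  have e2 : |tripleMain p h x y z t| ≤ (p⁻¹ - 1) ^ 2 * (3 * h ^ 2)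
        + |(p⁻¹ - 1) * (p⁻¹ - 2) - 3 * (p⁻¹ - 1) ^ 2| * h := by
    unfold tripleMain
    rw [abs_mul, abs_of_pos (hpow (3 * h)).1]
    have f1 : |(p⁻¹ - 1) ^ 2 * ((x : ℝ) * y + y * z + x * z)
        + ((p⁻¹ - 1) * (p⁻¹ - 2) - 3 * (p⁻¹ - 1) ^ 2) * t|
        ≤ (p⁻¹ - 1) ^ 2 * (3 * h ^ 2)
        + |(p⁻¹ - 1) * (p⁻¹ - 2) - 3 * (p⁻¹ - 1) ^ 2| * h := by
      refine (abs_add_le _ _).trans (add_le_add ?_ ?_)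
      · rw [abs_of_nonneg (by positivity)]
        gcongr
        calc (x : ℝ) * y + y * z + x * z ≤ h * h + h * h + h * h := by gcongr
          _ = 3 * (h : ℝ) ^ 2 := by ring
      · rw [abs_mul, Nat.abs_cast]
        gcongr
    calc _ ≤ 1 * _ := mul_le_mul (hpow _).2 f1 (abs_nonneg _) zero_le_one
      _ = _ := one_mul _
  calc _ ≤ |tripleCumulant p h U₁ U₂ U₃ U| + |tripleMain p h x y z t| := abs_sub _ _
    _ ≤ _ := by linarith

lemma tripleCumulant_eq {p : ℝ} (hp0 : 0 < p) {h x y z t U₁ U₂ U₃ U : ℕ}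
    (hU₁ : U₁ + x = 2 * h) (hU₂ : U₂ + y = 2 * h) (hU₃ : U₃ + z = 2 * h)
    (hU : U + (x + y + z) = 3 * h + t) :
    tripleCumulant p h U₁ U₂ U₃ U = p ^ (3 * h) *
      (p ^ t * (p⁻¹ ^ x * p⁻¹ ^ y * p⁻¹ ^ z) - p⁻¹ ^ x - p⁻¹ ^ y - p⁻¹ ^ z + 2) := by
  unfold tripleCumulant
  rw [pow_eq_mul_inv_pow hp0 hU₁, pow_eq_mul_inv_pow hp0 hU₂, pow_eq_mul_inv_pow hp0 hU₃,
    pow_eq_mul_inv_pow hp0 hU, pow_add, pow_add, pow_add]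
  ring

/-- The overlap patterns left when no pair shares two edges while another overlap is nonempty, and
no three pairwise overlaps occur without a common edge. On these patterns `tripleMain` is exact. -/
lemma pattern_cases {x y z t : ℕ} (htx : t ≤ x) (hty : t ≤ y) (htz : t ≤ z)
    (g₁ : ¬ (2 ≤ x ∧ 1 ≤ y + z)) (g₂ : ¬ (2 ≤ y ∧ 1 ≤ x + z)) (g₃ : ¬ (2 ≤ z ∧ 1 ≤ x + y))
    (g₄ : ¬ (1 ≤ x ∧ 1 ≤ y ∧ 1 ≤ z ∧ t = 0)) :
    (y = 0 ∧ z = 0 ∧ t = 0) ∨ (x = 0 ∧ z = 0 ∧ t = 0) ∨ (x = 0 ∧ y = 0 ∧ t = 0)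
      ∨ (x = 1 ∧ y = 1 ∧ z = 0 ∧ t = 0) ∨ (x = 1 ∧ y = 0 ∧ z = 1 ∧ t = 0)
      ∨ (x = 0 ∧ y = 1 ∧ z = 1 ∧ t = 0) ∨ (x = 1 ∧ y = 1 ∧ z = 1 ∧ t = 1) := by
  rcases Nat.eq_zero_or_pos x with hx | hx
  · rcases Nat.eq_zero_or_pos y with hy | hy
    · omega
    · rcases Nat.eq_zero_or_pos z with hz | hz
      · omega
      · have : y = 1 := by omega
        omega
  · rcases Nat.eq_zero_or_pos y with hy | hy
    · rcases Nat.eq_zero_or_pos z with hz | hz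
      · omega
      · have : x = 1 := by omega
        omega
    · have : x = 1 := by omega
      have : y = 1 := by omega
      rcases Nat.eq_zero_or_pos z with hz | hz
      · omega
      · have : z = 1 := by omega
        omega

/-- Exceptional patterns have weight at least 1 on the right, where a constant bound is enough; on
all others the difference vanishes. `W` stands for any quantity detecting triples that overlap
pairwise with no common edge. -/
lemma abs_tripleCumulant_sub_le {p : ℝ} (hp0 : 0 < p) (hp1 : p ≤ 1)
    {h x y z t U₁ U₂ U₃ U : ℕ} (hx : x ≤ h) (hy : y ≤ h) (hz : z ≤ h) (htx : t ≤ x) (hty : t ≤ y)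
    (htz : t ≤ z) (hU₁ : U₁ + x = 2 * h) (hU₂ : U₂ + y = 2 * h) (hU₃ : U₃ + z = 2 * h)
    (hU : U + (x + y + z) = 3 * h + t) {W : ℝ} (hW0 : 0 ≤ W)
    (hW : 1 ≤ x → 1 ≤ y → 1 ≤ z → t = 0 → 1 ≤ W) :
    |tripleCumulant p h U₁ U₂ U₃ U - tripleMain p h x y z t|
      ≤ (6 + (p⁻¹ - 1) ^ 2 * (3 * h ^ 2)
        + |(p⁻¹ - 1) * (p⁻¹ - 2) - 3 * (p⁻¹ - 1) ^ 2| * h)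
        * (((x : ℝ) * x - x) * (y + z) + ((y : ℝ) * y - y) * (x + z)
          + ((z : ℝ) * z - z) * (x + y) + W) := by
  have hsq : ∀ m : ℕ, (0 : ℝ) ≤ (m : ℝ) * m - m := fun m => by
    have : m ≤ m * m := Nat.le_mul_self m
    have : (m : ℝ) ≤ m * m := by exact_mod_cast this
    linarith
  have hsq2 : ∀ m : ℕ, 2 ≤ m → (1 : ℝ) ≤ (m : ℝ) * m - m := fun m hm => by
    have : (2 : ℝ) ≤ m := by exact_mod_cast hm
    nlinarith
  have hsum : ∀ m l : ℕ, 1 ≤ m + l → (1 : ℝ) ≤ (m : ℝ) + l := fun m l hml => by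
    exact_mod_cast hml
  have t1 : 0 ≤ ((x : ℝ) * x - x) * (y + z) := mul_nonneg (hsq x) (by positivity)
  have t2 : 0 ≤ ((y : ℝ) * y - y) * (x + z) := mul_nonneg (hsq y) (by positivity)
  have t3 : 0 ≤ ((z : ℝ) * z - z) * (x + y) := mul_nonneg (hsq z) (by positivity)
  by_cases hbad : 1 ≤ ((x : ℝ) * x - x) * (y + z) + ((y : ℝ) * y - y) * (x + z)
          + ((z : ℝ) * z - z) * (x + y) + W
  · exact (abs_tripleCumulant_sub_le_const hp0 hp1 hx hy hz htx).trans
      (le_mul_of_one_le_right (by positivity) hbad)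
  · have g1 : ¬ (2 ≤ x ∧ 1 ≤ y + z) := fun hh => hbad (by
      have := one_le_mul_of_one_le_of_one_le (hsq2 x hh.1) (hsum y z hh.2)
      linarith only [this, t1, t2, t3, hW0])
    have g2 : ¬ (2 ≤ y ∧ 1 ≤ x + z) := fun hh => hbad (by
      have := one_le_mul_of_one_le_of_one_le (hsq2 y hh.1) (hsum x z hh.2)
      linarith only [this, t1, t2, t3, hW0])
    have g3 : ¬ (2 ≤ z ∧ 1 ≤ x + y) := fun hh => hbad (by
      have := one_le_mul_of_one_le_of_one_le (hsq2 z hh.1) (hsum x y hh.2)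
      linarith only [this, t1, t2, t3, hW0])
    have g4 : ¬ (1 ≤ x ∧ 1 ≤ y ∧ 1 ≤ z ∧ t = 0) := fun hh => hbad (by
      have := hW hh.1 hh.2.1 hh.2.2.1 hh.2.2.2
      linarith only [this, t1, t2, t3])
    have hzero : tripleCumulant p h U₁ U₂ U₃ U - tripleMain p h x y z t = 0 := by
      -- With r = 1/p, and up to the factor p^{3h}, both sides are 0 if at most one overlap is
      -- nonempty, (r−1)² for two single overlaps, and (r−1)(r−2) for one edge common to all three
      -- sets.
      rw [tripleCumulant_eq hp0 hU₁ hU₂ hU₃ hU, tripleMain]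
      have cases := pattern_cases htx hty htz g1 g2 g3 g4
      rcases cases with ⟨rfl, rfl, rfl⟩ | ⟨rfl, rfl, rfl⟩ | ⟨rfl, rfl, rfl⟩ | ⟨rfl, rfl, rfl, rfl⟩ |
        ⟨rfl, rfl, rfl, rfl⟩ | ⟨rfl, rfl, rfl, rfl⟩ | ⟨rfl, rfl, rfl, rfl⟩
      · simp; right; ring
      · simp; right; ring
      · simp; right; ring
      · simp; ring
      · simp; ring
      · simp; ring
      · have := mul_inv_cancel₀ hp0.ne'
        simp only [pow_one, Nat.cast_one, mul_one]
        rw [← mul_assoc, ← mul_assoc, this]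
        ring
    rw [hzero, abs_zero]
    exact mul_nonneg (by positivity) (by positivity)

lemma card_union_three {E : Type*} [DecidableEq E] (A B C : Finset E) :
    (A ∪ B ∪ C).card + ((A ∩ B).card + (B ∩ C).card + (A ∩ C).card)
      = A.card + B.card + C.card + (A ∩ B ∩ C).card := by
  have h1 := Finset.card_union_add_card_inter (A ∪ B) C
  have h2 := Finset.card_union_add_card_inter A B
  have h3 := Finset.card_union_add_card_inter (A ∩ C) (B ∩ C)
  rw [Finset.union_inter_distrib_right] at h1
  have h4 : A ∩ C ∩ (B ∩ C) = A ∩ B ∩ C := by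
    ext; simp only [Finset.mem_inter]; tauto
  rw [h4] at h3
  omega

variable {E ι : Type*} [DecidableEq E] [Fintype ι] {I : ι → Finset E} {h : ℕ} {N Q : ℝ}

/-- A family of sets of size `h` in which all points have degree `N` and all pairs of points have
codegree at most `Q`. -/
structure RegularFamily (I : ι → Finset E) (h : ℕ) (N Q : ℝ) : Prop where
  card_eq : ∀ a, (I a).card = h
  degree : ∀ a, ∀ e ∈ I a, ∑ b, (if e ∈ I b then (1 : ℝ) else 0) = N
  codegree : ∀ e f, e ≠ f → ∑ b, (if e ∈ I b ∧ f ∈ I b then (1 : ℝ) else 0) ≤ Q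
  degree_nonneg : 0 ≤ N
  codegree_nonneg : 0 ≤ Q

namespace RegularFamily

variable (hI : RegularFamily I h N Q)
include hI

lemma sum_card_inter (a : ι) {J : Finset E} (hJ : J ⊆ I a) :
    ∑ b, ((J ∩ I b).card : ℝ) = J.card * N := by
  have : ∀ b, ((J ∩ I b).card : ℝ) = ∑ e ∈ J, if e ∈ I b then (1 : ℝ) else 0 := by
    intro b
    rw [← Finset.filter_mem_eq_inter, Finset.card_filter]
    push_cast
    rfl
  simp_rw [this]
  rw [Finset.sum_comm, Finset.sum_congr rfl fun e he => hI.degree a e (hJ he)]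
  simp

lemma sum_card_inter_self (a : ι) : ∑ b, ((I a ∩ I b).card : ℝ) = h * N := by
  rw [hI.sum_card_inter a subset_rfl, hI.card_eq]

lemma sum_card_inter_self' (a : ι) : ∑ b, ((I b ∩ I a).card : ℝ) = h * N := by
  simp_rw [Finset.inter_comm _ (I a)]
  exact hI.sum_card_inter_self a

/-- x² − x is the number of ordered pairs of distinct elements in the overlap; exchanging sums, each
of the at most h² pairs in `I a` is covered by at most `Q` sets. -/
lemma sum_offDiag_le (a : ι) :
    ∑ b, (((I a ∩ I b).card : ℝ) * (I a ∩ I b).card - (I a ∩ I b).card) ≤ h ^ 2 * Q := by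
  have key : ∀ b, (((I a ∩ I b).card : ℝ) * (I a ∩ I b).card - (I a ∩ I b).card)
      = ∑ x ∈ (I a).offDiag, if x.1 ∈ I b ∧ x.2 ∈ I b then (1 : ℝ) else 0 := by
    intro b
    have h1 : (I a ∩ I b).offDiag = (I a).offDiag.filter (fun x => x.1 ∈ I b ∧ x.2 ∈ I b) := by
      ext x
      simp only [Finset.mem_offDiag, Finset.mem_inter, Finset.mem_filter]
      tauto
    have h2 := Finset.offDiag_card (I a ∩ I b)
    have h3 : (((I a ∩ I b).offDiag.card : ℕ) : ℝ)
        = ((I a ∩ I b).card : ℝ) * (I a ∩ I b).card - (I a ∩ I b).card := by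
      rw [h2, Nat.cast_sub (Nat.le_mul_self _)]
      push_cast
      rfl
    rw [← h3, h1, Finset.card_filter]
    push_cast
    rfl
  simp_rw [key]
  rw [Finset.sum_comm]
  calc _ ≤ ∑ x ∈ (I a).offDiag, Q := by
        refine Finset.sum_le_sum fun x hx => hI.codegree _ _ ?_
        exact (Finset.mem_offDiag.1 hx).2.2
    _ = ((I a).offDiag.card : ℝ) * Q := by simp
    _ ≤ h ^ 2 * Q := by
        gcongr
        · exact hI.codegree_nonneg
        · rw [Finset.offDiag_card, hI.card_eq, ← pow_two]
          exact_mod_cast Nat.sub_le _ _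

lemma sum_offDiag_le' (a : ι) :
    ∑ b, (((I b ∩ I a).card : ℝ) * (I b ∩ I a).card - (I b ∩ I a).card) ≤ h ^ 2 * Q := by
  simp_rw [Finset.inter_comm _ (I a)]
  exact hI.sum_offDiag_le a

lemma card_union_two (a b : ι) : (I a ∪ I b).card + (I a ∩ I b).card = 2 * h := by
  rw [Finset.card_union_add_card_inter, hI.card_eq, hI.card_eq]
  ring

theorem abs_sum_covariance_sub_le {p : ℝ} (hp0 : 0 < p) (hp1 : p ≤ 1) :
    |∑ a, ∑ b, (p ^ (I a ∪ I b).card - p ^ (2 * h))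
        - p ^ (2 * h) * (p⁻¹ - 1) * (Fintype.card ι * (h * N))|
      ≤ (1 + (p⁻¹ - 1) * h) * (Fintype.card ι * (h ^ 2 * Q)) := by
  have hr : 0 ≤ p⁻¹ - 1 := by
    have := (one_le_inv₀ hp0).2 hp1
    linarith
  have e1 : p ^ (2 * h) * (p⁻¹ - 1) * (Fintype.card ι * (h * N))
      = ∑ a, ∑ b, p ^ (2 * h) * ((p⁻¹ - 1) * (I a ∩ I b).card) := by
    simp_rw [← Finset.mul_sum, hI.sum_card_inter_self]
    simp
    ring
  rw [e1, ← Finset.sum_sub_distrib]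
  simp_rw [← Finset.sum_sub_distrib]
  refine (Finset.abs_sum_le_sum_abs _ _).trans ?_
  have e2 : ∀ a, |∑ b, (p ^ (I a ∪ I b).card - p ^ (2 * h)
      - p ^ (2 * h) * ((p⁻¹ - 1) * (I a ∩ I b).card))|
      ≤ (1 + (p⁻¹ - 1) * h) * (h ^ 2 * Q) := by
    intro a
    refine (Finset.abs_sum_le_sum_abs _ _).trans ?_
    refine (Finset.sum_le_sum fun b _ => abs_covariance_sub_le hp0 hp1 (x := (I a ∩ I b).card)
      ?_ (hI.card_union_two a b)).trans ?_
    · exact (Finset.card_le_card Finset.inter_subset_left).trans_eq (hI.card_eq a)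
    · rw [← Finset.mul_sum]
      gcongr
      exact hI.sum_offDiag_le a
  refine (Finset.sum_le_sum fun a _ => e2 a).trans_eq ?_
  simp
  ring

end RegularFamily

/-- The number of triples `(e, f, g)` in `(A ∩ B) × (B ∩ C) × (A ∩ C)` with `e ≠ f` and
`g ≠ e`. -/
def triangleCount (A B C : Finset E) : ℝ :=
  ∑ x ∈ B.offDiag, ∑ g ∈ C, if x.1 ∈ A ∧ x.2 ∈ C ∧ g ∈ A ∧ x.1 ≠ g then 1 else 0

lemma triangleCount_nonneg (A B C : Finset E) : 0 ≤ triangleCount A B C :=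
  Finset.sum_nonneg fun _ _ => Finset.sum_nonneg fun _ _ => by split_ifs <;> norm_num

lemma one_le_triangleCount {A B C : Finset E} (h₁ : (A ∩ B).Nonempty) (h₂ : (B ∩ C).Nonempty)
    (h₃ : (A ∩ C).Nonempty) (h₀ : A ∩ B ∩ C = ∅) : 1 ≤ triangleCount A B C := by
  obtain ⟨e, he⟩ := h₁
  obtain ⟨f, hf⟩ := h₂
  obtain ⟨g, hg⟩ := h₃
  have h0 : ∀ x, x ∈ A → x ∈ B → x ∈ C → False := fun x hA hB hC => by
    have : x ∈ A ∩ B ∩ C := by simp [hA, hB, hC]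
    simp [h₀] at this
  rw [Finset.mem_inter] at he hf hg
  have hef : e ≠ f := fun h => h0 e he.1 he.2 (h ▸ hf.2)
  have heg : e ≠ g := fun h => h0 e he.1 he.2 (h ▸ hg.2)
  unfold triangleCount
  have hpos : ∀ x : E × E, ∀ g : E,
      (0 : ℝ) ≤ if x.1 ∈ A ∧ x.2 ∈ C ∧ g ∈ A ∧ x.1 ≠ g then 1 else 0 := by
    intro x g; split_ifs <;> norm_num
  refine le_trans ?_ (Finset.single_le_sum (fun x _ => Finset.sum_nonneg fun g _ => hpos x g)
    (Finset.mem_offDiag.2 ⟨he.2, hf.1, hef⟩ : (e, f) ∈ B.offDiag))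
  refine le_trans ?_ (Finset.single_le_sum (fun g _ => hpos (e, f) g) hg.2)
  simp [he.1, hf.2, hg.1, heg]

namespace RegularFamily

variable (hI : RegularFamily I h N Q)
include hI

/-- Fix (e, f) in `I b`, in at most h² ways. Then `c` must pass through f (`N` choices), g is one of
h elements of `I c`, and `a` contains the distinct elements e and g (at most `Q` choices). -/
lemma sum_triangleCount_le (b : ι) :
    ∑ c, ∑ a, triangleCount (I a) (I b) (I c) ≤ h ^ 2 * (h * (N * Q)) := by
  have hQ := hI.codegree_nonneg
  have hN := hI.degree_nonneg
  unfold triangleCount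
  have e1 : ∀ c, ∑ a, (∑ x ∈ (I b).offDiag, ∑ g ∈ I c,
      if x.1 ∈ I a ∧ x.2 ∈ I c ∧ g ∈ I a ∧ x.1 ≠ g then (1 : ℝ) else 0)
      ≤ ∑ x ∈ (I b).offDiag, (if x.2 ∈ I c then (1 : ℝ) else 0) * (h * Q) := by
    intro c
    rw [Finset.sum_comm]
    refine Finset.sum_le_sum fun x _ => ?_
    rw [Finset.sum_comm]
    have e2 : ∀ g ∈ I c, ∑ a, (if x.1 ∈ I a ∧ x.2 ∈ I c ∧ g ∈ I a ∧ x.1 ≠ g then (1 : ℝ) else 0)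
        ≤ (if x.2 ∈ I c then (1 : ℝ) else 0) * Q := by
      intro g _
      by_cases h2 : x.2 ∈ I c
      · by_cases hg : x.1 = g
        · simp [hg, h2, hQ]
        · simpa [hg, h2] using hI.codegree x.1 g hg
      · simp [h2]
    refine (Finset.sum_le_sum e2).trans_eq ?_
    rw [Finset.sum_const, hI.card_eq]
    simp
  refine (Finset.sum_le_sum fun c _ => e1 c).trans ?_
  rw [Finset.sum_comm]
  simp_rw [← Finset.sum_mul]
  rw [Finset.sum_congr rfl fun x hx => by rw [hI.degree b x.2 (Finset.mem_offDiag.1 hx).2.1]]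
  rw [Finset.sum_const, Finset.offDiag_card, hI.card_eq, nsmul_eq_mul]
  have : ((h * h - h : ℕ) : ℝ) ≤ h ^ 2 := by
    rw [pow_two]; exact_mod_cast Nat.sub_le _ _
  calc _ = ((h * h - h : ℕ) : ℝ) * (N * (h * Q)) := by ring
    _ ≤ (h : ℝ) ^ 2 * (N * (h * Q)) := by gcongr
    _ = _ := by ring

omit [DecidableEq E] hI in
lemma sum_mul_le (f g : ι → ι → ℝ) {u v : ℝ}
    (hf : ∀ a, ∑ b, f a b ≤ u) (hg : ∀ a, ∑ b, g a b = v) (hv : 0 ≤ v) :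
    ∑ a, ∑ b, ∑ c, f a b * g a c ≤ Fintype.card ι * (u * v) := by
  have : ∀ a, ∑ b, ∑ c, f a b * g a c ≤ u * v := by
    intro a
    simp_rw [← Finset.mul_sum, hg, ← Finset.sum_mul]
    exact mul_le_mul_of_nonneg_right (hf a) hv
  refine (Finset.sum_le_sum fun a _ => this a).trans_eq ?_
  simp

omit [DecidableEq E] hI in
lemma sum_rotate (F : ι → ι → ι → ℝ) :
    ∑ a, ∑ b, ∑ c, F a b c = ∑ b, ∑ c, ∑ a, F a b c := by
  rw [Finset.sum_comm]
  exact Finset.sum_congr rfl fun b _ => Finset.sum_comm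

lemma sum_tripleMain (p : ℝ) :
    ∑ a, ∑ b, ∑ c, tripleMain p h (I a ∩ I b).card (I b ∩ I c).card (I a ∩ I c).card
        (I a ∩ I b ∩ I c).card
      = p ^ (3 * h) * ((p⁻¹ - 1) ^ 2 * (3 * (Fintype.card ι * (h * N) ^ 2))
        + ((p⁻¹ - 1) * (p⁻¹ - 2) - 3 * (p⁻¹ - 1) ^ 2) * (Fintype.card ι * (h * N ^ 2))) := by
  have s1 : ∑ a, ∑ b, ∑ c, ((I a ∩ I b).card : ℝ) * (I b ∩ I c).card
      = Fintype.card ι * (h * N) ^ 2 := by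
    rw [Finset.sum_comm]
    simp_rw [← Finset.mul_sum, hI.sum_card_inter_self, ← Finset.sum_mul, hI.sum_card_inter_self']
    simp
    ring
  have s2 : ∑ a, ∑ b, ∑ c, ((I b ∩ I c).card : ℝ) * (I a ∩ I c).card
      = Fintype.card ι * (h * N) ^ 2 := by
    rw [sum_rotate]
    simp_rw [← Finset.mul_sum, hI.sum_card_inter_self', ← Finset.sum_mul, hI.sum_card_inter_self]
    simp
    ring
  have s3 : ∑ a, ∑ b, ∑ c, ((I a ∩ I b).card : ℝ) * (I a ∩ I c).card
      = Fintype.card ι * (h * N) ^ 2 := by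
    simp_rw [← Finset.sum_mul_sum, hI.sum_card_inter_self]
    simp only [Finset.sum_const, Finset.card_univ, nsmul_eq_mul]
    ring
  have s4 : ∑ a, ∑ b, ∑ c, ((I a ∩ I b ∩ I c).card : ℝ) = Fintype.card ι * (h * N ^ 2) := by
    have : ∀ a b, ∑ c, ((I a ∩ I b ∩ I c).card : ℝ) = (I a ∩ I b).card * N := fun a b =>
      hI.sum_card_inter a Finset.inter_subset_left
    simp_rw [this, ← Finset.sum_mul, hI.sum_card_inter_self]
    simp
    ring
  unfold tripleMain
  simp_rw [← Finset.mul_sum, Finset.sum_add_distrib, ← Finset.mul_sum, Finset.sum_add_distrib]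
  rw [s1, s2, s3, s4]
  ring

/-- Every exceptional pattern uses one codegree and one degree, so its total weight is O(card · N ·
Q) instead of card · N². The 7 counts six products of overlaps and one triangle term. -/
theorem abs_sum_tripleCumulant_sub_le {p : ℝ} (hp0 : 0 < p) (hp1 : p ≤ 1) :
    |∑ a, ∑ b, ∑ c, tripleCumulant p h (I a ∪ I b).card (I b ∪ I c).card (I a ∪ I c).card
        (I a ∪ I b ∪ I c).card
      - p ^ (3 * h) * ((p⁻¹ - 1) ^ 2 * (3 * (Fintype.card ι * (h * N) ^ 2))
        + ((p⁻¹ - 1) * (p⁻¹ - 2) - 3 * (p⁻¹ - 1) ^ 2) * (Fintype.card ι * (h * N ^ 2)))|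
      ≤ (6 + (p⁻¹ - 1) ^ 2 * (3 * h ^ 2)
        + |(p⁻¹ - 1) * (p⁻¹ - 2) - 3 * (p⁻¹ - 1) ^ 2| * h)
        * (7 * (Fintype.card ι * (h ^ 3 * (N * Q)))) := by
  set K := (6 + (p⁻¹ - 1) ^ 2 * (3 * h ^ 2)
        + |(p⁻¹ - 1) * (p⁻¹ - 2) - 3 * (p⁻¹ - 1) ^ 2| * h) with hK
  have hK0 : 0 ≤ K := by positivity
  have hN := hI.degree_nonneg
  rw [← hI.sum_tripleMain p]
  simp_rw [← Finset.sum_sub_distrib]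
  have hle : ∀ a b, (I a ∩ I b).card ≤ h := fun a b =>
    (Finset.card_le_card Finset.inter_subset_left).trans_eq (hI.card_eq a)
  let o : ι → ι → ℝ := fun a b =>
    ((I a ∩ I b).card : ℝ) * (I a ∩ I b).card - (I a ∩ I b).card
  let m : ι → ι → ℝ := fun a b => ((I a ∩ I b).card : ℝ)
  have ho0 : ∀ a b, 0 ≤ o a b := fun a b => by
    have : (I a ∩ I b).card ≤ (I a ∩ I b).card * (I a ∩ I b).card := Nat.le_mul_self _
    have : ((I a ∩ I b).card : ℝ) ≤ (I a ∩ I b).card * (I a ∩ I b).card := by exact_mod_cast this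
    change 0 ≤ _ - _
    linarith
  have ho : ∀ a, ∑ b, o a b ≤ h ^ 2 * Q := hI.sum_offDiag_le
  have ho' : ∀ a, ∑ b, o b a ≤ h ^ 2 * Q := hI.sum_offDiag_le'
  have hm : ∀ a, ∑ b, m a b = h * N := hI.sum_card_inter_self
  have hm' : ∀ a, ∑ b, m b a = h * N := hI.sum_card_inter_self'
  have hpt : ∀ a b c, |tripleCumulant p h (I a ∪ I b).card (I b ∪ I c).card (I a ∪ I c).card
        (I a ∪ I b ∪ I c).card - tripleMain p h (I a ∩ I b).card (I b ∩ I c).card (I a ∩ I c).card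
        (I a ∩ I b ∩ I c).card| ≤ K * (o a b * (m b c + m a c) + o b c * (m a b + m a c)
          + o a c * (m a b + m b c) + triangleCount (I a) (I b) (I c)) := by
    intro a b c
    refine abs_tripleCumulant_sub_le hp0 hp1 (hle _ _) (hle _ _) (hle _ _)
      (Finset.card_le_card Finset.inter_subset_left) (Finset.card_le_card ?_)
      (Finset.card_le_card ?_) (hI.card_union_two _ _) (hI.card_union_two _ _)
      (hI.card_union_two _ _) ?_ (triangleCount_nonneg _ _ _) ?_
    · intro x; simp only [Finset.mem_inter]; tauto
    · intro x; simp only [Finset.mem_inter]; tauto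
    · rw [card_union_three, hI.card_eq, hI.card_eq, hI.card_eq]
      ring
    · intro h1 h2 h3 h0
      exact one_le_triangleCount (Finset.card_pos.1 h1) (Finset.card_pos.1 h2)
        (Finset.card_pos.1 h3) (Finset.card_eq_zero.1 h0)
  have habs : ∀ F : ι → ι → ι → ℝ, |∑ a, ∑ b, ∑ c, F a b c| ≤ ∑ a, ∑ b, ∑ c, |F a b c| := fun F =>
    (Finset.abs_sum_le_sum_abs _ _).trans <| Finset.sum_le_sum fun a _ =>
      (Finset.abs_sum_le_sum_abs _ _).trans <| Finset.sum_le_sum fun b _ =>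
        Finset.abs_sum_le_sum_abs _ _
  refine (habs _).trans <| (Finset.sum_le_sum fun a _ => Finset.sum_le_sum fun b _ =>
    Finset.sum_le_sum fun c _ => hpt a b c).trans ?_
  simp_rw [← Finset.mul_sum]
  refine mul_le_mul_of_nonneg_left ?_ hK0
  have hhN : 0 ≤ h * N := by positivity
  -- In each of the six products the index common to both factors is moved outermost, after which
  -- the two other sums factor.
  have r1 : ∑ a, ∑ b, ∑ c, o a b * m b c ≤ Fintype.card ι * (h ^ 2 * Q * (h * N)) := by
    rw [Finset.sum_comm]
    exact sum_mul_le (fun b a => o a b) m ho' hm hhN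
  have r2 : ∑ a, ∑ b, ∑ c, o a b * m a c ≤ Fintype.card ι * (h ^ 2 * Q * (h * N)) :=
    sum_mul_le o m ho hm hhN
  have r3 : ∑ a, ∑ b, ∑ c, o b c * m a b ≤ Fintype.card ι * (h ^ 2 * Q * (h * N)) := by
    rw [sum_rotate]
    exact sum_mul_le o (fun b a => m a b) ho hm' hhN
  have r4 : ∑ a, ∑ b, ∑ c, o b c * m a c ≤ Fintype.card ι * (h ^ 2 * Q * (h * N)) := by
    rw [sum_rotate, Finset.sum_comm]
    exact sum_mul_le (fun c b => o b c) (fun c a => m a c) ho' hm' hhN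
  have r5 : ∑ a, ∑ b, ∑ c, o a c * m a b ≤ Fintype.card ι * (h ^ 2 * Q * (h * N)) := by
    rw [Finset.sum_congr rfl fun a _ => Finset.sum_comm]
    exact sum_mul_le o m ho hm hhN
  have r6 : ∑ a, ∑ b, ∑ c, o a c * m b c ≤ Fintype.card ι * (h ^ 2 * Q * (h * N)) := by
    rw [sum_rotate, sum_rotate]
    exact sum_mul_le (fun c a => o a c) (fun c b => m b c) ho' hm' hhN
  have r7 : ∑ a, ∑ b, ∑ c, triangleCount (I a) (I b) (I c)
      ≤ Fintype.card ι * (h ^ 2 * (h * (N * Q))) := by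
    rw [sum_rotate]
    refine (Finset.sum_le_sum fun b _ => hI.sum_triangleCount_le b).trans_eq ?_
    simp
  simp only [mul_add, Finset.sum_add_distrib]
  linarith

end RegularFamily

end Counting


/-! ### Degrees and codegrees of the copies of γ, and moment asymptotics -/

section CopyFamily

variable {k n : ℕ}

lemma exists_perm_map_eq {e f : Sym2 (Fin n)} (he : ¬ e.IsDiag) (hf : ¬ f.IsDiag) :
    ∃ π : Equiv.Perm (Fin n), Sym2.map π e = f := by
  induction e using Sym2.ind with
  | _ x y =>
    induction f using Sym2.ind with
    | _ x' y' =>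
      rw [Sym2.mk_isDiag_iff] at he hf
      refine ⟨(Equiv.swap x x').trans (Equiv.swap (Equiv.swap x x' y) y'), ?_⟩
      rw [Sym2.map_mk]
      have h1 : Equiv.swap x x' y ≠ x' := by
        intro h
        have : Equiv.swap x x' y = Equiv.swap x x' x := by rw [h, Equiv.swap_apply_left]
        exact he ((Equiv.swap x x').injective this).symm
      simp only [Equiv.trans_apply, Equiv.swap_apply_left]
      rw [Equiv.swap_apply_of_ne_of_ne h1.symm hf]

lemma copyEdges_trans (γ : SimpleGraph (Fin k)) (a : Fin k ↪ Fin n) (π : Equiv.Perm (Fin n))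
    (e : Sym2 (Fin n)) :
    Sym2.map π e ∈ copyEdges γ (a.trans π.toEmbedding) ↔ e ∈ copyEdges γ a := by
  simp only [mem_copyEdges]
  have h : ∀ g : Sym2 (Fin k), Sym2.map (a.trans π.toEmbedding) g = Sym2.map π (Sym2.map a g) := by
    intro g
    rw [Sym2.map_map]
    rfl
  simp_rw [h, (Sym2.map.injective π.injective).eq_iff]

/-- Permutations of the vertices act transitively on non-diagonal pairs and permute the embeddings.
-/
lemma degree_eq_degree (γ : SimpleGraph (Fin k)) {e f : Sym2 (Fin n)} (he : ¬ e.IsDiag)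
    (hf : ¬ f.IsDiag) :
    ∑ b : Fin k ↪ Fin n, (if e ∈ copyEdges γ b then (1 : ℝ) else 0)
      = ∑ b : Fin k ↪ Fin n, (if f ∈ copyEdges γ b then (1 : ℝ) else 0) := by
  obtain ⟨π, rfl⟩ := exists_perm_map_eq he hf
  refine Fintype.sum_equiv (Equiv.embeddingCongr (Equiv.refl _) π) _ _ fun b => ?_
  have : Equiv.embeddingCongr (Equiv.refl _) π b = b.trans π.toEmbedding := rfl
  rw [this]
  simp only [copyEdges_trans]

lemma card_embedding_cast (hk : 2 ≤ k) (hn : 2 ≤ n) :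
    (Fintype.card (Fin k ↪ Fin n) : ℝ)
      = n * (n - 1) * ((n - 2).descFactorial (k - 2) : ℕ) := by
  rw [Fintype.card_embedding_eq, Fintype.card_fin, Fintype.card_fin]
  obtain ⟨m, rfl⟩ := Nat.exists_eq_add_of_le' hn
  obtain ⟨l, rfl⟩ := Nat.exists_eq_add_of_le' hk
  rw [show m + 2 = (m + 1) + 1 from rfl, show l + 2 = (l + 1) + 1 from rfl,
    Nat.succ_descFactorial_succ, Nat.succ_descFactorial_succ]
  have h1 : m + 1 + 1 - 2 = m := by omega
  have h2 : l + 1 + 1 - 2 = l := by omega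
  rw [h1, h2]
  push_cast
  ring

/-- By symmetry all n(n−1)/2 pairs have the same degree, so it is the number of incidences
(embeddings times h) divided by the number of pairs. -/
lemma degree_copyEdges (γ : SimpleGraph (Fin k)) (hk : 2 ≤ k) {e : Sym2 (Fin n)}
    (he : ¬ e.IsDiag) :
    ∑ b : Fin k ↪ Fin n, (if e ∈ copyEdges γ b then (1 : ℝ) else 0)
      = 2 * edgeCount γ * ((n - 2).descFactorial (k - 2) : ℕ) := by
  classical
  have hn : 2 ≤ n := by
    induction e using Sym2.ind with
    | _ x y =>
      rw [Sym2.mk_isDiag_iff] at he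
      by_contra h
      have hx := x.2
      have hy := y.2
      exact he (Fin.ext (by omega))
  set d := ∑ b : Fin k ↪ Fin n, (if e ∈ copyEdges γ b then (1 : ℝ) else 0) with hd
  set S := (Finset.univ : Finset (Sym2 (Fin n))).filter (fun f => ¬ f.IsDiag) with hS
  have h1 : ∑ f ∈ S, ∑ b : Fin k ↪ Fin n, (if f ∈ copyEdges γ b then (1 : ℝ) else 0)
      = S.card * d := by
    rw [Finset.sum_congr rfl fun f hf => degree_eq_degree γ (Finset.mem_filter.1 hf).2 he,
      Finset.sum_const, nsmul_eq_mul]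
  have h2 : ∑ f ∈ S, ∑ b : Fin k ↪ Fin n, (if f ∈ copyEdges γ b then (1 : ℝ) else 0)
      = Fintype.card (Fin k ↪ Fin n) * edgeCount γ := by
    rw [Finset.sum_comm]
    have : ∀ b : Fin k ↪ Fin n, ∑ f ∈ S, (if f ∈ copyEdges γ b then (1 : ℝ) else 0)
        = edgeCount γ := by
      intro b
      have hsub : S.filter (· ∈ copyEdges γ b) = copyEdges γ b := by
        ext f
        simp only [hS, Finset.mem_filter, Finset.mem_univ, true_and]
        exact ⟨fun h => h.2, fun h => ⟨not_isDiag_of_mem_copyEdges h, h⟩⟩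
      rw [Finset.sum_boole, hsub, card_copyEdges]
    simp [this]
  have h3 : (S.card : ℝ) = n * (n - 1) / 2 := by
    have : S.card = n.choose 2 := by
      rw [hS, ← Fintype.card_subtype, Sym2.card_subtype_not_diag, Fintype.card_fin]
    rw [this, Nat.cast_choose_two]
  have hn' : (2 : ℝ) ≤ n := by exact_mod_cast hn
  rw [h1, h3, card_embedding_cast hk hn] at h2
  have hpos : (n : ℝ) * (n - 1) ≠ 0 := by
    have : 0 < (n : ℝ) - 1 := by linarith
    positivity
  apply mul_left_cancel₀ hpos
  linear_combination 2 * h2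

lemma card_filter_embedding_le (S : Finset (Fin k)) (W : Finset (Fin n)) :
    (Finset.univ.filter (fun b : Fin k ↪ Fin n => ∀ u ∈ S, b u ∈ W)).card
      ≤ W.card ^ S.card * n ^ (k - S.card) := by
  classical
  have h1 : (Finset.univ.filter (fun b : Fin k ↪ Fin n => ∀ u ∈ S, b u ∈ W)).card
      ≤ (Fintype.piFinset (fun u : Fin k => if u ∈ S then W else Finset.univ)).card := by
    refine Finset.card_le_card_of_injOn (fun b => (b : Fin k → Fin n)) ?_
      (fun a _ b _ h => DFunLike.coe_injective h)
    intro b hb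
    simp only [Finset.coe_filter, Finset.mem_univ, true_and, Set.mem_ofPred_eq] at hb
    simp only [Finset.mem_coe, Fintype.mem_piFinset]
    intro u
    by_cases hu : u ∈ S
    · simpa [hu] using hb u hu
    · simp [hu]
  refine h1.trans_eq ?_
  rw [Fintype.card_piFinset]
  have : ∀ u : Fin k, (if u ∈ S then W else Finset.univ).card = if u ∈ S then W.card else n := by
    intro u; split_ifs <;> simp
  simp_rw [this]
  rw [Finset.prod_ite, Finset.prod_const, Finset.prod_const, Finset.filter_mem_eq_inter,
    Finset.univ_inter, Finset.filter_not, Finset.filter_mem_eq_inter, Finset.univ_inter,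
    ← Finset.compl_eq_univ_sdiff, Finset.card_compl, Fintype.card_fin]

lemma three_le_card_union {α : Type*} [DecidableEq α] {e f : Sym2 α} (he : ¬ e.IsDiag)
    (hf : ¬ f.IsDiag) (hne : e ≠ f) : 3 ≤ (e.toFinset ∪ f.toFinset).card := by
  by_contra h
  have h1 := Sym2.card_toFinset_of_not_isDiag e he
  have h2 := Sym2.card_toFinset_of_not_isDiag f hf
  have h3 : e.toFinset = e.toFinset ∪ f.toFinset :=
    Finset.eq_of_subset_of_card_le Finset.subset_union_left (by omega)
  have h4 : f.toFinset = e.toFinset ∪ f.toFinset :=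
    Finset.eq_of_subset_of_card_le Finset.subset_union_right (by omega)
  refine hne (Sym2.ext fun x => ?_)
  rw [← Sym2.mem_toFinset, ← Sym2.mem_toFinset, h3, ← h4]

/-- Two distinct edges of γ span at least three vertices, and a copy sending them to `e` and `f`
maps those vertices into a set of at most four. Writing `n ^ k / n ^ 3` avoids truncated subtraction
when k = 2. -/
lemma codegree_copyEdges_le (γ : SimpleGraph (Fin k)) (hn : 1 ≤ n) {e f : Sym2 (Fin n)}
    (hne : e ≠ f) :
    ∑ b : Fin k ↪ Fin n, (if e ∈ copyEdges γ b ∧ f ∈ copyEdges γ b then (1 : ℝ) else 0)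
      ≤ (edgeCount γ : ℝ) ^ 2 * 4 ^ k * n ^ k / n ^ 3 := by
  classical
  rw [Finset.sum_boole]
  set W := e.toFinset ∪ f.toFinset
  have hW : W.card ≤ 4 := by
    refine (Finset.card_union_le _ _).trans ?_
    have h1 := Sym2.card_toFinset e
    have h2 := Sym2.card_toFinset f
    split_ifs at h1 h2 <;> omega
  have hsub : (Finset.univ.filter
      (fun b : Fin k ↪ Fin n => e ∈ copyEdges γ b ∧ f ∈ copyEdges γ b))
      ⊆ (patternEdges γ).offDiag.biUnion (fun g => Finset.univ.filter
        (fun b : Fin k ↪ Fin n => ∀ u ∈ g.1.toFinset ∪ g.2.toFinset, b u ∈ W)) := by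
    intro b hb
    simp only [Finset.mem_filter, Finset.mem_univ, true_and] at hb
    obtain ⟨⟨g, hg, rfl⟩, ⟨g', hg', rfl⟩⟩ := mem_copyEdges.1 hb.1, mem_copyEdges.1 hb.2
    simp only [Finset.mem_biUnion, Finset.mem_filter, Finset.mem_univ, true_and,
      Finset.mem_offDiag]
    refine ⟨(g, g'), ⟨by simpa [patternEdges] using hg, by simpa [patternEdges] using hg',
      fun h : g = g' => hne (by rw [h])⟩, fun u hu => ?_⟩
    simp only [W, Finset.mem_union, Sym2.mem_toFinset, Sym2.mem_map] at hu ⊢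
    rcases hu with hu | hu
    exacts [Or.inl ⟨u, hu, rfl⟩, Or.inr ⟨u, hu, rfl⟩]
  have hcard : ∀ g ∈ (patternEdges γ).offDiag, (Finset.univ.filter
      (fun b : Fin k ↪ Fin n => ∀ u ∈ g.1.toFinset ∪ g.2.toFinset, b u ∈ W)).card * n ^ 3
      ≤ 4 ^ k * n ^ k := by
    intro g hg
    obtain ⟨hg1, hg2, hg3⟩ := Finset.mem_offDiag.1 hg
    simp only [patternEdges, Set.Finite.mem_toFinset] at hg1 hg2
    have h3 := three_le_card_union (γ.not_isDiag_of_mem_edgeSet hg1)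
      (γ.not_isDiag_of_mem_edgeSet hg2) hg3
    set S := g.1.toFinset ∪ g.2.toFinset
    have hSk : S.card ≤ k := (Finset.card_le_univ S).trans_eq (Fintype.card_fin k)
    calc _ ≤ W.card ^ S.card * n ^ (k - S.card) * n ^ 3 :=
          Nat.mul_le_mul_right _ (card_filter_embedding_le S W)
      _ ≤ 4 ^ k * n ^ (k - 3) * n ^ 3 := by
          gcongr ?_ * ?_ * _
          · exact (Nat.pow_le_pow_left hW _).trans (Nat.pow_le_pow_right (by norm_num) hSk)
          · exact Nat.pow_le_pow_right hn (by omega)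
      _ = 4 ^ k * n ^ k := by
          rw [mul_assoc, ← pow_add, Nat.sub_add_cancel (h3.trans hSk)]
  have hn' : (0 : ℝ) < n := by exact_mod_cast hn
  rw [le_div_iff₀ (by positivity)]
  have hnat : (Finset.univ.filter
      (fun b : Fin k ↪ Fin n => e ∈ copyEdges γ b ∧ f ∈ copyEdges γ b)).card * n ^ 3
      ≤ edgeCount γ ^ 2 * (4 ^ k * n ^ k) := by
    calc _ ≤ (∑ g ∈ (patternEdges γ).offDiag, (Finset.univ.filter
        (fun b : Fin k ↪ Fin n => ∀ u ∈ g.1.toFinset ∪ g.2.toFinset, b u ∈ W)).card) * n ^ 3 :=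
          Nat.mul_le_mul_right _ ((Finset.card_le_card hsub).trans Finset.card_biUnion_le)
      _ ≤ ∑ g ∈ (patternEdges γ).offDiag, 4 ^ k * n ^ k := by
          rw [Finset.sum_mul]
          exact Finset.sum_le_sum hcard
      _ = (patternEdges γ).offDiag.card * (4 ^ k * n ^ k) := by simp
      _ ≤ _ := by
          gcongr
          rw [Finset.offDiag_card, card_patternEdges, pow_two]
          exact Nat.sub_le _ _
  rw [mul_assoc]
  exact_mod_cast hnat

theorem regularFamily_copyEdges (γ : SimpleGraph (Fin k)) (hk : 2 ≤ k) (hn : 1 ≤ n) :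
    RegularFamily (copyEdges γ (n := n)) (edgeCount γ)
      (2 * edgeCount γ * ((n - 2).descFactorial (k - 2) : ℕ))
      ((edgeCount γ : ℝ) ^ 2 * 4 ^ k * n ^ k / n ^ 3) where
  card_eq := card_copyEdges γ
  degree _ _ he := degree_copyEdges γ hk (not_isDiag_of_mem_copyEdges he)
  codegree _ _ hne := codegree_copyEdges_le γ hn hne
  degree_nonneg := by positivity
  codegree_nonneg := by positivity

lemma two_le_of_one_le_edgeCount {γ : SimpleGraph (Fin k)} (hγ : 1 ≤ edgeCount γ) : 2 ≤ k := by
  rw [← card_patternEdges] at hγ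
  obtain ⟨g, hg⟩ := Finset.card_pos.1 hγ
  simp only [patternEdges, Set.Finite.mem_toFinset] at hg
  have h1 := Sym2.card_toFinset_of_not_isDiag g (γ.not_isDiag_of_mem_edgeSet hg)
  have h2 := Finset.card_le_univ g.toFinset
  rw [Fintype.card_fin] at h2
  omega

/-- Bernoulli's inequality for (1 − k/n)^{k−2}: the falling factorial is β_n up to relative error
O(1/n). -/
lemma sub_le_descFactorial (hk : 2 ≤ k) (hn : k ≤ n) :
    beta k n - k ^ 2 * beta k n / n ≤ ((n - 2).descFactorial (k - 2) : ℕ) := by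
  have hn0 : (0 : ℝ) < n := by exact_mod_cast (by omega : 0 < n)
  have h1 := Nat.pow_sub_le_descFactorial (n - 2) (k - 2)
  have h2 : n - 2 + 1 - (k - 2) = n + 1 - k := by omega
  rw [h2] at h1
  have h3 : ((n + 1 - k : ℕ) : ℝ) ^ (k - 2) ≤ ((n - 2).descFactorial (k - 2) : ℕ) := by
    exact_mod_cast h1
  refine le_trans ?_ h3
  have h4 : (n : ℝ) - k ≤ ((n + 1 - k : ℕ) : ℝ) := by
    rw [Nat.cast_sub (by omega)]
    push_cast
    linarith
  have hkn : (k : ℝ) ≤ n := by exact_mod_cast hn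
  have h5 : (n : ℝ) - k = n * (1 + (-(k / n))) := by field_simp; ring
  have h6 : (k : ℝ) / n ≤ 1 := (div_le_one hn0).2 hkn
  have h7 := one_add_mul_le_pow (a := -(k / n : ℝ)) (by linarith) (k - 2)
  have h8 : ((k - 2 : ℕ) : ℝ) ≤ k := by exact_mod_cast Nat.sub_le _ _
  have h9 : 0 ≤ (k : ℝ) / n := by positivity
  calc beta k n - k ^ 2 * beta k n / n = n ^ (k - 2) * (1 + k * (-(k / n : ℝ))) := by
        unfold beta; field_simp
        ring
    _ ≤ n ^ (k - 2) * (1 + ((k - 2 : ℕ) : ℝ) * (-(k / n : ℝ))) := by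
        refine mul_le_mul_of_nonneg_left ?_ (by positivity)
        nlinarith
    _ ≤ n ^ (k - 2) * (1 + (-(k / n : ℝ))) ^ (k - 2) := by gcongr
    _ = ((n : ℝ) - k) ^ (k - 2) := by rw [h5, mul_pow]
    _ ≤ _ := pow_le_pow_left₀ (by linarith) h4 _

lemma descFactorial_le_beta (k n : ℕ) : (((n - 2).descFactorial (k - 2) : ℕ) : ℝ) ≤ beta k n := by
  have h1 := Nat.descFactorial_le_pow (n - 2) (k - 2)
  have h2 : (n - 2) ^ (k - 2) ≤ n ^ (k - 2) := Nat.pow_le_pow_left (Nat.sub_le _ _) _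
  unfold beta
  exact_mod_cast h1.trans h2

/-- For ν = n, `D` the falling factorial and β = β_n, the left-hand product is the number of
embeddings times D^{m−1} when m ≥ 1. Replacing D by β and n − 1 by n costs a relative O(1/n), by
induction on m. -/
lemma abs_mul_pow_sub_le {ν β D c : ℝ} (hν : 1 ≤ ν) (hD : 0 ≤ D) (hDβ : D ≤ β)
    (hβ : β - c * β / ν ≤ D) (m : ℕ) :
    |ν * (ν - 1) * D ^ m - ν ^ 2 * β ^ m| ≤ (m * c + 1) * (ν * β ^ m) := by
  have hβ0 : 0 ≤ β := hD.trans hDβ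
  have h1 : D ^ m ≤ β ^ m := pow_le_pow_left₀ hD hDβ m
  have h2 : ν * (β ^ m - D ^ m) ≤ m * c * β ^ m := by
    induction m with
    | zero => simp
    | succ m ih =>
      have ih := ih (pow_le_pow_left₀ hD hDβ m)
      have e1 : ν * (β - D) ≤ c * β := by
        have : β - D ≤ c * β / ν := by linarith
        calc ν * (β - D) ≤ ν * (c * β / ν) := by gcongr
          _ = c * β := by field_simp
      have e2 : D ^ m ≤ β ^ m := pow_le_pow_left₀ hD hDβ m
      have e3 : ν * (β ^ (m + 1) - D ^ (m + 1))
          = β * (ν * (β ^ m - D ^ m)) + D ^ m * (ν * (β - D)) := by ring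
      rw [e3]
      have e4 : D ^ m * (ν * (β - D)) ≤ β ^ m * (c * β) := by
        have : 0 ≤ D ^ m := pow_nonneg hD m
        have : 0 ≤ ν * (β - D) := mul_nonneg (by linarith) (by linarith)
        gcongr
      have e5 : β * (ν * (β ^ m - D ^ m)) ≤ β * (m * c * β ^ m) := by gcongr
      push_cast
      rw [pow_succ]
      linarith
  have hDm : 0 ≤ D ^ m := pow_nonneg hD m
  have h3 : ν * (ν - 1) * D ^ m - ν ^ 2 * β ^ m = -(ν * (ν * (β ^ m - D ^ m)) + ν * D ^ m) := by
    ring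
  have h4 : 0 ≤ ν * (ν * (β ^ m - D ^ m)) := by
    have : 0 ≤ β ^ m - D ^ m := by linarith
    positivity
  rw [h3, abs_neg, abs_of_nonneg (by positivity)]
  have h5 : ν * (ν * (β ^ m - D ^ m)) ≤ ν * (m * c * β ^ m) := by gcongr
  have h6 : ν * D ^ m ≤ ν * β ^ m := by gcongr
  linarith

lemma codegree_eq {c : ℝ} (hk : 2 ≤ k) (hn : 1 ≤ n) :
    c * (n : ℝ) ^ k / n ^ 3 = c * (beta k n / n) := by
  have hn0 : (n : ℝ) ≠ 0 := by
    have : n ≠ 0 := by omega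
    exact_mod_cast this
  have : (n : ℝ) ^ k = beta k n * n ^ 2 := by
    rw [beta, ← pow_add, Nat.sub_add_cancel hk]
  rw [this]
  field_simp

theorem exists_abs_second_moment_sub_le (γ : SimpleGraph (Fin k)) (hγ : 1 ≤ edgeCount γ)
    (p : unitInterval) (hp0 : 0 < (p : ℝ)) :
    ∃ C : ℝ, ∀ n : ℕ, k ≤ n →
      |∫ Γ, centeredCount γ p n Γ ^ 2 ∂(SimpleGraph.binomialRandom (Fin n) p)
        - sigmaSq (edgeCount γ) p * (n ^ 2 * beta k n ^ 2)| ≤ C * (n * beta k n ^ 2) := by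
  have hk := two_le_of_one_le_edgeCount hγ
  set h := edgeCount γ with hh
  set q : ℝ := (p : ℝ) with hq
  have hq1 : q ≤ 1 := p.2.2
  have hr : 0 ≤ q⁻¹ - 1 := by
    have := (one_le_inv₀ hp0).2 hq1
    linarith
  -- Since h ≥ 1, the exponent `2 * h - 1` is not truncated. The factor 2h² is h · N/D with N = 2hD.
  have hσ : sigmaSq h q = q ^ (2 * h) * (q⁻¹ - 1) * (2 * h ^ 2) := by
    have : q ^ (2 * h) = q ^ (2 * h - 1) * q := by
      rw [← pow_succ]; congr 1; omega
    rw [sigmaSq, this]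
    field_simp
  have hσ0 : 0 ≤ sigmaSq h q := by rw [hσ]; positivity
  refine ⟨(1 + (q⁻¹ - 1) * h) * (h ^ 2 * (h ^ 2 * 4 ^ k)) + sigmaSq h q * (2 * k ^ 2 + 1),
    fun n hn => ?_⟩
  have hn2 : 2 ≤ n := hk.trans hn
  have hn1 : (1 : ℝ) ≤ n := by exact_mod_cast (by omega : 1 ≤ n)
  have key := (regularFamily_copyEdges (n := n) γ hk (by omega)).abs_sum_covariance_sub_le hp0 hq1
  rw [integral_centeredCount_sq]
  rw [card_embedding_cast hk hn2, codegree_eq hk (by omega)] at key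
  set S := ∑ a : Fin k ↪ Fin n, ∑ b : Fin k ↪ Fin n,
    (q ^ (copyEdges γ a ∪ copyEdges γ b).card - q ^ (2 * h))
  set D := (((n - 2).descFactorial (k - 2) : ℕ) : ℝ) with hD
  have hDβ : D ≤ beta k n := descFactorial_le_beta k n
  have hD0 : 0 ≤ D := by positivity
  have hβ0 : 0 ≤ beta k n := hD0.trans hDβ
  have e1 := abs_mul_pow_sub_le hn1 hD0 hDβ (sub_le_descFactorial hk hn) 2
  have e2 : (n : ℝ) * (n - 1) * D ≤ n * n * beta k n := by
    have : (0 : ℝ) ≤ n - 1 := by linarith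
    gcongr
    linarith
  have e3 : (n : ℝ) * (n - 1) * D * (h ^ 2 * (h ^ 2 * 4 ^ k * (beta k n / n)))
      ≤ h ^ 2 * (h ^ 2 * 4 ^ k) * (n * beta k n ^ 2) := by
    calc _ ≤ (n : ℝ) * n * beta k n * (h ^ 2 * (h ^ 2 * 4 ^ k * (beta k n / n))) := by gcongr
      _ = _ := by field_simp
  have e4 : S - sigmaSq h q * (n ^ 2 * beta k n ^ 2)
      = (S - q ^ (2 * h) * (q⁻¹ - 1) * ((n : ℝ) * (n - 1) * D * (h * (2 * h * D))))
        + sigmaSq h q * ((n : ℝ) * (n - 1) * D ^ 2 - n ^ 2 * beta k n ^ 2) := by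
    rw [hσ]; ring
  rw [e4]
  refine (abs_add_le _ _).trans ?_
  rw [abs_mul, abs_of_nonneg hσ0, add_mul, mul_assoc (1 + (q⁻¹ - 1) * (h : ℝ)),
    mul_assoc (sigmaSq h q)]
  refine add_le_add (key.trans ?_) ?_
  · gcongr
  · gcongr
    exact_mod_cast e1

theorem exists_abs_third_moment_sub_le (γ : SimpleGraph (Fin k)) (hγ : 1 ≤ edgeCount γ)
    (p : unitInterval) (hp0 : 0 < (p : ℝ)) :
    ∃ C : ℝ, ∀ n : ℕ, k ≤ n →
      |∫ Γ, centeredCount γ p n Γ ^ 3 ∂(SimpleGraph.binomialRandom (Fin n) p)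
        - thirdCoeff (edgeCount γ) p * (n ^ 2 * beta k n ^ 3)| ≤ C * (n * beta k n ^ 3) := by
  have hk := two_le_of_one_le_edgeCount hγ
  set h := edgeCount γ with hh
  set q : ℝ := (p : ℝ) with hq
  have hq1 : q ≤ 1 := p.2.2
  -- With N = 2hD, 3(hN)² gives 12h⁴ (two single overlaps) and hN² gives 4h³ (a common edge).
  have hL : thirdCoeff h q = q ^ (3 * h) * ((q⁻¹ - 1) ^ 2 * (12 * h ^ 4)
      + ((q⁻¹ - 1) * (q⁻¹ - 2) - 3 * (q⁻¹ - 1) ^ 2) * (4 * h ^ 3)) := by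
    have : q ^ (3 * h) = q ^ (3 * h - 2) * q ^ 2 := by
      rw [← pow_add]; congr 1; omega
    rw [thirdCoeff, this]
    field_simp
    ring
  set K := 6 + (q⁻¹ - 1) ^ 2 * (3 * h ^ 2)
        + |(q⁻¹ - 1) * (q⁻¹ - 2) - 3 * (q⁻¹ - 1) ^ 2| * h with hK
  have hK0 : 0 ≤ K := by positivity
  refine ⟨K * (7 * (h ^ 3 * (2 * h * (h ^ 2 * 4 ^ k)))) + |thirdCoeff h q| * (3 * k ^ 2 + 1),
    fun n hn => ?_⟩
  have hn2 : 2 ≤ n := hk.trans hn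
  have hn1 : (1 : ℝ) ≤ n := by exact_mod_cast (by omega : 1 ≤ n)
  have key := (regularFamily_copyEdges (n := n) γ hk (by omega)).abs_sum_tripleCumulant_sub_le
    hp0 hq1
  rw [integral_centeredCount_cube]
  rw [card_embedding_cast hk hn2, codegree_eq hk (by omega)] at key
  unfold tripleCumulant at key
  rw [← hh, ← hK] at key
  set S := ∑ a : Fin k ↪ Fin n, ∑ b : Fin k ↪ Fin n, ∑ c : Fin k ↪ Fin n,
        (q ^ (copyEdges γ a ∪ copyEdges γ b ∪ copyEdges γ c).card
          - q ^ h * (q ^ (copyEdges γ a ∪ copyEdges γ b).card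
            + q ^ (copyEdges γ b ∪ copyEdges γ c).card
            + q ^ (copyEdges γ a ∪ copyEdges γ c).card)
          + 2 * q ^ (3 * h))
  set D := (((n - 2).descFactorial (k - 2) : ℕ) : ℝ) with hD
  have hDβ : D ≤ beta k n := descFactorial_le_beta k n
  have hD0 : 0 ≤ D := by positivity
  have hβ0 : 0 ≤ beta k n := hD0.trans hDβ
  have e1 := abs_mul_pow_sub_le hn1 hD0 hDβ (sub_le_descFactorial hk hn) 3
  have e2 : (n : ℝ) * (n - 1) * D ≤ n * n * beta k n := by
    have : (0 : ℝ) ≤ n - 1 := by linarith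
    gcongr
    linarith
  have e3 : (n : ℝ) * (n - 1) * D * (h ^ 3 * (2 * h * D * (h ^ 2 * 4 ^ k * (beta k n / n))))
      ≤ h ^ 3 * (2 * h * (h ^ 2 * 4 ^ k)) * (n * beta k n ^ 3) := by
    calc _ ≤ (n : ℝ) * n * beta k n *
          (h ^ 3 * (2 * h * beta k n * (h ^ 2 * 4 ^ k * (beta k n / n)))) := by gcongr
      _ = _ := by field_simp
  have e4 : S - thirdCoeff h q * (n ^ 2 * beta k n ^ 3)
      = (S - q ^ (3 * h) * ((q⁻¹ - 1) ^ 2 * (3 * ((n : ℝ) * (n - 1) * D * (h * (2 * h * D)) ^ 2))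
        + ((q⁻¹ - 1) * (q⁻¹ - 2) - 3 * (q⁻¹ - 1) ^ 2) *
          ((n : ℝ) * (n - 1) * D * (h * (2 * h * D) ^ 2))))
        + thirdCoeff h q * ((n : ℝ) * (n - 1) * D ^ 3 - n ^ 2 * beta k n ^ 3) := by
    rw [hL]; ring
  rw [e4]
  refine (abs_add_le _ _).trans ?_
  rw [abs_mul, add_mul, mul_assoc K, mul_assoc |thirdCoeff h q|]
  refine add_le_add (key.trans ?_) ?_
  · rw [mul_assoc 7]
    gcongr
  · gcongr
    exact_mod_cast e1

end CopyFamily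


/-! ### Taylor expansion of the logarithm of a zero-free function -/

section LogExpansion

open Metric

/-- Take a primitive `f` of M'/M on the disc; then M e^{−f} has zero derivative and equals 1 at the
origin. -/
lemma exists_log_of_hasDerivAt {M M₁ : ℂ → ℂ} (h₁ : ∀ z, HasDerivAt M (M₁ z) z)
    (hd : Differentiable ℂ M₁) {R : ℝ} (hR : 0 < R) (hne : ∀ z ∈ ball (0 : ℂ) R, M z ≠ 0)
    (hM0 : M 0 = 1) :
    ∃ f : ℂ → ℂ, f 0 = 0 ∧ (∀ z ∈ ball (0 : ℂ) R, HasDerivAt f (M₁ z / M z) z) ∧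
      ∀ z ∈ ball (0 : ℂ) R, M z = Complex.exp (f z) := by
  have hdM : Differentiable ℂ M := fun z => (h₁ z).differentiableAt
  have hg : DifferentiableOn ℂ (fun z => M₁ z / M z) (ball 0 R) :=
    hd.differentiableOn.div hdM.differentiableOn hne
  obtain ⟨f, hf0, hf⟩ := hg.isExactOn_ball.with_val_at 0 0
  refine ⟨f, hf0, hf, fun z hz => ?_⟩
  have hconst : ∀ x ∈ ball (0 : ℂ) R, HasDerivAt (fun z => M z * Complex.exp (-f z)) 0 x := by
    intro x hx
    have h := hne x hx
    have h' : M₁ x * Complex.exp (-f x) + M x * (Complex.exp (-f x) * -(M₁ x / M x)) = 0 := by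
      field_simp
      ring
    rw [← h']
    exact (h₁ x).mul (hf x hx).neg.cexp
  have h0 : (0 : ℂ) ∈ ball (0 : ℂ) R := mem_ball_self hR
  have := isOpen_ball.is_const_of_deriv_eq_zero (convex_ball (0 : ℂ) R).isPreconnected
    (fun x hx => (hconst x hx).differentiableAt.differentiableWithinAt)
    (fun x hx => (hconst x hx).deriv) hz h0
  simp only [hf0, hM0, neg_zero, Complex.exp_zero, mul_one] at this
  rw [Complex.exp_neg] at this
  exact (mul_inv_eq_one₀ (Complex.exp_ne_zero _)).1 this

/-- Cauchy's estimates bound the j-th term by B(‖w‖/r)^j; the tail from j = 4 is geometric with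
ratio at most 1/2, hence the factor 2. -/
lemma norm_sub_cubic_taylor_le {f : ℂ → ℂ} {r B : ℝ} (hr : 0 < r)
    (hf : DiffContOnCl ℂ f (ball 0 r)) (hB : ∀ z ∈ closedBall (0 : ℂ) r, ‖f z‖ ≤ B) {w : ℂ}
    (hw : ‖w‖ ≤ r / 2) :
    ‖f w - (f 0 + iteratedDeriv 1 f 0 * w + iteratedDeriv 2 f 0 / 2 * w ^ 2
      + iteratedDeriv 3 f 0 / 6 * w ^ 3)‖ ≤ 2 * B / r ^ 4 * ‖w‖ ^ 4 := by
  have hB0 : 0 ≤ B := (norm_nonneg _).trans (hB 0 (mem_closedBall_self hr.le))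
  have hwb : w ∈ ball (0 : ℂ) r := by
    rw [mem_ball_zero_iff]
    linarith
  have hs := Complex.hasSum_taylorSeries_on_ball hf.differentiableOn hwb
  have hterm : ∀ j : ℕ, ‖(j.factorial : ℂ)⁻¹ • (w - 0) ^ j • iteratedDeriv j f 0‖
      ≤ B * (‖w‖ / r) ^ j := by
    intro j
    have h1 := Complex.norm_iteratedDeriv_le_of_forall_mem_sphere_norm_le j hr hf
      (fun z hz => hB z (sphere_subset_closedBall hz))
    rw [norm_smul, norm_smul, sub_zero, norm_inv, norm_pow, Complex.norm_natCast]
    have hfac : (0 : ℝ) < j.factorial := by exact_mod_cast j.factorial_pos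
    calc _ ≤ (j.factorial : ℝ)⁻¹ * (‖w‖ ^ j * (j.factorial * B / r ^ j)) := by gcongr
      _ = _ := by rw [div_pow]; field_simp
  have htail := (hasSum_nat_add_iff' 4).2 hs
  have hsum : ∑ i ∈ Finset.range 4, (i.factorial : ℂ)⁻¹ • (w - 0) ^ i • iteratedDeriv i f 0
      = f 0 + iteratedDeriv 1 f 0 * w + iteratedDeriv 2 f 0 / 2 * w ^ 2
      + iteratedDeriv 3 f 0 / 6 * w ^ 3 := by
    simp only [Finset.sum_range_succ, Finset.sum_range_zero, smul_eq_mul, sub_zero,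
      iteratedDeriv_zero, Nat.factorial]
    push_cast
    ring
  rw [hsum] at htail
  have hx : ‖w‖ / r ≤ 1 / 2 := by
    rw [div_le_iff₀ hr]
    linarith
  have hx0 : 0 ≤ ‖w‖ / r := by positivity
  have hgeo : HasSum (fun j : ℕ => B * (‖w‖ / r) ^ 4 * (‖w‖ / r) ^ j)
      (B * (‖w‖ / r) ^ 4 * (1 - ‖w‖ / r)⁻¹) :=
    (hasSum_geometric_of_lt_one hx0 (by linarith)).mul_left _
  have hle := htail.norm_le_of_bounded hgeo (fun j => (hterm (j + 4)).trans_eq (by ring))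
  refine hle.trans ?_
  have hinv : (1 - ‖w‖ / r)⁻¹ ≤ 2 := by
    rw [inv_le_comm₀ (by linarith) (by norm_num)]
    linarith
  calc _ ≤ B * (‖w‖ / r) ^ 4 * 2 := by gcongr
    _ = _ := by rw [div_pow]; ring

/-- An upper bound on |M| bounds Re log M only from above, which is what Borel–Carathéodory needs.
As M(0) = 1 and M'(0) = 0, the second and third derivatives of log M at 0 are those of M. -/
theorem exists_cubic_expansion {M M₁ M₂ M₃ : ℂ → ℂ} (h₁ : ∀ z, HasDerivAt M (M₁ z) z)
    (h₂ : ∀ z, HasDerivAt M₁ (M₂ z) z) (h₃ : ∀ z, HasDerivAt M₂ (M₃ z) z) {R B : ℝ}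
    (hR : 0 < R) (hB : 0 < B) (hne : ∀ z ∈ ball (0 : ℂ) R, M z ≠ 0)
    (hbound : ∀ z ∈ ball (0 : ℂ) R, ‖M z‖ ≤ Real.exp B) (hM0 : M 0 = 1) (hM1 : M₁ 0 = 0) {w : ℂ}
    (hw : ‖w‖ ≤ R / 4) :
    ∃ S : ℂ, ‖S‖ ≤ 64 * B / R ^ 4 * ‖w‖ ^ 4 ∧
      M w = Complex.exp (M₂ 0 / 2 * w ^ 2 + M₃ 0 / 6 * w ^ 3 + S) := by
  obtain ⟨f, hf0, hf, hexp⟩ := exists_log_of_hasDerivAt h₁ (fun z => (h₂ z).differentiableAt) hR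
    hne hM0
  have hfd : DifferentiableOn ℂ f (ball 0 R) := fun z hz =>
    (hf z hz).differentiableAt.differentiableWithinAt
  have hre : Set.MapsTo f (ball 0 R) {z | z.re ≤ B} := by
    intro z hz
    have := hbound z hz
    rw [hexp z hz, Complex.norm_exp, Real.exp_le_exp] at this
    exact this
  have hbd : ∀ z ∈ closedBall (0 : ℂ) (R / 2), ‖f z‖ ≤ 2 * B := by
    intro z hz
    rw [mem_closedBall_zero_iff] at hz
    have hzR : z ∈ ball (0 : ℂ) R := by
      rw [mem_ball_zero_iff]
      linarith
    refine (Complex.borelCaratheodory_zero hB hfd hre hR hzR hf0).trans ?_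
    rw [div_le_iff₀ (by linarith)]
    have h1 : ‖z‖ ≤ R - ‖z‖ := by linarith
    gcongr
  have hcl : DiffContOnCl ℂ f (ball 0 (R / 2)) := by
    refine DifferentiableOn.diffContOnCl (hfd.mono ?_)
    exact closure_ball_subset_closedBall.trans (closedBall_subset_ball (by linarith))
  -- Radius R/2 and bound 2B give the constant 2 · 2B/(R/2)⁴ = 64B/R⁴.
  have ht := norm_sub_cubic_taylor_le (half_pos hR) hcl hbd (w := w) (by linarith)
  have hnhds : ball (0 : ℂ) R ∈ 𝓝 (0 : ℂ) := ball_mem_nhds 0 hR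
  have d1 : deriv f =ᶠ[𝓝 0] fun z => M₁ z / M z := by
    filter_upwards [hnhds] with z hz using (hf z hz).deriv
  have d2 : deriv (deriv f) =ᶠ[𝓝 0] fun z => (M₂ z * M z - M₁ z * M₁ z) / M z ^ 2 := by
    filter_upwards [d1.eventually_nhds, hnhds] with z hz hzR
    rw [EventuallyEq.deriv_eq hz]
    exact ((h₂ z).div (h₁ z) (hne z hzR)).deriv
  have i1 : iteratedDeriv 1 f 0 = 0 := by
    rw [iteratedDeriv_one, d1.eq_of_nhds, hM1, zero_div]
  have i2 : iteratedDeriv 2 f 0 = M₂ 0 := by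
    rw [iteratedDeriv_succ, iteratedDeriv_one, d2.eq_of_nhds, hM1, hM0]
    simp
  have i3 : iteratedDeriv 3 f 0 = M₃ 0 := by
    rw [iteratedDeriv_succ, iteratedDeriv_succ, iteratedDeriv_one, d2.deriv_eq]
    have hden : M 0 ^ 2 ≠ 0 := by rw [hM0]; norm_num
    have := ((((h₃ 0).mul (h₁ 0)).sub ((h₂ 0).mul (h₂ 0))).div ((h₁ 0).pow 2) hden).deriv
    rw [hM0, hM1] at this
    refine Eq.trans ?_ (this.trans ?_)
    · rfl
    · simp [hM0]
  rw [hf0, i1, i2, i3] at ht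
  refine ⟨f w - (M₂ 0 / 2 * w ^ 2 + M₃ 0 / 6 * w ^ 3), ?_, ?_⟩
  · convert ht using 1
    · congr 1; ring
    · field_simp; ring
  · rw [hexp w (by rw [mem_ball_zero_iff]; linarith)]
    congr 1
    ring

end LogExpansion

/-! ### Cubic expansion for the centered subgraph count -/

section CubicExpansion

/-- The logarithm of the moment generating function of `Y n` has a third order expansion, uniform
in a neighbourhood of zero, with variance `s * n ^ 2` and third cumulant `L * n ^ 2`. -/
def CubicExpansion {Ω : ℕ → Type*} [∀ n, MeasurableSpace (Ω n)] (P : ∀ n, Measure (Ω n))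
    (Y : ∀ n, Ω n → ℝ) (s L : ℝ) : Prop :=
  ∃ c C : ℝ, 0 < c ∧ 0 ≤ C ∧ ∀ᶠ n : ℕ in atTop, ∀ w : ℂ, ‖w‖ ≤ c → ∃ S : ℂ,
    ‖S‖ ≤ C * (n * ‖w‖ ^ 2 + n ^ 2 * ‖w‖ ^ 4) ∧
    complexMGF (Y n) (P n) w
      = Complex.exp (n ^ 2 * (s * w ^ 2 / 2 + L * w ^ 3 / 6) + S)

variable {k n : ℕ} (γ : SimpleGraph (Fin k))

/-- Centering contributes only an exponential factor. The rest is a partition sum with |u| ≤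
2|w|/β_n and degree at most 2hβ_n, so the powers of n cancel and the disc does not depend on n. -/
lemma complexMGF_centeredCount_ne_zero (hγ : 1 ≤ edgeCount γ) (p : unitInterval) (hn : 1 ≤ n)
    {w : ℂ} (hw : ‖w‖ * (16 * edgeCount γ * 2 ^ edgeCount γ) ≤ 1) :
    complexMGF (fun Γ => centeredCount γ p n Γ / beta k n) (SimpleGraph.binomialRandom (Fin n) p) w
      ≠ 0 := by
  classical
  have hk := two_le_of_one_le_edgeCount hγ
  have hn1 : (1 : ℝ) ≤ n := by exact_mod_cast hn
  have hβ1 : 1 ≤ beta k n := one_le_pow₀ hn1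
  have hβ0 : 0 < beta k n := by linarith
  set m := ∫ Γ', subgraphCount γ n Γ' ∂(SimpleGraph.binomialRandom (Fin n) p) with hm
  have h1 : complexMGF (fun Γ => centeredCount γ p n Γ / beta k n)
      (SimpleGraph.binomialRandom (Fin n) p) w = Complex.exp (-(w / beta k n * m))
        * complexMGF (subgraphCount γ n) (SimpleGraph.binomialRandom (Fin n) p)
          (w / beta k n) := by
    unfold complexMGF
    rw [← integral_const_mul]
    congr 1
    ext Γ
    have : centeredCount γ p n Γ = subgraphCount γ n Γ - m := rfl
    simp only [← Complex.exp_add, this]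
    congr 1
    push_cast
    ring
  rw [h1, complexMGF_subgraphCount]
  refine mul_ne_zero (Complex.exp_ne_zero _) ?_
  have hh : (1 : ℝ) ≤ edgeCount γ := by exact_mod_cast hγ
  have h2 : (1 : ℝ) ≤ 2 ^ edgeCount γ := one_le_pow₀ (by norm_num)
  have hwn := norm_nonneg w
  have hw1 : ‖w‖ * 16 ≤ 1 := by
    refine le_trans ?_ hw
    gcongr
    nlinarith
  have hnorm : ‖w / (beta k n : ℂ)‖ = ‖w‖ / beta k n := by
    rw [norm_div, Complex.norm_real, Real.norm_of_nonneg hβ0.le]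
  have hle : ‖w‖ / beta k n ≤ ‖w‖ := div_le_self hwn hβ1
  have hu : ‖Complex.exp (w / beta k n) - 1‖ ≤ 2 * (‖w‖ / beta k n) := by
    rw [← hnorm]
    exact Complex.norm_exp_sub_one_le (by rw [hnorm]; linarith)
  refine partitionSum_ne_zero p.2.1 p.2.2 (d := edgeCount γ)
    (D := 2 * edgeCount γ * (n - 2).descFactorial (k - 2)) (fun a => (card_copyEdges γ a).le)
    (fun e A => ?_) ?_ (by linarith) _
  · have hsub : (A.filter (e ∈ copyEdges γ ·)).card
        ≤ (Finset.univ.filter (fun b : Fin k ↪ Fin n => e ∈ copyEdges γ b)).card :=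
      Finset.card_le_card (Finset.filter_subset_filter _ (Finset.subset_univ _))
    refine hsub.trans ?_
    by_cases he : e.IsDiag
    · rw [Finset.filter_false_of_mem]
      · simp
      · exact fun b _ hb => not_isDiag_of_mem_copyEdges hb he
    · have := degree_copyEdges γ hk he
      rw [Finset.sum_boole] at this
      exact_mod_cast this.le
  · have hD := descFactorial_le_beta k n
    push_cast
    calc _ ≤ 2 * (‖w‖ / beta k n) * 2 ^ edgeCount γ * (2 * edgeCount γ * beta k n) := by gcongr
      _ = ‖w‖ * (16 * edgeCount γ * 2 ^ edgeCount γ) / 4 := by field_simp; ring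
      _ ≤ 1 / 4 := by linarith

lemma abs_centeredCount_div_le (p : unitInterval) (hk : 2 ≤ k) (hn : 1 ≤ n)
    (Γ : SimpleGraph (Fin n)) : |centeredCount γ p n Γ / beta k n| ≤ n ^ 2 := by
  have hn1 : (1 : ℝ) ≤ n := by exact_mod_cast hn
  have hβ0 : 0 < beta k n := pow_pos (by linarith) _
  rw [abs_div, abs_of_pos hβ0, div_le_iff₀ hβ0, beta, ← pow_add, Nat.add_sub_cancel' hk]
  exact abs_centeredCount_le γ p Γ

lemma hasDerivAt_integral_pow_mul_cexp_of_finite {Ω : Type*} [Finite Ω] [MeasurableSpace Ω]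
    [DiscreteMeasurableSpace Ω] (P : Measure Ω) [IsFiniteMeasure P] (Y : Ω → ℝ) (m : ℕ) (z : ℂ) :
    HasDerivAt (fun z : ℂ => ∫ ω, (Y ω : ℂ) ^ m * Complex.exp (z * Y ω) ∂P)
      (∫ ω, (Y ω : ℂ) ^ (m + 1) * Complex.exp (z * Y ω) ∂P) z := by
  refine hasDerivAt_integral_pow_mul_exp ?_ m
  have : integrableExpSet Y P = Set.univ := Set.eq_univ_of_forall fun t => by
    change Integrable _ _
    exact Integrable.of_finite
  simp [this]

theorem cubicExpansion_centeredCount (hγ : 1 ≤ edgeCount γ) (p : unitInterval)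
    (hp0 : 0 < (p : ℝ)) :
    CubicExpansion (fun n => SimpleGraph.binomialRandom (Fin n) p)
      (fun n Γ => centeredCount γ p n Γ / beta k n) (sigmaSq (edgeCount γ) p)
      (thirdCoeff (edgeCount γ) p) := by
  have hk := two_le_of_one_le_edgeCount hγ
  obtain ⟨C₂, hC₂⟩ := exists_abs_second_moment_sub_le γ hγ p hp0
  obtain ⟨C₃, hC₃⟩ := exists_abs_third_moment_sub_le γ hγ p hp0
  have hh : (1 : ℝ) ≤ edgeCount γ := by exact_mod_cast hγ
  have h2 : (1 : ℝ) ≤ 2 ^ edgeCount γ := one_le_pow₀ (by norm_num)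
  set K : ℝ := 16 * edgeCount γ * 2 ^ edgeCount γ with hK
  have hK1 : 1 ≤ K := by nlinarith
  -- `K⁻¹` is the zero-free radius R. The summand 64K⁴ is 64B/R⁴ with B = n² factored out; `C₂` and
  -- `C₃` are the errors of the two moments, the cubic one being absorbed since ‖w‖³ ≤ ‖w‖².
  refine ⟨K⁻¹ / 4, |C₂| + |C₃| + 64 * K ^ 4, by positivity, by positivity, ?_⟩
  filter_upwards [eventually_ge_atTop k] with n hn w hw
  have hn1 : (1 : ℝ) ≤ n := by exact_mod_cast (by omega : 1 ≤ n)
  have hβ0 : 0 < beta k n := pow_pos (by linarith) _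
  set P := SimpleGraph.binomialRandom (Fin n) p
  set Y : SimpleGraph (Fin n) → ℝ := fun Γ => centeredCount γ p n Γ / beta k n with hY
  have hM0 : complexMGF Y P = fun z => ∫ ω, (Y ω : ℂ) ^ 0 * Complex.exp (z * Y ω) ∂P := by
    ext z
    simp [complexMGF]
  have hderiv := hasDerivAt_integral_pow_mul_cexp_of_finite P Y
  have hmom : ∀ m : ℕ, ∫ ω, (Y ω : ℂ) ^ m * Complex.exp (0 * Y ω) ∂P
      = ((∫ ω, centeredCount γ p n ω ^ m ∂P) / beta k n ^ m : ℝ) := by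
    intro m
    rw [← integral_div, ← integral_complex_ofReal]
    congr 1
    ext ω
    simp [hY, div_pow]
  have hexp := exists_cubic_expansion (R := K⁻¹) (B := (n : ℝ) ^ 2)
    (M := complexMGF Y P)
    (M₁ := fun z => ∫ ω, (Y ω : ℂ) ^ 1 * Complex.exp (z * Y ω) ∂P)
    (M₂ := fun z => ∫ ω, (Y ω : ℂ) ^ 2 * Complex.exp (z * Y ω) ∂P)
    (M₃ := fun z => ∫ ω, (Y ω : ℂ) ^ 3 * Complex.exp (z * Y ω) ∂P)
    (by rw [hM0]; exact hderiv 0) (hderiv 1) (hderiv 2) (by positivity) (by positivity) ?_ ?_ ?_ ?_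
    hw
  · obtain ⟨S, hS, hSexp⟩ := hexp
    rw [hmom 2, hmom 3] at hSexp
    have e2 := hC₂ n hn
    have e3 := hC₃ n hn
    set m₂ := ∫ ω, centeredCount γ p n ω ^ 2 ∂P
    set m₃ := ∫ ω, centeredCount γ p n ω ^ 3 ∂P
    set s := sigmaSq (edgeCount γ) p
    set L := thirdCoeff (edgeCount γ) p
    have f2 : |m₂ / beta k n ^ 2 - s * n ^ 2| ≤ |C₂| * n := by
      have : m₂ / beta k n ^ 2 - s * n ^ 2
          = (m₂ - s * (n ^ 2 * beta k n ^ 2)) / beta k n ^ 2 := by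
        field_simp
      rw [this, abs_div, abs_of_pos (pow_pos hβ0 2), div_le_iff₀ (pow_pos hβ0 2)]
      calc _ ≤ C₂ * (n * beta k n ^ 2) := e2
        _ ≤ |C₂| * (n * beta k n ^ 2) := by gcongr; exact le_abs_self _
        _ = _ := by ring
    have f3 : |m₃ / beta k n ^ 3 - L * n ^ 2| ≤ |C₃| * n := by
      have : m₃ / beta k n ^ 3 - L * n ^ 2
          = (m₃ - L * (n ^ 2 * beta k n ^ 3)) / beta k n ^ 3 := by
        field_simp
      rw [this, abs_div, abs_of_pos (pow_pos hβ0 3), div_le_iff₀ (pow_pos hβ0 3)]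
      calc _ ≤ C₃ * (n * beta k n ^ 3) := e3
        _ ≤ |C₃| * (n * beta k n ^ 3) := by gcongr; exact le_abs_self _
        _ = _ := by ring
    refine ⟨((m₂ / beta k n ^ 2 - s * n ^ 2 : ℝ) : ℂ) / 2 * w ^ 2
      + ((m₃ / beta k n ^ 3 - L * n ^ 2 : ℝ) : ℂ) / 6 * w ^ 3 + S, ?_, ?_⟩
    · have hw1 : ‖w‖ ≤ 1 := by
        have : K⁻¹ ≤ 1 := inv_le_one_of_one_le₀ hK1
        linarith
      have g2 : ‖((m₂ / beta k n ^ 2 - s * n ^ 2 : ℝ) : ℂ) / 2 * w ^ 2‖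
          ≤ |C₂| * (n * ‖w‖ ^ 2) := by
        rw [norm_mul, norm_div, Complex.norm_real, norm_pow, Real.norm_eq_abs, Complex.norm_two]
        calc _ ≤ |C₂| * n / 1 * ‖w‖ ^ 2 := by gcongr; norm_num
          _ = _ := by ring
      have g3 : ‖((m₃ / beta k n ^ 3 - L * n ^ 2 : ℝ) : ℂ) / 6 * w ^ 3‖
          ≤ |C₃| * (n * ‖w‖ ^ 2) := by
        rw [norm_mul, norm_div, Complex.norm_real, norm_pow, Real.norm_eq_abs, Complex.norm_ofNat]
        calc _ ≤ |C₃| * n / 1 * ‖w‖ ^ 2 := by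
              gcongr ?_ / ?_ * ?_
              · norm_num
              · exact pow_le_pow_of_le_one (norm_nonneg _) hw1 (by norm_num)
          _ = _ := by ring
      have g4 : ‖S‖ ≤ 64 * K ^ 4 * (n ^ 2 * ‖w‖ ^ 4) := by
        refine hS.trans_eq ?_
        rw [inv_pow]
        field_simp
      have hnw : 0 ≤ (n : ℝ) * ‖w‖ ^ 2 := by positivity
      have hnw' : 0 ≤ (n : ℝ) ^ 2 * ‖w‖ ^ 4 := by positivity
      refine (norm_add₃_le).trans ((add_le_add (add_le_add g2 g3) g4).trans ?_)
      have t1 : 0 ≤ (|C₂| + |C₃|) * ((n : ℝ) ^ 2 * ‖w‖ ^ 4) := by positivity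
      have t2 : 0 ≤ 64 * K ^ 4 * ((n : ℝ) * ‖w‖ ^ 2) := by positivity
      linarith
    · rw [hSexp]
      congr 1
      push_cast
      ring
  · intro z hz
    rw [Metric.mem_ball, dist_zero_right] at hz
    refine complexMGF_centeredCount_ne_zero γ hγ p (by omega) ?_
    rw [← hK]
    calc _ ≤ K⁻¹ * K := by gcongr
      _ = 1 := inv_mul_cancel₀ (by positivity)
  · intro z hz
    rw [Metric.mem_ball, dist_zero_right] at hz
    have hz1 : ‖z‖ ≤ 1 := hz.le.trans (inv_le_one_of_one_le₀ hK1)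
    refine (norm_integral_le_of_norm_le_const (C := Real.exp ((n : ℝ) ^ 2))
      (ae_of_all _ fun ω => ?_)).trans_eq (by simp)
    rw [Complex.norm_exp, Real.exp_le_exp]
    have hYb := abs_centeredCount_div_le γ p hk (by omega : 1 ≤ n) ω
    calc (z * (Y ω : ℂ)).re ≤ ‖z * (Y ω : ℂ)‖ := Complex.re_le_norm _
      _ = ‖z‖ * |Y ω| := by rw [norm_mul, Complex.norm_real, Real.norm_eq_abs]
      _ ≤ 1 * n ^ 2 := by gcongr
      _ = _ := one_mul _
  · simp [complexMGF]
  · have := hmom 1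
    simp only [pow_one] at this
    simp only [pow_one, this, integral_centeredCount, P]
    simp

end CubicExpansion


/-! ### Mod-Gaussian convergence from the cubic expansion -/

section ModGaussian

lemma strip_top : strip ⊤ = Set.univ :=
  Set.eq_univ_of_forall fun _ => EReal.coe_lt_top _

/-- The m-th convolution root is the Gaussian of variance 1/m, recognized by characteristic
functions. -/
lemma infinitelyDivisible_gaussianReal : InfinitelyDivisible (gaussianReal 0 1) := by
  refine ⟨inferInstance, fun m hm => ⟨gaussianReal 0 (1 / m), inferInstance, ?_⟩⟩
  have hm0 : (m : ℂ) ≠ 0 := by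
    have : m ≠ 0 := by omega
    exact_mod_cast this
  have hmeas : Measurable fun x : Fin m → ℝ => ∑ i, x i := by fun_prop
  have : IsProbabilityMeasure ((Measure.pi fun _ : Fin m => gaussianReal 0 (1 / m)).map
      fun x => ∑ i, x i) := Measure.isProbabilityMeasure_map hmeas.aemeasurable
  refine Measure.ext_of_charFun (funext fun t => ?_)
  rw [charFun_apply_real, integral_map hmeas.aemeasurable (by fun_prop)]
  have h1 : ∀ x : Fin m → ℝ, Complex.exp (t * ((∑ i, x i : ℝ) : ℂ) * Complex.I)
      = ∏ i, Complex.exp (t * (x i : ℂ) * Complex.I) := by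
    intro x
    rw [← Complex.exp_sum]
    push_cast
    rw [Finset.mul_sum, Finset.sum_mul]
  simp_rw [h1]
  rw [integral_fintype_prod_eq_prod (fun _ : Fin m => fun y : ℝ =>
    Complex.exp (t * (y : ℂ) * Complex.I))]
  simp_rw [← charFun_apply_real, charFun_gaussianReal]
  rw [Finset.prod_const, ← Complex.exp_nat_mul]
  congr 1
  simp only [Finset.card_univ, Fintype.card_fin]
  push_cast
  field_simp
  ring

lemma gaussianReal_ne_dirac (a : ℝ) : gaussianReal 0 1 ≠ Measure.dirac a := by
  intro h
  have : NullSingletonClass (gaussianReal 0 1) := nullSingletonClass_gaussianReal one_ne_zero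
  have h1 : gaussianReal 0 1 {a} = 0 := measure_singleton a
  rw [h] at h1
  simp at h1

lemma complexMGF_div_const {Ω : Type*} [MeasurableSpace Ω] (P : Measure Ω) (Y : Ω → ℝ) (a : ℝ)
    (z : ℂ) : complexMGF (fun ω => Y ω / a) P z = complexMGF Y P (z / a) := by
  unfold complexMGF
  congr 1
  ext ω
  congr 1
  push_cast
  ring

theorem CubicExpansion.tendstoLocallyUniformlyOn {Ω : ℕ → Type*} [∀ n, MeasurableSpace (Ω n)]
    {P : ∀ n, Measure (Ω n)} {Y : ∀ n, Ω n → ℝ} {s L : ℝ} (hY : CubicExpansion P Y s L) :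
    TendstoLocallyUniformlyOn (fun n z => Complex.exp
        (-((s * alpha n ^ (1 / 3 : ℝ) : ℝ) : ℂ) * (z ^ 2 / 2))
        * complexMGF (fun ω => Y n ω / alpha n ^ (1 / 3 : ℝ)) (P n) z)
      (fun z => Complex.exp ((L : ℂ) / 6 * z ^ 3)) atTop Set.univ := by
  obtain ⟨c, C, hc, hC, hexp⟩ := hY
  rw [tendstoLocallyUniformlyOn_iff_forall_isCompact isOpen_univ]
  intro K _ hK
  obtain ⟨B, hB0, hB⟩ := hK.isBounded.exists_pos_norm_le
  rw [Metric.tendstoUniformlyOn_iff]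
  intro ε hε
  set a : ℕ → ℝ := fun n => alpha n ^ (1 / 3 : ℝ) with ha
  have ha_top : Tendsto a atTop atTop := by
    have h1 : Tendsto (fun n : ℕ => alpha n) atTop atTop :=
      (tendsto_pow_atTop two_ne_zero).comp tendsto_natCast_atTop_atTop
    exact (tendsto_rpow_atTop (by norm_num)).comp h1
  have ha3 : ∀ n, a n ^ 3 = (n : ℝ) ^ 2 := by
    intro n
    simp only [ha, alpha]
    rw [← Real.rpow_natCast, ← Real.rpow_mul (by positivity)]
    norm_num
  -- From a³ = n² one gets n/a² = a^{−1/2}. Likewise n²/a⁴ = 1/a, so both error terms of the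
  -- expansion vanish on compacts.
  have hlim1 : Tendsto (fun n : ℕ => (n : ℝ) / a n ^ 2) atTop (𝓝 0) := by
    have h1 : Tendsto (fun n : ℕ => Real.sqrt ((a n)⁻¹)) atTop (𝓝 0) := by
      exact (Real.continuous_sqrt.tendsto' 0 0 Real.sqrt_zero).comp
        (tendsto_inv_atTop_zero.comp ha_top)
    refine h1.congr' ?_
    filter_upwards [ha_top.eventually_gt_atTop 0] with n hn
    rw [Real.sqrt_eq_iff_eq_sq (by positivity) (by positivity), div_pow, ← ha3]
    field_simp
  have hlim : Tendsto (fun n : ℕ => C * ((n : ℝ) / a n ^ 2 * B ^ 2 + (a n)⁻¹ * B ^ 4)) atTop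
      (𝓝 0) := by
    have := ((hlim1.mul_const (B ^ 2)).add
      ((tendsto_inv_atTop_zero.comp ha_top).mul_const (B ^ 4))).const_mul C
    simpa using this
  set E := Real.exp (|L| / 6 * B ^ 3) with hE
  have hE0 : 0 < E := Real.exp_pos _
  filter_upwards [hexp, ha_top.eventually_ge_atTop (B / c), ha_top.eventually_gt_atTop 0,
    hlim.eventually_lt_const (u := min 1 (ε / (2 * E))) (by positivity)]
    with n hn hnB hn0 hnlim z hz
  have hzB := hB z hz
  have hnorm : ‖z / (a n : ℂ)‖ = ‖z‖ / a n := by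
    rw [norm_div, Complex.norm_real, Real.norm_of_nonneg hn0.le]
  have hzc : ‖z / (a n : ℂ)‖ ≤ c := by
    rw [hnorm, div_le_iff₀ hn0]
    rw [div_le_iff₀ hc] at hnB
    linarith
  obtain ⟨S, hS, hSexp⟩ := hn _ hzc
  have hSle : ‖S‖ ≤ C * ((n : ℝ) / a n ^ 2 * B ^ 2 + (a n)⁻¹ * B ^ 4) := by
    refine hS.trans ?_
    rw [hnorm]
    have e1 : (n : ℝ) * (‖z‖ / a n) ^ 2 ≤ (n : ℝ) / a n ^ 2 * B ^ 2 := by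
      rw [div_pow, mul_div_assoc', div_mul_eq_mul_div]
      gcongr
    have e2 : (n : ℝ) ^ 2 * (‖z‖ / a n) ^ 4 ≤ (a n)⁻¹ * B ^ 4 := by
      rw [← ha3]
      calc _ = (a n)⁻¹ * ‖z‖ ^ 4 := by field_simp
        _ ≤ _ := by gcongr
    gcongr
  have hS1 := hSle.trans_lt hnlim
  have hkey : Complex.exp (-((s * alpha n ^ (1 / 3 : ℝ) : ℝ) : ℂ) * (z ^ 2 / 2))
        * complexMGF (fun ω => Y n ω / alpha n ^ (1 / 3 : ℝ)) (P n) z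
      = Complex.exp ((L : ℂ) / 6 * z ^ 3) * Complex.exp S := by
    change Complex.exp (-((s * a n : ℝ) : ℂ) * (z ^ 2 / 2))
        * complexMGF (fun ω => Y n ω / a n) (P n) z = _
    rw [complexMGF_div_const, hSexp, ← Complex.exp_add, ← Complex.exp_add]
    congr 1
    have h3 : ((n : ℂ)) ^ 2 = (a n : ℂ) ^ 3 := by
      have := ha3 n
      exact_mod_cast this.symm
    have hne : (a n : ℂ) ≠ 0 := by exact_mod_cast hn0.ne'
    rw [h3]
    push_cast
    field_simp
    ring
  rw [hkey, dist_eq_norm]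
  have hfac : Complex.exp ((L : ℂ) / 6 * z ^ 3) - Complex.exp ((L : ℂ) / 6 * z ^ 3) * Complex.exp S
      = -(Complex.exp ((L : ℂ) / 6 * z ^ 3) * (Complex.exp S - 1)) := by ring
  rw [hfac, norm_neg, norm_mul]
  have hEle : ‖Complex.exp ((L : ℂ) / 6 * z ^ 3)‖ ≤ E := by
    refine (Complex.norm_exp_le_exp_norm _).trans (Real.exp_le_exp.2 ?_)
    rw [norm_mul, norm_div, Complex.norm_real, norm_pow, Real.norm_eq_abs, Complex.norm_ofNat]
    gcongr
  have hS2 : ‖Complex.exp S - 1‖ ≤ 2 * ‖S‖ :=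
    Complex.norm_exp_sub_one_le (hS1.le.trans (min_le_left _ _))
  have hS3 : ‖S‖ < ε / (2 * E) := hS1.trans_le (min_le_right _ _)
  calc _ ≤ E * (2 * ‖S‖) := by gcongr
    _ < E * (2 * (ε / (2 * E))) := by gcongr
    _ = ε := by field_simp

theorem CubicExpansion.convergesModGaussian {Ω : ℕ → Type*} [∀ n, MeasurableSpace (Ω n)]
    {P : ∀ n, Measure (Ω n)} [hP : ∀ n, IsProbabilityMeasure (P n)] {Y : ∀ n, Ω n → ℝ} {s L : ℝ}
    (hs : 0 < s) (hY : CubicExpansion P Y s L) (hm : ∀ n, AEMeasurable (Y n) (P n))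
    (hint : ∀ n, ∀ z : ℂ, Integrable (fun ω => Complex.exp (z * Y n ω)) (P n)) :
    ConvergesModGaussian ⊤ P (fun n ω => Y n ω / alpha n ^ (1 / 3 : ℝ))
      (fun n => s * alpha n ^ (1 / 3 : ℝ)) (fun z => Complex.exp ((L : ℂ) / 6 * z ^ 3)) where
  c_pos := EReal.zero_lt_top
  isProbabilityMeasure := hP
  aemeasurable n := (hm n).div_const _
  integrable n z _ := by
    convert hint n (z / (alpha n ^ (1 / 3 : ℝ) : ℝ)) using 3
    push_cast
    ring
  infinitelyDivisible := infinitelyDivisible_gaussianReal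
  nonconstant := gaussianReal_ne_dirac
  integrable_limit z _ := by
    rw [← integrable_norm_iff (by fun_prop)]
    refine (integrable_exp_mul_gaussianReal z.re).congr (ae_of_all _ fun x => ?_)
    simp [Complex.norm_exp]
  exponent_analytic := by
    refine DifferentiableOn.analyticOnNhd ?_ (by rw [strip_top]; exact isOpen_univ)
    fun_prop
  exponent_zero := by simp
  mgf_limit z _ := by
    rw [complexMGF_id_gaussianReal]
    simp
  psi_analytic := by
    refine DifferentiableOn.analyticOnNhd ?_ (by rw [strip_top]; exact isOpen_univ)
    fun_prop
  psi_ne_zero x _ := Complex.exp_ne_zero _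
  parameters := by
    have h1 : Tendsto (fun n : ℕ => alpha n) atTop atTop :=
      (tendsto_pow_atTop two_ne_zero).comp tendsto_natCast_atTop_atTop
    exact ((tendsto_rpow_atTop (by norm_num)).comp h1).const_mul_atTop hs
  tendsto := by
    rw [strip_top]
    exact hY.tendstoLocallyUniformlyOn

end ModGaussian


/-! ### The Laplace distribution and the Cauchy kernel -/

section Laplace

lemma cexp_eqOn_Iic (t : ℝ) : Set.EqOn
    (fun x : ℝ => (Real.exp (-|x|) : ℂ) * Complex.exp (t * x * Complex.I))
    (fun x : ℝ => Complex.exp ((1 + t * Complex.I) * x)) (Set.Iic 0) := by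
  intro x hx
  simp only
  rw [abs_of_nonpos hx, Complex.ofReal_exp, ← Complex.exp_add]
  congr 1
  push_cast
  ring

lemma cexp_eqOn_Ioi (t : ℝ) : Set.EqOn
    (fun x : ℝ => (Real.exp (-|x|) : ℂ) * Complex.exp (t * x * Complex.I))
    (fun x : ℝ => Complex.exp ((-1 + t * Complex.I) * x)) (Set.Ioi 0) := by
  intro x hx
  simp only
  rw [abs_of_pos hx, Complex.ofReal_exp, ← Complex.exp_add]
  congr 1
  push_cast
  ring

lemma integrable_exp_neg_abs_mul_cexp (t : ℝ) :
    Integrable (fun x : ℝ => (Real.exp (-|x|) : ℂ) * Complex.exp (t * x * Complex.I)) := by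
  rw [← integrableOn_univ, ← Set.Iic_union_Ioi (a := (0 : ℝ))]
  refine IntegrableOn.union ?_ ?_
  · rw [integrableOn_congr_fun (cexp_eqOn_Iic t) measurableSet_Iic]
    exact integrableOn_exp_mul_complex_Iic (by simp) 0
  · rw [integrableOn_congr_fun (cexp_eqOn_Ioi t) measurableSet_Ioi]
    exact integrableOn_exp_mul_complex_Ioi (by simp) 0

lemma integrable_exp_neg_abs : Integrable (fun x : ℝ => Real.exp (-|x|)) := by
  have := (integrable_exp_neg_abs_mul_cexp 0).norm
  refine this.congr (ae_of_all _ fun x => ?_)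
  simp [Complex.norm_exp]

lemma integral_exp_neg_abs_mul_cexp (t : ℝ) :
    ∫ x : ℝ, (Real.exp (-|x|) : ℂ) * Complex.exp (t * x * Complex.I)
      = 2 * ((1 + t ^ 2)⁻¹ : ℝ) := by
  have hi := integrable_exp_neg_abs_mul_cexp t
  rw [← setIntegral_univ, ← Set.Iic_union_Ioi (a := (0 : ℝ)),
    setIntegral_union (Set.Iic_disjoint_Ioi le_rfl) measurableSet_Ioi hi.integrableOn
      hi.integrableOn, setIntegral_congr_fun measurableSet_Iic (cexp_eqOn_Iic t),
    setIntegral_congr_fun measurableSet_Ioi (cexp_eqOn_Ioi t),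
    integral_exp_mul_complex_Iic (by simp), integral_exp_mul_complex_Ioi (by simp)]
  have h1 : (1 + t * Complex.I : ℂ) ≠ 0 := fun h => by
    have := congrArg Complex.re h
    simp at this
  have h2 : (-1 + t * Complex.I : ℂ) ≠ 0 := fun h => by
    have := congrArg Complex.re h
    simp at this
  have h3 : (1 + (t : ℂ) ^ 2) = -((1 + t * Complex.I) * (-1 + t * Complex.I)) := by
    linear_combination ((t : ℂ) ^ 2) * Complex.I_sq
  push_cast
  rw [h3]
  simp only [mul_zero, Complex.exp_zero]
  field_simp
  ring

lemma integral_exp_neg_abs : ∫ x : ℝ, Real.exp (-|x|) = 2 := by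
  have := integral_exp_neg_abs_mul_cexp 0
  simp only [Complex.ofReal_zero, zero_mul, Complex.exp_zero, mul_one] at this
  rw [integral_complex_ofReal] at this
  have h2 : ((∫ x : ℝ, Real.exp (-|x|) : ℝ) : ℂ) = ((2 : ℝ) : ℂ) := by
    rw [this]
    simp
  exact_mod_cast h2

/-- Fourier inversion for the Cauchy density. -/
lemma integral_cauchy_mul_cexp (u : ℝ) :
    ∫ y : ℝ, ((1 + y ^ 2)⁻¹ : ℝ) * Complex.exp (y * u * Complex.I)
      = Real.pi * (Real.exp (-|u|) : ℂ) := by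
  set f : ℝ → ℂ := fun x => (Real.exp (-|x|) : ℂ) with hf
  have hfi : Integrable f := by
    have := integrable_exp_neg_abs.ofReal (𝕜 := ℂ)
    exact this
  have hfc : Continuous f := by fun_prop
  have hF : FourierTransform.fourier f
      = fun ξ : ℝ => 2 * (((1 + (2 * Real.pi * ξ) ^ 2)⁻¹ : ℝ) : ℂ) := by
    ext ξ
    rw [Real.fourier_real_eq_integral_exp_smul]
    have h := integral_exp_neg_abs_mul_cexp (-(2 * Real.pi * ξ))
    rw [neg_sq] at h
    rw [← h]
    congr 1
    ext x
    rw [smul_eq_mul, mul_comm]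
    congr 2
    push_cast
    ring
  have hFi : Integrable (FourierTransform.fourier f) := by
    rw [hF]
    refine Integrable.const_mul ?_ _
    exact (integrable_inv_one_add_sq.comp_mul_left' (R := 2 * Real.pi) (by positivity)).ofReal
  have hinv := congrFun (hfc.fourierInv_fourier_eq hfi hFi) u
  rw [Real.fourierInv_eq', hF] at hinv
  set g : ℝ → ℂ := fun y => ((1 + y ^ 2)⁻¹ : ℝ) * Complex.exp (y * u * Complex.I) with hg
  -- Rescaling by 2π passes from the normalization of `FourierTransform` to the kernel e^{iyu}.
  have hcomp := Measure.integral_comp_mul_left g (2 * Real.pi)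
  have h2 : ∫ ξ : ℝ, g (2 * Real.pi * ξ) = f u / 2 := by
    rw [← hinv, ← integral_div]
    congr 1
    ext ξ
    simp only [hg, smul_eq_mul]
    have : (inner ℝ ξ u : ℝ) = u * ξ := rfl
    rw [this]
    push_cast
    have e : (2 * Real.pi * ξ * u * Complex.I : ℂ) = 2 * Real.pi * (u * ξ) * Complex.I := by ring
    rw [e]
    ring
  rw [h2, abs_of_pos (by positivity)] at hcomp
  rw [Complex.real_smul] at hcomp
  have hpi : (Real.pi : ℂ) ≠ 0 := by exact_mod_cast Real.pi_ne_zero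
  push_cast at hcomp
  field_simp at hcomp
  rw [← hcomp, hf]
  ring

/-- The Laplace distribution. -/
def laplaceMeasure : Measure ℝ := (volume : Measure ℝ).tilted (fun x => -|x|)

instance : IsProbabilityMeasure laplaceMeasure :=
  isProbabilityMeasure_tilted integrable_exp_neg_abs

lemma charFun_laplaceMeasure (t : ℝ) : charFun laplaceMeasure t = ((1 + t ^ 2)⁻¹ : ℝ) := by
  rw [charFun_apply_real, laplaceMeasure, integral_tilted, integral_exp_neg_abs]
  have h : ∀ x : ℝ, (Real.exp (-|x|) / 2) • Complex.exp (t * x * Complex.I)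
      = (Real.exp (-|x|) : ℂ) * Complex.exp (t * x * Complex.I) / 2 := by
    intro x
    rw [Complex.real_smul]
    push_cast
    ring
  simp_rw [h]
  rw [integral_div, integral_exp_neg_abs_mul_cexp]
  ring

lemma laplaceMeasure_apply (s : Set ℝ) (hs : MeasurableSet s) :
    laplaceMeasure s = ENNReal.ofReal (∫ x in s, Real.exp (-|x|) / 2) := by
  rw [laplaceMeasure, tilted_apply_eq_ofReal_integral' _ hs, integral_exp_neg_abs]

lemma laplaceMeasure_frontier_Ici : laplaceMeasure (frontier (Set.Ici 0)) = 0 := by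
  rw [frontier_Ici, laplaceMeasure_apply _ (measurableSet_singleton 0)]
  simp

lemma laplaceMeasure_Ici : laplaceMeasure (Set.Ici 0) = ENNReal.ofReal (1 / 2) := by
  rw [laplaceMeasure_apply _ measurableSet_Ici, integral_Ici_eq_integral_Ioi]
  congr 1
  rw [setIntegral_congr_fun (g := fun x => Real.exp (-x) / 2) measurableSet_Ioi
    fun x hx => by simp only [abs_of_pos (Set.mem_Ioi.1 hx)], integral_div, integral_exp_neg_Ioi]
  simp

end Laplace

/-! ### Gaussian integrals against a widening Cauchy kernel -/

section Limit

lemma norm_cauchy_mul_le {c : ℝ} (z : ℂ) (hz : ‖z‖ ≤ 1) (hc : 0 ≤ c) : ‖(c : ℂ) * z‖ ≤ c := by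
  rw [norm_mul, Complex.norm_real, Real.norm_of_nonneg hc]
  exact mul_le_of_le_one_right hc hz

/-- For |η| > R ≥ 2|λ|s the shift takes away at most half of |η|/s. The right-hand side is written
as a Cauchy kernel of width R so that its integral is explicit. -/
lemma cauchy_tail_le {s R lam η : ℝ} (hs : 0 < s) (hR : 0 < R) (hlam : 2 * |lam| * s ≤ R)
    (hη : R < |η|) : (1 + (η / s - lam) ^ 2)⁻¹ ≤ 8 * s ^ 2 / R ^ 2 * (1 + (R⁻¹ * η) ^ 2)⁻¹ := by
  have h1 : |η| / (2 * s) ≤ |η / s - lam| := by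
    have e1 : |η / s| = |η| / s := by rw [abs_div, abs_of_pos hs]
    have e2 := abs_sub_abs_le_abs_sub (η / s) lam
    have e3 : |lam| ≤ |η| / (2 * s) := by
      rw [le_div_iff₀ (by positivity)]
      linarith
    have e4 : |η| / s = |η| / (2 * s) + |η| / (2 * s) := by field_simp; ring
    linarith
  have hη0 : 0 < |η| := hR.trans hη
  have h2 : |η| ^ 2 / (4 * s ^ 2) ≤ (η / s - lam) ^ 2 := by
    rw [← sq_abs (η / s - lam)]
    calc |η| ^ 2 / (4 * s ^ 2) = (|η| / (2 * s)) ^ 2 := by rw [div_pow]; ring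
      _ ≤ _ := by gcongr
  have h3 : 1 + (R⁻¹ * η) ^ 2 ≤ 2 * |η| ^ 2 / R ^ 2 := by
    have : R ^ 2 ≤ |η| ^ 2 := by gcongr
    rw [le_div_iff₀ (by positivity), sq_abs]
    rw [sq_abs] at this
    field_simp
    linarith
  calc (1 + (η / s - lam) ^ 2)⁻¹ ≤ (|η| ^ 2 / (4 * s ^ 2))⁻¹ := by
        gcongr
        linarith
    _ = 8 * s ^ 2 / R ^ 2 * (2 * |η| ^ 2 / R ^ 2)⁻¹ := by field_simp; ring
    _ ≤ _ := by gcongr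

/-- On |η| ≤ R dominated convergence applies and the kernel tends to its value 1/(1 + λ²). Beyond R
only |Φ| ≤ 1 is known, and the kernel tail contributes O(s²/R). -/
theorem tendsto_integral_cauchy_mul {Φ : ℕ → ℝ → ℂ} {s R : ℕ → ℝ} {K : ℝ} (hK : 0 ≤ K)
    (hΦc : ∀ n, Continuous (Φ n)) (hΦ1 : ∀ n η, ‖Φ n η‖ ≤ 1)
    (hs : Tendsto s atTop atTop) (hR : Tendsto R atTop atTop)
    (hsR : Tendsto (fun n => s n ^ 2 / R n) atTop (𝓝 0))
    (hΦ : ∀ η, Tendsto (fun n => Φ n η) atTop (𝓝 (Real.exp (-η ^ 2 / 2) : ℂ)))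
    (hdom : ∀ᶠ n in atTop, ∀ η, |η| ≤ R n → ‖Φ n η‖ ≤ K * Real.exp (-(1 / 4) * η ^ 2))
    (lam : ℝ) :
    Tendsto (fun n => ∫ η : ℝ, ((1 + (η / s n - lam) ^ 2)⁻¹ : ℝ) * Φ n η) atTop
      (𝓝 (((1 + lam ^ 2)⁻¹ * Real.sqrt (2 * Real.pi) : ℝ) : ℂ)) := by
  set κ : ℕ → ℝ → ℝ := fun n η => (1 + (η / s n - lam) ^ 2)⁻¹ with hκ
  have hκ0 : ∀ n η, 0 ≤ κ n η := fun n η => by positivity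
  have hκ1 : ∀ n η, κ n η ≤ 1 := fun n η =>
    inv_le_one_of_one_le₀ (le_add_of_nonneg_right (sq_nonneg _))
  have hκc : ∀ n, Continuous (κ n) := fun n => by
    refine Continuous.inv₀ (by fun_prop) fun η => ?_
    positivity
  have hFc : ∀ n, Continuous fun η => (κ n η : ℂ) * Φ n η := fun n =>
    (Complex.continuous_ofReal.comp (hκc n)).mul (hΦc n)
  have hmeasS : ∀ n, MeasurableSet {η : ℝ | |η| ≤ R n} := fun n =>
    measurableSet_le (by fun_prop) measurable_const
  set G : ℕ → ℝ → ℂ := fun n => {η : ℝ | |η| ≤ R n}.indicator fun η => (κ n η : ℂ) * Φ n η with hG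
  set H : ℕ → ℝ → ℂ := fun n => {η : ℝ | |η| ≤ R n}ᶜ.indicator fun η => (κ n η : ℂ) * Φ n η with hH
  have hlimG : Tendsto (fun n => ∫ η, G n η) atTop
      (𝓝 (∫ η : ℝ, (((1 + lam ^ 2)⁻¹ * Real.exp (-(1 / 2) * η ^ 2) : ℝ) : ℂ))) := by
    refine tendsto_integral_filter_of_dominated_convergence
      (fun η => K * Real.exp (-(1 / 4) * η ^ 2)) ?_ ?_ ?_ ?_
    · exact Eventually.of_forall fun n =>
        ((hFc n).aestronglyMeasurable).indicator (hmeasS n)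
    · filter_upwards [hdom] with n hn
      refine ae_of_all _ fun η => ?_
      by_cases hη : |η| ≤ R n
      · simp only [hG]
        rw [Set.indicator_of_mem (by exact hη), norm_mul, Complex.norm_real,
          Real.norm_of_nonneg (hκ0 n η)]
        calc _ ≤ 1 * ‖Φ n η‖ := by gcongr; exact hκ1 n η
          _ ≤ _ := by rw [one_mul]; exact hn η hη
      · simp only [hG]
        rw [Set.indicator_of_notMem (by exact hη), norm_zero]
        positivity
    · exact (integrable_exp_neg_mul_sq (by norm_num)).const_mul K
    · refine ae_of_all _ fun η => ?_
      have h1 : Tendsto (fun n => κ n η) atTop (𝓝 (1 + lam ^ 2)⁻¹) := by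
        have : Tendsto (fun n => (1 + (η / s n - lam) ^ 2)⁻¹) atTop
            (𝓝 (1 + (0 - lam) ^ 2)⁻¹) := by
          refine Tendsto.inv₀ ?_ (by positivity)
          exact (((hs.const_div_atTop η).sub_const lam).pow 2).const_add 1
        simpa using this
      have h2 : Tendsto (fun n => (κ n η : ℂ) * Φ n η) atTop
          (𝓝 ((((1 + lam ^ 2)⁻¹ : ℝ) : ℂ) * (Real.exp (-η ^ 2 / 2) : ℂ))) :=
        ((Complex.continuous_ofReal.tendsto _).comp h1).mul (hΦ η)
      have h3 : (((1 + lam ^ 2)⁻¹ * Real.exp (-(1 / 2) * η ^ 2) : ℝ) : ℂ)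
          = (((1 + lam ^ 2)⁻¹ : ℝ) : ℂ) * (Real.exp (-η ^ 2 / 2) : ℂ) := by
        rw [← Complex.ofReal_mul]
        congr 3
        ring
      rw [h3]
      refine h2.congr' ?_
      filter_upwards [hR.eventually_ge_atTop |η|] with n hn
      simp only [hG]
      rw [Set.indicator_of_mem (by exact hn)]
  have htail : ∀ᶠ n in atTop, ‖∫ η, H n η‖ ≤ 8 * Real.pi * (s n ^ 2 / R n) := by
    have hRs : ∀ᶠ n in atTop, 2 * |lam| * s n ≤ R n := by
      filter_upwards [hsR.eventually_le_const (u := 1) (by norm_num),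
        hs.eventually_ge_atTop (2 * |lam|), hR.eventually_gt_atTop 0,
        hs.eventually_gt_atTop 0] with n h1 h2 h3 h4
      rw [div_le_one h3] at h1
      nlinarith
    filter_upwards [hRs, hs.eventually_gt_atTop 0, hR.eventually_gt_atTop 0] with n h1 h2 h3
    have hb : Integrable (fun η : ℝ => 8 * s n ^ 2 / R n ^ 2 * (1 + ((R n)⁻¹ * η) ^ 2)⁻¹) :=
      (integrable_inv_one_add_sq.comp_mul_left' (R := (R n)⁻¹) (by positivity)).const_mul _
    have hle : ‖∫ η, H n η‖ ≤ ∫ η : ℝ, 8 * s n ^ 2 / R n ^ 2 * (1 + ((R n)⁻¹ * η) ^ 2)⁻¹ := by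
      refine norm_integral_le_of_norm_le hb (ae_of_all _ fun η => ?_)
      by_cases hη : |η| ≤ R n
      · simp only [hH]
        rw [Set.indicator_of_notMem (by simpa using hη), norm_zero]
        positivity
      · simp only [hH]
        rw [Set.indicator_of_mem (by simpa using hη)]
        exact (norm_cauchy_mul_le _ (hΦ1 n η) (hκ0 n η)).trans
          (cauchy_tail_le h2 h3 h1 (not_le.1 hη))
    refine hle.trans_eq ?_
    rw [integral_const_mul, Measure.integral_comp_mul_left (fun x : ℝ => (1 + x ^ 2)⁻¹),
      integral_univ_inv_one_add_sq, inv_inv, abs_of_pos h3, smul_eq_mul]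
    field_simp
  have hlimH : Tendsto (fun n => ∫ η, H n η) atTop (𝓝 0) := by
    refine squeeze_zero_norm' htail ?_
    simpa using hsR.const_mul (8 * Real.pi)
  have hsum : ∀ᶠ n in atTop, ∫ η, (κ n η : ℂ) * Φ n η = (∫ η, G n η) + ∫ η, H n η := by
    have : ∀ᶠ n in atTop, s n ≠ 0 := by
      filter_upwards [hs.eventually_gt_atTop 0] with n hn using hn.ne'
    filter_upwards [this] with n hn
    have hκi : Integrable (κ n) := by
      have h1 : Integrable fun x : ℝ => (1 + (x - lam) ^ 2)⁻¹ :=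
        integrable_inv_one_add_sq.comp_sub_right lam
      exact h1.comp_div hn
    have hi : Integrable fun η => (κ n η : ℂ) * Φ n η :=
      hκi.mono' (hFc n).aestronglyMeasurable
        (ae_of_all _ fun η => norm_cauchy_mul_le _ (hΦ1 n η) (hκ0 n η))
    have h1 : (∫ η, G n η) = ∫ η in {η : ℝ | |η| ≤ R n}, (κ n η : ℂ) * Φ n η :=
      integral_indicator (hmeasS n)
    have h2 : (∫ η, H n η) = ∫ η in {η : ℝ | |η| ≤ R n}ᶜ, (κ n η : ℂ) * Φ n η :=
      integral_indicator (hmeasS n).compl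
    rw [h1, h2, integral_add_compl (hmeasS n) hi]
  have hval : ∫ η : ℝ, (((1 + lam ^ 2)⁻¹ * Real.exp (-(1 / 2) * η ^ 2) : ℝ) : ℂ)
      = (((1 + lam ^ 2)⁻¹ * Real.sqrt (2 * Real.pi) : ℝ) : ℂ) := by
    rw [integral_complex_ofReal, integral_const_mul, integral_gaussian]
    congr 4
    ring
  have := hlimG.add hlimH
  rw [add_zero, hval] at this
  exact this.congr' (hsum.mono fun n hn => hn.symm)

end Limit


/-! ### Fourier inversion under an exponential tilt -/

section Inversion

lemma integral_shifted_cauchy_mul_cexp {s : ℝ} (hs : 0 < s) (lam u : ℝ) :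
    ∫ η : ℝ, ((1 + (η / s - lam) ^ 2)⁻¹ : ℝ) * Complex.exp ((η / s * u : ℝ) * Complex.I)
      = Real.pi * s * (Real.exp (-|u|) * Complex.exp ((lam * u : ℝ) * Complex.I)) := by
  set g : ℝ → ℂ := fun y => ((1 + y ^ 2)⁻¹ : ℝ) * Complex.exp (y * u * Complex.I) with hg
  have h1 : ∫ η : ℝ, g (η / s - lam) = s * ∫ y : ℝ, g y := by
    rw [Measure.integral_comp_div (fun x => g (x - lam)) s, integral_sub_right_eq_self g lam,
      abs_of_pos hs, Complex.real_smul]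
  rw [show (∫ y : ℝ, g y) = _ from integral_cauchy_mul_cexp u] at h1
  have h2 : ∀ η : ℝ, ((1 + (η / s - lam) ^ 2)⁻¹ : ℝ) * Complex.exp ((η / s * u : ℝ) * Complex.I)
      = g (η / s - lam) * Complex.exp ((lam * u : ℝ) * Complex.I) := by
    intro η
    simp only [hg]
    rw [mul_assoc, ← Complex.exp_add]
    congr 2
    push_cast
    ring
  simp_rw [h2]
  rw [integral_mul_const, h1]
  ring

variable {Ω : Type*} [MeasurableSpace Ω] {P : Measure Ω} [IsProbabilityMeasure P] {Y : Ω → ℝ}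

lemma integrable_cexp_of_bounded (hm : Measurable Y) {B : ℝ} (hB : ∀ ω, |Y ω| ≤ B) (z : ℂ) :
    Integrable (fun ω => Complex.exp (z * Y ω)) P := by
  refine Integrable.of_bound (by fun_prop) (Real.exp (‖z‖ * B)) (ae_of_all _ fun ω => ?_)
  rw [Complex.norm_exp, Real.exp_le_exp]
  calc (z * (Y ω : ℂ)).re ≤ ‖z * (Y ω : ℂ)‖ := Complex.re_le_norm _
    _ = ‖z‖ * |Y ω| := by rw [norm_mul, Complex.norm_real, Real.norm_eq_abs]
    _ ≤ ‖z‖ * B := by gcongr; exact hB ω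

lemma integrable_exp_of_bounded (hm : Measurable Y) {B : ℝ} (hB : ∀ ω, |Y ω| ≤ B) (h : ℝ) :
    Integrable (fun ω => Real.exp (h * Y ω)) P := by
  refine (integrable_cexp_of_bounded (P := P) hm hB h).norm.congr (ae_of_all _ fun ω => ?_)
  simp [Complex.norm_exp]

lemma continuous_complexMGF_of_bounded (hm : Measurable Y) {B : ℝ} (hB : ∀ ω, |Y ω| ≤ B) :
    Continuous (complexMGF Y P) := by
  have : integrableExpSet Y P = Set.univ := Set.eq_univ_of_forall fun t =>
    integrable_exp_of_bounded hm hB t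
  have hd := differentiableOn_complexMGF (X := Y) (μ := P)
  simp only [this, interior_univ, Set.mem_univ, Set.ofPred_true] at hd
  exact (differentiableOn_univ.1 hd).continuous

/-- Fourier inversion of the Laplace transform of the two-sided exponential of a shift of `Y`,
under an exponential tilt. -/
lemma integral_tilted_laplace (hm : Measurable Y) {B : ℝ} (hB : ∀ ω, |Y ω| ≤ B) (h T lam : ℝ)
    {s : ℝ} (hs : 0 < s) :
    ∫ ω, (Real.exp (h * Y ω - |h * (Y ω - T)|) : ℂ)
        * Complex.exp ((lam * (h * (Y ω - T)) : ℝ) * Complex.I) ∂P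
      = ((Real.pi * s)⁻¹ : ℝ) * ∫ η : ℝ, ((1 + (η / s - lam) ^ 2)⁻¹ : ℝ) *
        (Complex.exp (-((η * (h / s) * T : ℝ) : ℂ) * Complex.I)
          * complexMGF Y P (h + (η * (h / s) : ℝ) * Complex.I)) := by
  set F : Ω → ℝ → ℂ := fun ω η => (Real.exp (h * Y ω) : ℂ) * (((1 + (η / s - lam) ^ 2)⁻¹ : ℝ)
    * Complex.exp ((η / s * (h * (Y ω - T)) : ℝ) * Complex.I)) with hF
  have hκi : Integrable fun η : ℝ => (1 + (η / s - lam) ^ 2)⁻¹ := by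
    have h1 : Integrable fun x : ℝ => (1 + (x - lam) ^ 2)⁻¹ :=
      integrable_inv_one_add_sq.comp_sub_right lam
    exact h1.comp_div hs.ne'
  -- Fubini is available because the Cauchy kernel is itself integrable; no integrability of the
  -- characteristic function is needed.
  have hFi : Integrable (Function.uncurry F) (P.prod volume) := by
    refine Integrable.mono' ((integrable_exp_of_bounded (P := P) hm hB h).mul_prod hκi) ?_
      (ae_of_all _ fun x => ?_)
    · have : Measurable (Function.uncurry F) := by
        simp only [hF, Function.uncurry_def]
        fun_prop
      exact this.aestronglyMeasurable
    · simp only [hF, Function.uncurry_def]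
      rw [norm_mul, Complex.norm_real, Real.norm_of_nonneg (Real.exp_pos _).le, norm_mul,
        Complex.norm_real, Real.norm_of_nonneg (by positivity), Complex.norm_exp_ofReal_mul_I,
        mul_one]
  have hswap := integral_integral_swap hFi
  have e1 : ∀ ω, ∫ η, F ω η = ((Real.pi * s : ℝ) : ℂ)
      * ((Real.exp (h * Y ω - |h * (Y ω - T)|) : ℂ)
        * Complex.exp ((lam * (h * (Y ω - T)) : ℝ) * Complex.I)) := by
    intro ω
    simp only [hF]
    have : Real.exp (h * Y ω - |h * (Y ω - T)|) = Real.exp (h * Y ω)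
        * Real.exp (-|h * (Y ω - T)|) := by rw [← Real.exp_add, sub_eq_add_neg]
    rw [integral_const_mul, integral_shifted_cauchy_mul_cexp hs, this]
    push_cast
    ring
  have e2 : ∀ η, ∫ ω, F ω η ∂P = ((1 + (η / s - lam) ^ 2)⁻¹ : ℝ) *
        (Complex.exp (-((η * (h / s) * T : ℝ) : ℂ) * Complex.I)
          * complexMGF Y P (h + (η * (h / s) : ℝ) * Complex.I)) := by
    intro η
    unfold complexMGF
    rw [← integral_const_mul, ← integral_const_mul]
    congr 1
    ext ω
    simp only [hF]
    rw [Complex.ofReal_exp, mul_left_comm, ← Complex.exp_add, ← Complex.exp_add]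
    congr 2
    push_cast
    ring
  simp_rw [e1, e2] at hswap
  rw [integral_const_mul] at hswap
  rw [← hswap, ← mul_assoc, ← Complex.ofReal_mul, inv_mul_cancel₀ (by positivity),
    Complex.ofReal_one, one_mul]

omit [IsProbabilityMeasure P] in
lemma norm_complexMGF_le_of_re {h : ℝ} (τ : ℝ) :
    ‖complexMGF Y P (h + τ * Complex.I)‖ ≤ mgf Y P h := by
  refine norm_complexMGF_le_mgf.trans_eq ?_
  simp

end Inversion

/-! ### Expansion of the tilted characteristic function -/

section TiltedExpansion

/-- The expansion of a tilted characteristic function. -/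
lemma exists_tilted_expansion {M : ℂ → ℂ} {ν h σ L C c T : ℝ} (hν : 0 < ν) (hσ : 0 < σ)
    (hC : 0 ≤ C) (hT : T = ν ^ 2 * σ ^ 2 * h)
    (hM : ∀ w : ℂ, ‖w‖ ≤ c → ∃ S : ℂ, ‖S‖ ≤ C * (ν * ‖w‖ ^ 2 + ν ^ 2 * ‖w‖ ^ 4) ∧
      M w = Complex.exp ((ν : ℂ) ^ 2 * ((σ : ℂ) ^ 2 * w ^ 2 / 2 + L * w ^ 3 / 6) + S))
    {η : ℝ} (hc : |h| + |η| / (σ * ν) ≤ c) :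
    ∃ E : ℂ, Complex.exp (-((η * (σ * ν)⁻¹ * T : ℝ) : ℂ) * Complex.I)
        * M (h + (η * (σ * ν)⁻¹ : ℝ) * Complex.I) / M h = Complex.exp (-(η ^ 2 / 2 : ℝ) + E) ∧
      ‖E‖ ≤ |L| / 6 * (3 * ((ν * h ^ 2) * |η| / σ) + 3 * (|h| * η ^ 2 / σ ^ 2)
        + |η| ^ 3 / σ ^ 3 * ν⁻¹) + C * (2 * (ν * h ^ 2) + 3 * (ν * h ^ 2) ^ 2
          + η ^ 2 / σ ^ 2 * ν⁻¹ + 2 * (η ^ 4 / σ ^ 4 * (ν⁻¹) ^ 2)) ∧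
      E.re ≤ |L| / 2 * (|h| * η ^ 2 / σ ^ 2) + C * (2 * (ν * h ^ 2) + 3 * (ν * h ^ 2) ^ 2
          + η ^ 2 / σ ^ 2 * ν⁻¹ + 2 * (η ^ 4 / σ ^ 4 * (ν⁻¹) ^ 2)) := by
  set τ : ℝ := η * (σ * ν)⁻¹ with hτ
  have hτabs : |τ| = |η| / (σ * ν) := by
    rw [hτ, abs_mul, abs_inv, abs_of_pos (by positivity : 0 < σ * ν), div_eq_mul_inv]
  set w : ℂ := h + τ * Complex.I with hw
  have hwn : ‖w‖ ≤ c := by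
    refine (norm_add_le _ _).trans ?_
    rw [norm_mul, Complex.norm_I, mul_one, Complex.norm_real, Complex.norm_real,
      Real.norm_eq_abs, Real.norm_eq_abs, hτabs]
    exact hc
  have hhn : ‖(h : ℂ)‖ ≤ c := by
    rw [Complex.norm_real, Real.norm_eq_abs]
    have : 0 ≤ |η| / (σ * ν) := by positivity
    linarith
  have hwsq : ‖w‖ ^ 2 = h ^ 2 + τ ^ 2 := by
    rw [← Complex.normSq_eq_norm_sq, hw, Complex.normSq_add_mul_I]
  have hhsq : ‖(h : ℂ)‖ ^ 2 = h ^ 2 := by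
    rw [Complex.norm_real, Real.norm_eq_abs, sq_abs]
  obtain ⟨S, hS, hSe⟩ := hM w hwn
  obtain ⟨S₀, hS₀, hS₀e⟩ := hM h hhn
  -- The cubic part of log M(h + iτ) − log M(h). In the quadratic part, −ν²σ²τ²/2 is −η²/2, and the
  -- term linear in τ cancels against e^{−iτT} by the choice of `T`.
  set D : ℂ := (L / 6 : ℝ) * (((3 * (ν ^ 2 * h ^ 2 * τ) - ν ^ 2 * τ ^ 3 : ℝ) : ℂ) * Complex.I
    - ((3 * (ν ^ 2 * h * τ ^ 2) : ℝ) : ℂ)) with hD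
  have hSS : ‖S - S₀‖ ≤ C * (2 * (ν * h ^ 2) + 3 * (ν * h ^ 2) ^ 2
          + η ^ 2 / σ ^ 2 * ν⁻¹ + 2 * (η ^ 4 / σ ^ 4 * (ν⁻¹) ^ 2)) := by
    have e1 : ν * τ ^ 2 = η ^ 2 / σ ^ 2 * ν⁻¹ := by rw [hτ]; field_simp
    have e2 : ν ^ 2 * τ ^ 4 = η ^ 4 / σ ^ 4 * (ν⁻¹) ^ 2 := by rw [hτ]; field_simp
    have e3 : ν * ‖w‖ ^ 2 + ν ^ 2 * ‖w‖ ^ 4 ≤ ν * h ^ 2 + ν * τ ^ 2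
        + 2 * (ν * h ^ 2) ^ 2 + 2 * (ν ^ 2 * τ ^ 4) := by
      have : ‖w‖ ^ 4 = (‖w‖ ^ 2) ^ 2 := by ring
      rw [this, hwsq]
      nlinarith [mul_nonneg (sq_nonneg ν) (sq_nonneg (h ^ 2 - τ ^ 2))]
    have e4 : ν * ‖(h : ℂ)‖ ^ 2 + ν ^ 2 * ‖(h : ℂ)‖ ^ 4 = ν * h ^ 2 + (ν * h ^ 2) ^ 2 := by
      have : ‖(h : ℂ)‖ ^ 4 = (‖(h : ℂ)‖ ^ 2) ^ 2 := by ring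
      rw [this, hhsq]
      ring
    rw [e4] at hS₀
    have e5 := mul_le_mul_of_nonneg_left e3 hC
    rw [e1, e2] at e5
    calc ‖S - S₀‖ ≤ ‖S‖ + ‖S₀‖ := norm_sub_le _ _
      _ ≤ _ := by linarith
  refine ⟨D + (S - S₀), ?_, ?_, ?_⟩
  · rw [hSe, hS₀e, ← Complex.exp_add, ← Complex.exp_sub]
    congr 1
    have hηe : η = τ * (σ * ν) := by rw [hτ]; field_simp
    rw [hD, hw, hT, hηe]
    have hI3 : Complex.I ^ 3 = -Complex.I := by rw [pow_succ, Complex.I_sq]; ring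
    push_cast
    ring_nf
    rw [hI3, Complex.I_sq]
    ring
  · refine (norm_add_le _ _).trans (add_le_add ?_ hSS)
    rw [hD, norm_mul, Complex.norm_real, Real.norm_eq_abs, abs_div, abs_of_pos (by norm_num :
      (0 : ℝ) < 6)]
    gcongr
    refine (norm_sub_le _ _).trans ?_
    rw [norm_mul, Complex.norm_I, mul_one, Complex.norm_real, Complex.norm_real,
      Real.norm_eq_abs, Real.norm_eq_abs]
    have e1 : |3 * (ν ^ 2 * h ^ 2 * τ)| = 3 * ((ν * h ^ 2) * |η| / σ) := by
      rw [abs_mul, abs_mul, abs_of_pos (by norm_num : (0 : ℝ) < 3),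
        abs_of_nonneg (by positivity : 0 ≤ ν ^ 2 * h ^ 2), hτabs]
      field_simp
    have e2 : |ν ^ 2 * τ ^ 3| = |η| ^ 3 / σ ^ 3 * ν⁻¹ := by
      rw [abs_mul, abs_of_nonneg (by positivity : 0 ≤ ν ^ 2), abs_pow, hτabs]
      field_simp
    have e3 : |3 * (ν ^ 2 * h * τ ^ 2)| = 3 * (|h| * η ^ 2 / σ ^ 2) := by
      rw [abs_mul, abs_mul, abs_mul, abs_of_pos (by norm_num : (0 : ℝ) < 3),
        abs_of_nonneg (by positivity : 0 ≤ ν ^ 2), abs_of_nonneg (sq_nonneg τ), hτ]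
      field_simp
    have e4 := abs_sub (3 * (ν ^ 2 * h ^ 2 * τ)) (ν ^ 2 * τ ^ 3)
    rw [e1, e2] at e4
    rw [e3]
    linarith
  · rw [Complex.add_re]
    refine add_le_add ?_ ((Complex.re_le_norm _).trans hSS)
    -- The terms in h²τ and τ³ are purely imaginary, so the modulus of the characteristic function
    -- sees only this one.
    have e1 : D.re = -(L / 2 * (h * η ^ 2 / σ ^ 2)) := by
      have : ν ^ 2 * h * τ ^ 2 = h * η ^ 2 / σ ^ 2 := by rw [hτ]; field_simp
      rw [hD, Complex.re_ofReal_mul, Complex.sub_re, Complex.re_ofReal_mul, Complex.I_re,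
        Complex.ofReal_re, this]
      ring
    rw [e1]
    refine (neg_le_abs _).trans_eq ?_
    rw [abs_mul, abs_div, abs_div, abs_mul, abs_of_nonneg (sq_nonneg η),
      abs_of_pos (by positivity : 0 < σ ^ 2), abs_of_pos (by norm_num : (0 : ℝ) < 2)]

end TiltedExpansion


/-! ### The doubly tilted law and its characteristic function -/

section Tilted

variable {Ω : Type*} [MeasurableSpace Ω]

/-- The characteristic function of `b * (Y - T)` under the measure with density proportional to
`exp (h * Y)`. -/
def tiltedCharFun (P : Measure Ω) (Y : Ω → ℝ) (h T b η : ℝ) : ℂ :=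
  Complex.exp (-((η * b * T : ℝ) : ℂ) * Complex.I)
    * complexMGF Y P (h + (η * b : ℝ) * Complex.I) / complexMGF Y P h

/-- The law of `h * (Y - T)` under the measure with density proportional to
`exp (h * Y - |h * (Y - T)|)`. -/
def doublyTiltedLaw (P : Measure Ω) (Y : Ω → ℝ) (h T : ℝ) : Measure ℝ :=
  (P.tilted fun ω => h * Y ω - |h * (Y ω - T)|).map fun ω => h * (Y ω - T)

variable {P : Measure Ω} [IsProbabilityMeasure P] {Y : Ω → ℝ}

lemma integrable_exp_doubly_tilted (hm : Measurable Y) {B : ℝ} (hB : ∀ ω, |Y ω| ≤ B) (h T : ℝ) :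
    Integrable (fun ω => Real.exp (h * Y ω - |h * (Y ω - T)|)) P := by
  refine (integrable_exp_of_bounded (P := P) hm hB h).mono'
    (by fun_prop) (ae_of_all _ fun ω => ?_)
  rw [Real.norm_of_nonneg (Real.exp_pos _).le, Real.exp_le_exp]
  linarith [abs_nonneg (h * (Y ω - T))]

lemma isProbabilityMeasure_doublyTiltedLaw (hm : Measurable Y) {B : ℝ} (hB : ∀ ω, |Y ω| ≤ B)
    (h T : ℝ) : IsProbabilityMeasure (doublyTiltedLaw P Y h T) := by
  have := isProbabilityMeasure_tilted (integrable_exp_doubly_tilted (P := P) hm hB h T)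
  exact Measure.isProbabilityMeasure_map (by fun_prop)

lemma mgf_pos_of_bounded (hm : Measurable Y) {B : ℝ} (hB : ∀ ω, |Y ω| ≤ B) (h : ℝ) :
    0 < mgf Y P h := mgf_pos (integrable_exp_of_bounded hm hB h)

lemma continuous_tiltedCharFun (hm : Measurable Y) {B : ℝ} (hB : ∀ ω, |Y ω| ≤ B) (h T b : ℝ) :
    Continuous (tiltedCharFun P Y h T b) := by
  have := continuous_complexMGF_of_bounded (P := P) hm hB
  unfold tiltedCharFun
  fun_prop

lemma norm_tiltedCharFun_le (hm : Measurable Y) {B : ℝ} (hB : ∀ ω, |Y ω| ≤ B) (h T b η : ℝ) :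
    ‖tiltedCharFun P Y h T b η‖ ≤ 1 := by
  have hpos := mgf_pos_of_bounded (P := P) hm hB h
  rw [tiltedCharFun, norm_div, norm_mul, ← Complex.ofReal_neg, Complex.norm_exp_ofReal_mul_I,
    one_mul, complexMGF_ofReal, Complex.norm_real, Real.norm_of_nonneg hpos.le,
    div_le_one hpos]
  exact norm_complexMGF_le_of_re _

lemma integral_doubly_tilted_mul_cexp (hm : Measurable Y) {B : ℝ} (hB : ∀ ω, |Y ω| ≤ B)
    (h T lam : ℝ) {s : ℝ} (hs : 0 < s) :
    ∫ ω, (Real.exp (h * Y ω - |h * (Y ω - T)|) : ℂ)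
        * Complex.exp ((lam * (h * (Y ω - T)) : ℝ) * Complex.I) ∂P
      = ((mgf Y P h / (Real.pi * s) : ℝ) : ℂ) * ∫ η : ℝ, ((1 + (η / s - lam) ^ 2)⁻¹ : ℝ) *
        tiltedCharFun P Y h T (h / s) η := by
  have hpos := mgf_pos_of_bounded (P := P) hm hB h
  have hne : (mgf Y P h : ℂ) ≠ 0 := by exact_mod_cast hpos.ne'
  have hΦ : ∀ η : ℝ, ((1 + (η / s - lam) ^ 2)⁻¹ : ℝ)
        * (Complex.exp (-((η * (h / s) * T : ℝ) : ℂ) * Complex.I)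
          * complexMGF Y P (h + (η * (h / s) : ℝ) * Complex.I))
      = (mgf Y P h : ℂ) * (((1 + (η / s - lam) ^ 2)⁻¹ : ℝ) * tiltedCharFun P Y h T (h / s) η) := by
    intro η
    rw [tiltedCharFun, complexMGF_ofReal]
    field_simp
  rw [integral_tilted_laplace hm hB h T lam hs]
  simp_rw [hΦ]
  rw [integral_const_mul]
  push_cast
  ring

lemma integral_exp_doubly_tilted (hm : Measurable Y) {B : ℝ} (hB : ∀ ω, |Y ω| ≤ B)
    (h T : ℝ) {s : ℝ} (hs : 0 < s) :
    ((∫ ω, Real.exp (h * Y ω - |h * (Y ω - T)|) ∂P : ℝ) : ℂ)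
      = ((mgf Y P h / (Real.pi * s) : ℝ) : ℂ) * ∫ η : ℝ, ((1 + (η / s - 0) ^ 2)⁻¹ : ℝ) *
        tiltedCharFun P Y h T (h / s) η := by
  rw [← integral_doubly_tilted_mul_cexp hm hB h T 0 hs, ← integral_complex_ofReal]
  simp

/-- The denominator is the normalizing constant, the same integral at λ = 0; the prefactor mgf/(πs)
cancels. -/
lemma charFun_doublyTiltedLaw (hm : Measurable Y) {B : ℝ} (hB : ∀ ω, |Y ω| ≤ B)
    (h T lam : ℝ) {s : ℝ} (hs : 0 < s) :
    charFun (doublyTiltedLaw P Y h T) lam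
      = (∫ η : ℝ, ((1 + (η / s - lam) ^ 2)⁻¹ : ℝ) * tiltedCharFun P Y h T (h / s) η)
        / ∫ η : ℝ, ((1 + (η / s - 0) ^ 2)⁻¹ : ℝ) * tiltedCharFun P Y h T (h / s) η := by
  have hpos := mgf_pos_of_bounded (P := P) hm hB h
  have hc : ((mgf Y P h / (Real.pi * s) : ℝ) : ℂ) ≠ 0 := by
    exact_mod_cast (by positivity : mgf Y P h / (Real.pi * s) ≠ 0)
  rw [← mul_div_mul_left _ _ hc, ← integral_doubly_tilted_mul_cexp hm hB h T lam hs,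
    ← integral_exp_doubly_tilted hm hB h T hs, charFun_apply_real, doublyTiltedLaw,
    integral_map (by fun_prop) (by fun_prop), integral_tilted, ← integral_div]
  congr 1
  ext ω
  rw [Complex.real_smul]
  push_cast
  ring

-- On {Y ≥ T} the exponent hY − |h(Y − T)| is the constant hT, so the tail probability can be read
-- off exactly.
omit [IsProbabilityMeasure P] in
lemma doublyTiltedLaw_Ici (hm : Measurable Y) {h : ℝ} (hh : 0 < h) (T : ℝ) :
    doublyTiltedLaw P Y h T (Set.Ici 0) = ENNReal.ofReal (Real.exp (h * T) * P.real {ω | T ≤ Y ω}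
      / ∫ ω, Real.exp (h * Y ω - |h * (Y ω - T)|) ∂P) := by
  have hpre : (fun ω => h * (Y ω - T)) ⁻¹' Set.Ici 0 = {ω | T ≤ Y ω} := by
    ext ω
    simp [mul_nonneg_iff_of_pos_left hh]
  have hms : MeasurableSet {ω | T ≤ Y ω} := measurableSet_le measurable_const hm
  rw [doublyTiltedLaw, Measure.map_apply (by fun_prop) measurableSet_Ici, hpre,
    tilted_apply_eq_ofReal_integral' _ hms]
  congr 1
  rw [setIntegral_congr_fun (g := fun _ => Real.exp (h * T)
    / ∫ ω, Real.exp (h * Y ω - |h * (Y ω - T)|) ∂P) hms]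
  · rw [setIntegral_const, smul_eq_mul]
    ring
  · intro ω hω
    have hω' : 0 ≤ h * (Y ω - T) := mul_nonneg hh.le (sub_nonneg.2 hω)
    simp only [abs_of_nonneg hω']
    congr 2
    ring

end Tilted

/-! ### Tail probability from the Laplace limit -/

section Limit

/-- A tail asymptotic by exponential tilting: if the tilted characteristic functions converge to
the Gaussian one with suitable domination, the tilted law puts asymptotically the same mass on the
two sides of `T`. -/
theorem tendsto_tail_of_tiltedCharFun {Ω : ℕ → Type*} [∀ n, MeasurableSpace (Ω n)]
    {P : ∀ n, Measure (Ω n)} [∀ n, IsProbabilityMeasure (P n)] {Y : ∀ n, Ω n → ℝ}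
    (hm : ∀ n, Measurable (Y n)) (hb : ∀ n, ∃ B, ∀ ω, |Y n ω| ≤ B) {h T s R : ℕ → ℝ} {K : ℝ}
    (hK : 0 ≤ K) (hh : ∀ᶠ n in atTop, 0 < h n) (hs : Tendsto s atTop atTop)
    (hR : Tendsto R atTop atTop) (hsR : Tendsto (fun n => s n ^ 2 / R n) atTop (𝓝 0))
    (hΦ : ∀ η, Tendsto (fun n => tiltedCharFun (P n) (Y n) (h n) (T n) (h n / s n) η) atTop
      (𝓝 (Real.exp (-η ^ 2 / 2) : ℂ)))
    (hdom : ∀ᶠ n in atTop, ∀ η, |η| ≤ R n →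
      ‖tiltedCharFun (P n) (Y n) (h n) (T n) (h n / s n) η‖ ≤ K * Real.exp (-(1 / 4) * η ^ 2)) :
    Tendsto (fun n => (P n).real {ω | T n ≤ Y n ω} * Real.exp (h n * T n) * s n
      / mgf (Y n) (P n) (h n)) atTop (𝓝 (Real.sqrt (2 * Real.pi))⁻¹) := by
  choose B hB using hb
  set J : ℝ → ℕ → ℂ := fun lam n => ∫ η : ℝ, ((1 + (η / s n - lam) ^ 2)⁻¹ : ℝ) *
    tiltedCharFun (P n) (Y n) (h n) (T n) (h n / s n) η with hJ
  have hJlim : ∀ lam, Tendsto (J lam) atTop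
      (𝓝 (((1 + lam ^ 2)⁻¹ * Real.sqrt (2 * Real.pi) : ℝ) : ℂ)) := fun lam =>
    tendsto_integral_cauchy_mul hK
      (fun n => continuous_tiltedCharFun (hm n) (hB n) _ _ _)
      (fun n η => norm_tiltedCharFun_le (hm n) (hB n) _ _ _ _) hs hR hsR hΦ hdom lam
  have hr : (0 : ℝ) < Real.sqrt (2 * Real.pi) := Real.sqrt_pos.2 (by positivity)
  have hJ0 := hJlim 0
  simp only [ne_eq, OfNat.ofNat_ne_zero, not_false_eq_true, zero_pow, add_zero, inv_one,
    one_mul] at hJ0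
  have hspos : ∀ᶠ n in atTop, 0 < s n := hs.eventually_gt_atTop 0
  let ρ : ℕ → ProbabilityMeasure ℝ := fun n => ⟨doublyTiltedLaw (P n) (Y n) (h n) (T n),
    isProbabilityMeasure_doublyTiltedLaw (hm n) (hB n) _ _⟩
  let μ₀ : ProbabilityMeasure ℝ := ⟨laplaceMeasure, inferInstance⟩
  -- The factors √(2π) cancel in the quotient of limits, leaving 1/(1 + λ²), the characteristic
  -- function of the Laplace law.
  have hρ : Tendsto ρ atTop (𝓝 μ₀) := by
    refine ProbabilityMeasure.tendsto_of_tendsto_charFun fun lam => ?_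
    simp only [ρ, μ₀, ProbabilityMeasure.coe_mk]
    rw [charFun_laplaceMeasure]
    have h1 := (hJlim lam).div hJ0 (by exact_mod_cast hr.ne')
    rw [← Complex.ofReal_div, mul_div_cancel_right₀ _ hr.ne'] at h1
    refine h1.congr' ?_
    filter_upwards [hspos] with n hn
    exact (charFun_doublyTiltedLaw (hm n) (hB n) _ _ _ hn).symm
  have hhalf := ProbabilityMeasure.tendsto_measure_of_null_frontier_of_tendsto' hρ
    (E := Set.Ici 0) laplaceMeasure_frontier_Ici
  simp only [ρ, μ₀, ProbabilityMeasure.coe_mk, laplaceMeasure_Ici] at hhalf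
  have hhalf2 := (ENNReal.tendsto_toReal ENNReal.ofReal_ne_top).comp hhalf
  rw [ENNReal.toReal_ofReal (by norm_num)] at hhalf2
  have hre : Tendsto (fun n => (J 0 n).re) atTop (𝓝 (Real.sqrt (2 * Real.pi))) := by
    have := (Complex.continuous_re.tendsto _).comp hJ0
    rwa [Complex.ofReal_re] at this
  -- 1/2 is the Laplace mass of [0, ∞), and √(2π)/π comes from the normalizing constant.
  have hlim : (1 / 2 : ℝ) * (Real.sqrt (2 * Real.pi) / Real.pi)
      = (Real.sqrt (2 * Real.pi))⁻¹ := by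
    have h2 := Real.sq_sqrt (by positivity : (0 : ℝ) ≤ 2 * Real.pi)
    have := Real.pi_pos.ne'
    field_simp
    rw [h2]
  rw [← hlim]
  refine (hhalf2.mul (hre.div_const Real.pi)).congr' ?_
  filter_upwards [hspos, hh] with n hn hhn
  have hpos := mgf_pos_of_bounded (P := P n) (hm n) (hB n) (h n)
  set Z := ∫ ω, Real.exp (h n * Y n ω - |h n * (Y n ω - T n)|) ∂P n with hZ
  have hZpos : 0 < Z := integral_exp_pos (integrable_exp_doubly_tilted (hm n) (hB n) _ _)
  have hZe : Z = mgf (Y n) (P n) (h n) / (Real.pi * s n) * (J 0 n).re := by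
    have := congrArg Complex.re (integral_exp_doubly_tilted (P := P n) (hm n) (hB n)
      (h n) (T n) hn)
    rwa [Complex.ofReal_re, Complex.re_ofReal_mul] at this
  simp only [Function.comp_apply]
  rw [doublyTiltedLaw_Ici (hm n) hhn, ← hZ, ENNReal.toReal_ofReal (by positivity)]
  have hre0 : (J 0 n).re = Z * (Real.pi * s n) / mgf (Y n) (P n) (h n) := by
    rw [hZe]
    field_simp
  rw [hre0]
  field_simp

end Limit


/-! ### Precise moderate deviations -/

section TailAsymptotics

variable {Ω : ℕ → Type*} [∀ n, MeasurableSpace (Ω n)] {P : ∀ n, Measure (Ω n)}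
  {Y : ∀ n, Ω n → ℝ} {σ L : ℝ} {h : ℕ → ℝ}

lemma tendsto_zero_of_mul_sq (hx : Tendsto (fun n : ℕ => n * h n ^ 2) atTop (𝓝 0)) :
    Tendsto (fun n => |h n|) atTop (𝓝 0) := by
  have h1 : Tendsto (fun n => h n ^ 2) atTop (𝓝 0) := by
    refine squeeze_zero' (Eventually.of_forall fun n => sq_nonneg _) ?_ hx
    filter_upwards [eventually_ge_atTop 1] with n hn
    have : (1 : ℝ) ≤ n := by exact_mod_cast hn
    nlinarith [sq_nonneg (h n)]
  have := (Real.continuous_sqrt.tendsto 0).comp h1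
  simpa [Function.comp_def, Real.sqrt_sq_eq_abs] using this

/-- For fixed η the error exponent is a continuous function, vanishing at the origin, of nh², |h|
and 1/n, all of which tend to 0. -/
lemma CubicExpansion.tendsto_tiltedCharFun (hσ : 0 < σ) (hY : CubicExpansion P Y (σ ^ 2) L)
    (hx : Tendsto (fun n : ℕ => n * h n ^ 2) atTop (𝓝 0)) (η : ℝ) :
    Tendsto (fun n : ℕ => tiltedCharFun (P n) (Y n) (h n) ((n : ℝ) ^ 2 * σ ^ 2 * h n)
      ((σ * n)⁻¹) η) atTop (𝓝 (Real.exp (-η ^ 2 / 2) : ℂ)) := by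
  obtain ⟨c, C, hc, hC, hexp⟩ := hY
  have hh := tendsto_zero_of_mul_sq hx
  have hinv : Tendsto (fun n : ℕ => (n : ℝ)⁻¹) atTop (𝓝 0) := tendsto_inv_atTop_nhds_zero_nat
  set g : ℝ × ℝ × ℝ → ℝ := fun q => |L| / 6 * (3 * (q.1 * |η| / σ) + 3 * (q.2.1 * η ^ 2 / σ ^ 2)
    + |η| ^ 3 / σ ^ 3 * q.2.2) + C * (2 * q.1 + 3 * q.1 ^ 2
      + η ^ 2 / σ ^ 2 * q.2.2 + 2 * (η ^ 4 / σ ^ 4 * q.2.2 ^ 2)) with hg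
  have hgc : Continuous g := by fun_prop
  have hglim : Tendsto (fun n : ℕ => g (n * h n ^ 2, |h n|, (n : ℝ)⁻¹)) atTop (𝓝 0) := by
    have := (hgc.tendsto (0, 0, 0)).comp (hx.prodMk_nhds (hh.prodMk_nhds hinv))
    simpa [hg, Function.comp_def] using this
  have hsmall : Tendsto (fun n : ℕ => |h n| + |η| / σ * (n : ℝ)⁻¹) atTop (𝓝 0) := by
    simpa using hh.add (hinv.const_mul (|η| / σ))
  rw [tendsto_iff_norm_sub_tendsto_zero]
  refine squeeze_zero' (Eventually.of_forall fun n => norm_nonneg _) ?_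
    (by simpa using hglim.const_mul 2)
  filter_upwards [hexp, eventually_gt_atTop 0, hsmall.eventually_le_const hc,
    hglim.eventually_le_const one_pos] with n hn hn0 hcn hg1
  have hn0' : (0 : ℝ) < n := by exact_mod_cast hn0
  obtain ⟨E, hE, hE1, -⟩ := exists_tilted_expansion (M := complexMGF (Y n) (P n)) (η := η)
    (L := L) hn0' hσ hC rfl (by exact_mod_cast hn)
    (by rwa [div_mul_eq_div_div, div_eq_mul_inv (|η| / σ)] :
      |h n| + |η| / (σ * n) ≤ c)
  have hE2 : ‖E‖ ≤ 1 := hE1.trans hg1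
  rw [tiltedCharFun, hE, Complex.exp_add, Complex.ofReal_exp]
  have e1 : Complex.exp (-((η ^ 2 / 2 : ℝ) : ℂ)) * Complex.exp E
      - Complex.exp ((-η ^ 2 / 2 : ℝ) : ℂ)
      = Complex.exp ((-η ^ 2 / 2 : ℝ) : ℂ) * (Complex.exp E - 1) := by
    rw [← Complex.ofReal_neg, neg_div]
    ring
  rw [e1, norm_mul, ← Complex.ofReal_exp, Complex.norm_real,
    Real.norm_of_nonneg (Real.exp_pos _).le]
  calc Real.exp (-η ^ 2 / 2) * ‖Complex.exp E - 1‖ ≤ 1 * (2 * ‖E‖) := by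
        gcongr
        · rw [Real.exp_le_one_iff]
          nlinarith [sq_nonneg η]
        · exact Complex.norm_exp_sub_one_le hE2
    _ ≤ _ := by rw [one_mul]; gcongr

/-- Domination for |η| ≤ δn: three error terms cost at most η²/16 each out of η²/2, and the part
independent of η is at most 1. -/
lemma CubicExpansion.norm_tiltedCharFun_le_exp (hσ : 0 < σ) (hY : CubicExpansion P Y (σ ^ 2) L)
    (hx : Tendsto (fun n : ℕ => n * h n ^ 2) atTop (𝓝 0)) :
    ∃ δ : ℝ, 0 < δ ∧ ∀ᶠ n : ℕ in atTop, ∀ η, |η| ≤ δ * n →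
      ‖tiltedCharFun (P n) (Y n) (h n) ((n : ℝ) ^ 2 * σ ^ 2 * h n) ((σ * n)⁻¹) η‖
        ≤ Real.exp 1 * Real.exp (-(1 / 4) * η ^ 2) := by
  obtain ⟨c, C, hc, hC, hexp⟩ := hY
  have hh := tendsto_zero_of_mul_sq hx
  have hinv : Tendsto (fun n : ℕ => (n : ℝ)⁻¹) atTop (𝓝 0) := tendsto_inv_atTop_nhds_zero_nat
  -- The first bound keeps the argument in the disc of the expansion, using |h| ≤ c/2. The second
  -- brings the quartic error below η²/16; the +1 covers C = 0.
  set δ := min (c * σ / 2) (σ ^ 2 / (32 * C + 1)) with hδ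
  have hδ0 : 0 < δ := by positivity
  refine ⟨δ, hδ0, ?_⟩
  have h1 : Tendsto (fun n => |L| / 2 / σ ^ 2 * |h n|) atTop (𝓝 0) := by
    simpa using hh.const_mul (|L| / 2 / σ ^ 2)
  have h2 : Tendsto (fun n : ℕ => C / σ ^ 2 * (n : ℝ)⁻¹) atTop (𝓝 0) := by
    simpa using hinv.const_mul (C / σ ^ 2)
  have h3 : Tendsto (fun n : ℕ => C * (2 * (n * h n ^ 2) + 3 * (n * h n ^ 2) ^ 2)) atTop
      (𝓝 0) := by
    simpa using ((hx.const_mul 2).add ((hx.pow 2).const_mul 3)).const_mul C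
  have h4 : 2 * C * δ ^ 2 / σ ^ 4 ≤ 1 / 16 := by
    have : δ ^ 2 ≤ σ ^ 4 / (32 * C + 1) := by
      calc δ ^ 2 ≤ (σ ^ 2 / (32 * C + 1)) ^ 2 := by gcongr; exact min_le_right _ _
        _ = σ ^ 4 / (32 * C + 1) / (32 * C + 1) := by field_simp
        _ ≤ σ ^ 4 / (32 * C + 1) := div_le_self (by positivity) (by linarith)
    calc 2 * C * δ ^ 2 / σ ^ 4 ≤ 2 * C * (σ ^ 4 / (32 * C + 1)) / σ ^ 4 := by gcongr
      _ = 2 * C / (32 * C + 1) := by field_simp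
      _ ≤ 1 / 16 := by rw [div_le_div_iff₀ (by positivity) (by norm_num)]; linarith
  filter_upwards [hexp, eventually_gt_atTop 0, hh.eventually_le_const (half_pos hc),
    h1.eventually_le_const (by norm_num : (0 : ℝ) < 1 / 16),
    h2.eventually_le_const (by norm_num : (0 : ℝ) < 1 / 16),
    h3.eventually_le_const one_pos] with n hn hn0 hcn h1 h2 h3 η hη
  have hn0' : (0 : ℝ) < n := by exact_mod_cast hn0
  have hηc : |η| / (σ * n) ≤ c / 2 := by
    rw [div_le_iff₀ (by positivity)]
    calc |η| ≤ δ * n := hη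
      _ ≤ c * σ / 2 * n := by gcongr; exact min_le_left _ _
      _ = _ := by ring
  obtain ⟨E, hE, -, hE1⟩ := exists_tilted_expansion (M := complexMGF (Y n) (P n)) (η := η)
    (L := L) hn0' hσ hC rfl (by exact_mod_cast hn) (by linarith : |h n| + |η| / (σ * n) ≤ c)
  rw [tiltedCharFun, hE, Complex.norm_exp, ← Real.exp_add, Real.exp_le_exp, Complex.add_re,
    Complex.neg_re, Complex.ofReal_re]
  have hη2 : η ^ 2 ≤ δ ^ 2 * n ^ 2 := by
    rw [← sq_abs η, ← mul_pow]
    gcongr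
  have b1 : |L| / 2 * (|h n| * η ^ 2 / σ ^ 2) ≤ 1 / 16 * η ^ 2 := by
    calc |L| / 2 * (|h n| * η ^ 2 / σ ^ 2) = |L| / 2 / σ ^ 2 * |h n| * η ^ 2 := by ring
      _ ≤ _ := by gcongr
  have b2 : C * (η ^ 2 / σ ^ 2 * (n : ℝ)⁻¹) ≤ 1 / 16 * η ^ 2 := by
    calc C * (η ^ 2 / σ ^ 2 * (n : ℝ)⁻¹) = C / σ ^ 2 * (n : ℝ)⁻¹ * η ^ 2 := by ring
      _ ≤ _ := by gcongr
  have b3 : C * (2 * (η ^ 4 / σ ^ 4 * ((n : ℝ)⁻¹) ^ 2)) ≤ 1 / 16 * η ^ 2 := by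
    calc C * (2 * (η ^ 4 / σ ^ 4 * ((n : ℝ)⁻¹) ^ 2))
        = 2 * C / σ ^ 4 * (n : ℝ)⁻¹ ^ 2 * η ^ 2 * η ^ 2 := by ring
      _ ≤ 2 * C / σ ^ 4 * (n : ℝ)⁻¹ ^ 2 * (δ ^ 2 * n ^ 2) * η ^ 2 := by gcongr
      _ = 2 * C * δ ^ 2 / σ ^ 4 * η ^ 2 := by field_simp
      _ ≤ _ := by gcongr
  nlinarith [sq_nonneg η]

/-- Under a cubic expansion, the moment generating function at a real point `h` with
`n * h ^ 2 → 0` is asymptotic to its expansion. -/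
lemma CubicExpansion.tendsto_mgf_mul_exp (hY : CubicExpansion P Y (σ ^ 2) L)
    (hx : Tendsto (fun n : ℕ => n * h n ^ 2) atTop (𝓝 0)) :
    Tendsto (fun n : ℕ => mgf (Y n) (P n) (h n)
      * Real.exp (-((n : ℝ) ^ 2 * (σ ^ 2 * h n ^ 2 / 2 + L * h n ^ 3 / 6)))) atTop (𝓝 1) := by
  obtain ⟨c, C, hc, hC, hexp⟩ := hY
  have hh := tendsto_zero_of_mul_sq hx
  have h3 : Tendsto (fun n : ℕ => C * (n * h n ^ 2 + (n * h n ^ 2) ^ 2)) atTop (𝓝 0) := by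
    simpa using (hx.add (hx.pow 2)).const_mul C
  rw [tendsto_iff_norm_sub_tendsto_zero]
  refine squeeze_zero' (Eventually.of_forall fun n => norm_nonneg _) ?_
    (by simpa using h3.const_mul 2)
  filter_upwards [hexp, hh.eventually_le_const hc, h3.eventually_le_const one_pos]
    with n hn hcn h3
  obtain ⟨S, hS, hSe⟩ := hn (h n) (by rwa [Complex.norm_real, Real.norm_eq_abs])
  have hS' : ‖S‖ ≤ C * (n * h n ^ 2 + (n * h n ^ 2) ^ 2) := by
    refine hS.trans_eq ?_
    rw [Complex.norm_real, Real.norm_eq_abs, sq_abs, show |h n| ^ 4 = (|h n| ^ 2) ^ 2 by ring,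
      sq_abs]
    ring
  have e1 : ((mgf (Y n) (P n) (h n)
      * Real.exp (-((n : ℝ) ^ 2 * (σ ^ 2 * h n ^ 2 / 2 + L * h n ^ 3 / 6))) : ℝ) : ℂ)
      = Complex.exp S := by
    rw [Complex.ofReal_mul, ← complexMGF_ofReal, hSe, Complex.ofReal_exp, ← Complex.exp_add]
    congr 1
    push_cast
    ring
  rw [← Complex.norm_real, Complex.ofReal_sub, e1, Complex.ofReal_one]
  exact (Complex.norm_exp_sub_one_le (hS'.trans h3)).trans (by gcongr)

/-- Precise moderate deviations from a cubic expansion of the cumulant generating function. -/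
theorem CubicExpansion.isEquivalent [∀ n, IsProbabilityMeasure (P n)] (hσ : 0 < σ)
    (hY : CubicExpansion P Y (σ ^ 2) L) (hm : ∀ n, Measurable (Y n))
    (hb : ∀ n, ∃ B, ∀ ω, |Y n ω| ≤ B) {T : ℕ → ℝ}
    (hT1 : Tendsto (fun n => T n / n) atTop atTop)
    (hT2 : Tendsto (fun n => T n ^ 2 / n ^ 3) atTop (𝓝 0)) :
    Asymptotics.IsEquivalent atTop (fun n => (P n).real {ω | T n ≤ Y n ω})
      (fun n => Real.exp (-(T n ^ 2 / (2 * σ ^ 2 * alpha n)))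
        / Real.sqrt (2 * Real.pi * (T n ^ 2 / (σ ^ 2 * alpha n)))
        * Real.exp (L * T n ^ 3 / (6 * σ ^ 6 * alpha n ^ 2))) := by
  -- The saddle point of the Gaussian part, solving n²σ²h = T. The cubic correction to it is not
  -- needed: it shifts the tilted mean by O(n²h²), negligible against σn because nh² → 0.
  set h : ℕ → ℝ := fun n => T n / (σ ^ 2 * n ^ 2) with hh
  set s : ℕ → ℝ := fun n => T n / (σ * n) with hs
  have hTpos : ∀ᶠ n in atTop, 0 < T n ∧ (0 : ℝ) < n := by
    filter_upwards [hT1.eventually_gt_atTop 0, eventually_gt_atTop 0] with n hn hn0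
    have hn0' : (0 : ℝ) < n := by exact_mod_cast hn0
    exact ⟨by have := mul_pos hn hn0'; rwa [div_mul_cancel₀ _ hn0'.ne'] at this, hn0'⟩
  have hx : Tendsto (fun n : ℕ => n * h n ^ 2) atTop (𝓝 0) := by
    have := hT2.div_const (σ ^ 4)
    rw [zero_div] at this
    refine this.congr' ?_
    filter_upwards [hTpos] with n hn
    have := hn.2
    simp only [hh]
    field_simp
  have hslim : Tendsto s atTop atTop := by
    refine (hT1.atTop_div_const hσ).congr fun n => ?_
    rw [hs, div_div, mul_comm]
  obtain ⟨δ, hδ, hdom⟩ := hY.norm_tiltedCharFun_le_exp hσ hx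
  have hhs : ∀ᶠ n : ℕ in atTop, h n / s n = (σ * n)⁻¹ ∧ T n = (n : ℝ) ^ 2 * σ ^ 2 * h n := by
    filter_upwards [hTpos] with n ⟨hT, hn⟩
    simp only [hh, hs]
    constructor <;> field_simp
  have hR : Tendsto (fun n : ℕ => δ * (n : ℝ)) atTop atTop :=
    tendsto_natCast_atTop_atTop.const_mul_atTop hδ
  have hsR : Tendsto (fun n : ℕ => s n ^ 2 / (δ * n)) atTop (𝓝 0) := by
    have := hT2.div_const (σ ^ 2 * δ)
    rw [zero_div] at this
    refine this.congr fun n => ?_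
    simp only [hs]
    rw [div_pow, div_div, div_div]
    ring_nf
  have hΦ : ∀ η, Tendsto (fun n => tiltedCharFun (P n) (Y n) (h n) (T n) (h n / s n) η) atTop
      (𝓝 (Real.exp (-η ^ 2 / 2) : ℂ)) := fun η => by
    refine (hY.tendsto_tiltedCharFun hσ hx η).congr' ?_
    filter_upwards [hhs] with n ⟨h1, h2⟩
    rw [h1, ← h2]
  have hdom' : ∀ᶠ n : ℕ in atTop, ∀ η, |η| ≤ δ * n →
      ‖tiltedCharFun (P n) (Y n) (h n) (T n) (h n / s n) η‖
        ≤ Real.exp 1 * Real.exp (-(1 / 4) * η ^ 2) := by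
    filter_upwards [hhs, hdom] with n ⟨h1, h2⟩ h3
    rwa [h1, h2]
  have hhpos : ∀ᶠ n in atTop, 0 < h n := by
    filter_upwards [hTpos] with n ⟨hT, hn⟩
    positivity
  have hmain := (tendsto_tail_of_tiltedCharFun hm hb (Real.exp_pos 1).le hhpos hslim hR hsR hΦ
    hdom').mul (hY.tendsto_mgf_mul_exp hx)
  have hr : (0 : ℝ) < Real.sqrt (2 * Real.pi) := Real.sqrt_pos.2 (by positivity)
  have hmain2 := hmain.mul_const (Real.sqrt (2 * Real.pi))
  rw [mul_one, inv_mul_cancel₀ hr.ne'] at hmain2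
  have htarget : ∀ᶠ n in atTop, Real.exp (-(T n ^ 2 / (2 * σ ^ 2 * alpha n)))
        / Real.sqrt (2 * Real.pi * (T n ^ 2 / (σ ^ 2 * alpha n)))
        * Real.exp (L * T n ^ 3 / (6 * σ ^ 6 * alpha n ^ 2))
      = Real.exp (n ^ 2 * (σ ^ 2 * h n ^ 2 / 2 + L * h n ^ 3 / 6)) / Real.exp (h n * T n)
        / (Real.sqrt (2 * Real.pi) * s n) := by
    filter_upwards [hTpos] with n ⟨hT, hn⟩
    have e1 : T n ^ 2 / (σ ^ 2 * alpha n) = s n ^ 2 := by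
      simp only [hs, alpha]
      field_simp
    -- At the saddle point the quadratic part is half of hT, hence the net −T²/(2σ²n²).
    have e2 : (n : ℝ) ^ 2 * (σ ^ 2 * h n ^ 2 / 2 + L * h n ^ 3 / 6) - h n * T n
        = -(T n ^ 2 / (2 * σ ^ 2 * alpha n)) + L * T n ^ 3 / (6 * σ ^ 6 * alpha n ^ 2) := by
      simp only [hh, alpha]
      field_simp
      ring
    have hs0 : 0 ≤ s n := by positivity
    rw [e1, Real.sqrt_mul (by positivity), Real.sqrt_sq hs0, ← Real.exp_sub, e2, Real.exp_add]
    ring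
  have hne : ∀ᶠ n in atTop, Real.exp (n ^ 2 * (σ ^ 2 * h n ^ 2 / 2 + L * h n ^ 3 / 6))
      / Real.exp (h n * T n) / (Real.sqrt (2 * Real.pi) * s n) ≠ 0 := by
    filter_upwards [hTpos] with n ⟨hT, hn⟩
    have : 0 < s n := by positivity
    positivity
  refine Asymptotics.IsEquivalent.congr_right ?_ (htarget.mono fun n hn => hn.symm)
  rw [Asymptotics.isEquivalent_iff_tendsto_one hne]
  refine hmain2.congr' ?_
  filter_upwards [hTpos] with n ⟨hT, hn⟩
  obtain ⟨B, hB⟩ := hb n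
  have hpos := mgf_pos_of_bounded (P := P n) (hm n) hB (h n)
  have hs0 : 0 < s n := by positivity
  rw [Pi.div_apply, Real.exp_neg]
  field_simp

end TailAsymptotics

end ModGauss

end

/-! ### The theorem for subgraph counts -/

theorem theorem9p1 {k : ℕ} (γ : SimpleGraph (Fin k)) (hγ : 1 ≤ ModGauss.edgeCount γ)
    (p : unitInterval) (hp0 : 0 < (p : ℝ)) (hp1 : (p : ℝ) < 1)
    (σ L : ℝ) (hσ0 : 0 < σ) (hσ : σ ^ 2 = ModGauss.sigmaSq (ModGauss.edgeCount γ) p)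
    (hL : L = ModGauss.thirdCoeff (ModGauss.edgeCount γ) p) :
    ModGauss.ConvergesModGaussian ⊤
      (fun n => SimpleGraph.binomialRandom (Fin n) p)
      (fun n Γ => ModGauss.centeredCount γ p n Γ
        / (ModGauss.alpha n ^ (1 / 3 : ℝ) * ModGauss.beta k n))
      (fun n => σ ^ 2 * ModGauss.alpha n ^ (1 / 3 : ℝ))
      (fun z => Complex.exp ((L : ℂ) / 6 * z ^ 3))
    ∧ ∀ T : ℕ → ℝ,
      Tendsto (fun n => T n / ModGauss.alpha n ^ (1 / 2 : ℝ)) atTop atTop →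
      Tendsto (fun n => T n / ModGauss.alpha n ^ (3 / 4 : ℝ)) atTop (𝓝 0) →
      Asymptotics.IsEquivalent atTop
        (fun n => (SimpleGraph.binomialRandom (Fin n) p).real
          {Γ | T n ≤ ModGauss.centeredCount γ p n Γ / ModGauss.beta k n})
        (fun n => Real.exp (-(T n ^ 2 / (2 * σ ^ 2 * ModGauss.alpha n)))
          / Real.sqrt (2 * Real.pi * (T n ^ 2 / (σ ^ 2 * ModGauss.alpha n)))
          * Real.exp (L * T n ^ 3 / (6 * σ ^ 6 * ModGauss.alpha n ^ 2))) := by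
  have hY := ModGauss.cubicExpansion_centeredCount γ hγ p hp0
  rw [← hσ, ← hL] at hY
  have hm : ∀ n, Measurable fun Γ : SimpleGraph (Fin n) =>
    ModGauss.centeredCount γ p n Γ / ModGauss.beta k n := fun n => Measurable.of_discrete
  have hb : ∀ n, ∃ B, ∀ Γ : SimpleGraph (Fin n),
      |ModGauss.centeredCount γ p n Γ / ModGauss.beta k n| ≤ B := fun n => by
    obtain ⟨B, hB⟩ := (Set.finite_range fun Γ : SimpleGraph (Fin n) =>
      |ModGauss.centeredCount γ p n Γ / ModGauss.beta k n|).bddAbove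
    exact ⟨B, fun Γ => hB ⟨Γ, rfl⟩⟩
  refine ⟨?_, fun T hT1 hT2 => ?_⟩
  · have := hY.convergesModGaussian (by positivity) (fun n => (hm n).aemeasurable)
      fun n z => Integrable.of_finite
    simpa only [div_div, mul_comm (ModGauss.beta k _)] using this
  · refine hY.isEquivalent hσ0 hm hb ?_ ?_
    · refine hT1.congr fun n => ?_
      rw [ModGauss.alpha, ← Real.sqrt_eq_rpow, Real.sqrt_sq (Nat.cast_nonneg n)]
    -- T ≪ α^{3/4} is used in squared form, T²/n³ → 0, which up to a constant is nh² → 0.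
    · have := hT2.pow 2
      rw [zero_pow two_ne_zero] at this
      refine this.congr fun n => ?_
      rw [div_pow, ModGauss.alpha, ← Real.rpow_natCast (((n : ℝ) ^ 2) ^ (3 / 4 : ℝ)),
        ← Real.rpow_mul (by positivity), ← Real.rpow_natCast (n : ℝ) 2,
        ← Real.rpow_mul (Nat.cast_nonneg n), ← Real.rpow_natCast (n : ℝ) 3]
      norm_num
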